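/- Let $k$ be a field, $A$ an associative unital $k$-algebra and $M=\{M_1,\dots,M_r\}$ a finite family of right $A$-modules such that all $\mathrm{Ext}^1_A(M_i,M_j)$ are finite-dimensional over $k$. **Deformation functor.** An $r$-pointed $k$-algebra is a $k$-algebra $R$ with $k$-algebra homomorphisms $k^r\to R\to k^r$ composing to the identity; $I(R)=\ker(R\to k^r)$; morphisms are algebra homomorphisms commuting with both structure maps. $\mathbf{Art}_k$ consists of the $R$ with $\dim_kR<\infty$ and $I(R)$ nilpotent. $R$ is formal if every $R/I(R)^n$ is finite-dimensional and $R$ is separated and complete for the $I(R)$-adic topology. A deformation of $M$ to $S$ is an $S$-$A$-bimodule $M_S$ on which $k$ acts centrally, isomorphic to $S\otimes_{k^r}\bigoplus_iM_i$ as left $S$-module, together with an isomorphism of $k^r$-$A$-bimodules $k^r\otimes_SM_S\simeq\bigoplus_iM_i$. Two deformations are equivalent if they are isomorphic as bimodules compatibly with the isomorphisms to $\bigoplus_iM_i$. $\mathrm{Def}_M(S)$ is the set of equivalence classes, functorial by $M_S\mapsto S'\otimes_SM_S$. A prorepresenting hull of $\mathrm{Def}_M$ is a formal $r$-pointed algebra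 $H$ for which there is a morphism of functors $\eta:\mathrm{Mor}(H,-)\to\mathrm{Def}_M$ on $\mathbf{Art}_k$ (equivalently, an element of $\varprojlim_n\mathrm{Def}_M(H/I(H)^n)$) such that $\mathrm{Mor}(H,R)\to\mathrm{Mor}(H,S)\times_{\mathrm{Def}_M(S)}\mathrm{Def}_M(R)$ is surjective for every surjection $R\to S$ in $\mathbf{Art}_k$, and $\eta_R$ is bijective whenever $I(R)^2=0$. **Construction of $\hat A_M$.** Let $C^p_{ij}=\mathrm{Hom}_k(A^{\otimes p},\mathrm{Hom}_k(M_i,M_j))$ be the Hochschild cochains, with $(d\varphi)(a,b)(m)=\varphi(b)(ma)-\varphi(ab)(m)+\varphi(a)(m)\,b$ on $C^1_{ij}$ and $(\varphi\cup\psi)(a,b)=\psi(b)\circ\varphi(a)$ for $\varphi\in C^1_{ij}$, $\psi\in C^1_{js}$; then $H^1(C^\bullet_{ij})=\mathrm{Ext}^1_A(M_i,M_j)$. This is the ($r\times r$ matrix) GMMP-algebra $(C^1(A,M),C^2(A,M),\cup,d)$. Choose cocycles $x_{ij}(l)\in C^1_{ij}$, $1\le l\le\dim_k\mathrm{Ext}^1_A(M_i,M_j)$,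 whose classes form a basis. Let $T$ be the tensor algebra over $k^r$ on variables (again denoted) $x_{ij}(l)$ in position $(i,j)$, $\mathfrak m=\ker(T\to k^r)$; a monomial is an idempotent $e_i$ or a composable word in the variables. Construct ideals $J_N$ of $T$, sets of monomials $B_N$ and cochains $v_u\in C^1_{ij}$ for monomials $u$ of positive degree in $\bar B_N=B_0\cup\dots\cup B_N$ in position $(i,j)$ as follows. $J_0=\mathfrak m$, $J_1=\mathfrak m^2$, $B_0=\{e_i\}$, $B_1=\{x_{ij}(l)\}$, and $v_u$ is the chosen cocycle for a variable $u$. For $N\ge1$, $J_{N+1}$ is generated by $\mathfrak mJ_N+J_N\mathfrak m$ and all $f_y^{N+1}=\sum_{p,q}y(v_p\cup v_q)\,pq$, where $p,q$ run over the pairs of monomials of positive degree in $\bar B_N$ with $p$ in position $(i,s)$ and $q$ in position $(s,j)$ for some $s$, and $y$ runs over the linear forms on $C^2_{ij}/\operatorname{im}d$, for all $i,j$; $B_{N+1}$ is any set of monomials which is a basis of $\ker(T/J_{N+1}\to T/J_N)$; and for $u\in B_{N+1}$, $v_u$ is any cochain with $d(v_u)=-\sum_{p,q}\beta_{pq,u}\,v_p\cup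 v_q$, where $t\equiv\sum_{u\in\bar B_{N+1}}\beta_{t,u}\,u\pmod{J_{N+1}}$ for monomials $t$. Put $\hat A_M=\varprojlim_NT/J_N$, an $r$-pointed algebra. **Proposition.** For every choice of representatives $x_{ij}(l)$ of bases, the choices of $B_N$ and $v_u$ can be made at all stages, and for all such choices $\hat A_M$ is a prorepresenting hull of the noncommutative deformation functor $\mathrm{Def}_M$. -/

import Mathlib

open scoped TensorProduct

universe u v w x y

noncomputable section

namespace NCDef

/-! ### Pointed algebras -/

/-- An `r`-pointed `k`-algebra: a `k`-algebra `R` with algebra homomorphisms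
`k^r → R → k^r` whose composition is the identity. -/
structure PointedAlg (k : Type u) [Field k] (r : ℕ) where
  carrier : Type u
  [ring : Ring carrier]
  [algebra : Algebra k carrier]
  incl : (Fin r → k) →ₐ[k] carrier
  aug : carrier →ₐ[k] (Fin r → k)
  aug_incl : ∀ c, aug (incl c) = c

attribute [instance] PointedAlg.ring PointedAlg.algebra

namespace PointedAlg

variable {k : Type u} [Field k] {r : ℕ}

/-- A morphism of `r`-pointed algebras: an algebra homomorphism which commutes with the
structure maps from and to `k^r`. -/
@[ext]
structure Hom (R S : PointedAlg k r) where
  toAlgHom : R.carrier →ₐ[k] S.carrier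
  comp_incl : toAlgHom.comp R.incl = S.incl
  aug_comp : S.aug.comp toAlgHom = R.aug

instance : CategoryTheory.Category (PointedAlg k r) where
  Hom := Hom
  id R := ⟨AlgHom.id k R.carrier, by ext; rfl, by ext; rfl⟩
  comp f g := ⟨g.toAlgHom.comp f.toAlgHom,
    by rw [AlgHom.comp_assoc, f.comp_incl, g.comp_incl],
    by rw [← AlgHom.comp_assoc, g.aug_comp, f.aug_comp]⟩

/-- The augmentation ideal `I(R)`, the kernel of `R → k^r`. -/
def augIdeal (R : PointedAlg k r) : Ideal R.carrier := RingHom.ker R.aug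

instance (R : PointedAlg k r) : R.augIdeal.IsTwoSided :=
  inferInstanceAs (RingHom.ker R.aug).IsTwoSided

/-- `R` is an object of `Art_k`: it is Artinian, i.e. of finite dimension over `k`, and its
augmentation ideal is nilpotent. -/
def IsArt (R : PointedAlg k r) : Prop :=
  Module.Finite k R.carrier ∧ ∃ n : ℕ, R.augIdeal ^ n = ⊥

/-- `R` is a formal `r`-pointed algebra: all the quotients `R / I(R) ^ n` are of finite dimension
(hence they lie in `Art_k` for `n ≥ 1`), and `R` is the limit of these quotients, i.e. `R` is
separated and complete for the `I(R)`-adic topology. -/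
def IsFormal (R : PointedAlg k r) : Prop :=
  (∀ n : ℕ, Module.Finite k (R.carrier ⧸ R.augIdeal ^ n)) ∧
  (∀ a : R.carrier, (∀ n : ℕ, a ∈ R.augIdeal ^ n) → a = 0) ∧
  (∀ a : ℕ → R.carrier, (∀ n, a (n + 1) - a n ∈ R.augIdeal ^ n) →
    ∃ l : R.carrier, ∀ n, l - a n ∈ R.augIdeal ^ n)

end PointedAlg

open CategoryTheory in
/-- `H` is a prorepresenting hull of the functor `F` on `Art_k`: `H` is a formal `r`-pointed
algebra, and there is a morphism of functors `η : Mor(H, -) ⟶ F` on `Art_k` (by Yoneda's lemma,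
this is the same as an element of `lim_n F (H / I(H) ^ n)`) which is smooth, i.e.
`Mor(H, R) → Mor(H, S) ×_{F S} F R` is surjective for every surjection `R ⟶ S` in `Art_k`, and
which is bijective on all `R` in `Art_k` with `I(R) ^ 2 = 0`. -/
def IsProrepHull {k : Type u} [Field k] {r : ℕ} (F : PointedAlg k r ⥤ Type w)
    (H : PointedAlg k r) : Prop :=
  H.IsFormal ∧
  ∃ η : ∀ R : PointedAlg k r, R.IsArt → (H ⟶ R) → F.obj R,
    (∀ (R S : PointedAlg k r) (hR : R.IsArt) (hS : S.IsArt) (f : R ⟶ S) (a : H ⟶ R),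
      η S hS (a ≫ f) = F.map f (η R hR a)) ∧
    (∀ (R S : PointedAlg k r) (hR : R.IsArt) (hS : S.IsArt) (f : R ⟶ S),
      Function.Surjective f.toAlgHom →
      ∀ (b : H ⟶ S) (ξ : F.obj R), F.map f ξ = η S hS b →
        ∃ a : H ⟶ R, a ≫ f = b ∧ η R hR a = ξ) ∧
    (∀ (R : PointedAlg k r) (hR : R.IsArt), R.augIdeal ^ 2 = ⊥ →
      Function.Bijective (η R hR))

/-! ### Bimodules and extension of scalars -/

/-- A `B`-`A`-bimodule (left over `B`, right over `A`) on which `k` acts centrally, i.e. a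
`B ⊗_k A`-module with `B` acting on the left and `A` on the right. -/
structure Bimod (k : Type u) [Field k] (B : Type y) [Ring B] [Algebra k B]
    (A : Type w) [Ring A] [Algebra k A] where
  carrier : Type x
  [addCommGroup : AddCommGroup carrier]
  [left : Module B carrier]
  [right : Module Aᵐᵒᵖ carrier]
  [smulComm : SMulCommClass B Aᵐᵒᵖ carrier]
  central : ∀ (c : k) (m : carrier),
    algebraMap k B c • m = MulOpposite.op (algebraMap k A c) • m

attribute [instance] Bimod.addCommGroup Bimod.left Bimod.right Bimod.smulComm

namespace Bimod

variable {k : Type u} [Field k] {A : Type w} [Ring A] [Algebra k A]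
variable {B : Type*} [Ring B] [Algebra k B] {C : Type*} [Ring C] [Algebra k C]
variable {D : Type*} [Ring D] [Algebra k D]

/-- Isomorphisms of bimodules. -/
structure Equiv (X : Bimod k B A) (Y : Bimod k B A) where
  toLin : X.carrier ≃ₗ[B] Y.carrier
  map_right : ∀ (a : Aᵐᵒᵖ) (m : X.carrier), toLin (a • m) = a • toLin m

namespace Equiv

def refl (X : Bimod k B A) : Equiv X X := ⟨LinearEquiv.refl B _, fun _ _ => rfl⟩

def symm {X : Bimod k B A} {Y : Bimod k B A} (e : Equiv X Y) : Equiv Y X :=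
  ⟨e.toLin.symm, fun a m => e.toLin.injective (by simp [e.map_right])⟩

def trans {X : Bimod k B A} {Y : Bimod k B A} {Z : Bimod k B A}
    (e : Equiv X Y) (f : Equiv Y Z) : Equiv X Z :=
  ⟨e.toLin.trans f.toLin, fun a m => by simp [e.map_right, f.map_right]⟩

end Equiv

/-- The relations `c φ(b) ⊗ m = c ⊗ b m` of the balanced tensor product `C ⊗_B X`. -/
def balance (φ : B →ₐ[k] C) (X : Bimod k B A) : Submodule C (C ⊗[ℤ] X.carrier) :=
  Submodule.span C
    {z | ∃ (c : C) (b : B) (m : X.carrier), z = (c * φ b) ⊗ₜ[ℤ] m - c ⊗ₜ[ℤ] (b • m)}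

/-- The left `C`-module `C ⊗_B X`. -/
abbrev ExtendCarrier (φ : B →ₐ[k] C) (X : Bimod k B A) :=
  (C ⊗[ℤ] X.carrier) ⧸ balance φ X

/-- The canonical map `m ↦ 1 ⊗ m`, before `C ⊗_B X` is made a bimodule. -/
def preUnit (φ : B →ₐ[k] C) (X : Bimod k B A) : X.carrier →+ ExtendCarrier φ X where
  toFun m := (balance φ X).mkQ ((1 : C) ⊗ₜ[ℤ] m)
  map_zero' := by simp
  map_add' m n := by rw [TensorProduct.tmul_add, map_add]

theorem preUnit_smul (φ : B →ₐ[k] C) (X : Bimod k B A) (b : B) (m : X.carrier) :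
    preUnit φ X (b • m) = φ b • preUnit φ X m := by
  symm
  change φ b • (balance φ X).mkQ ((1 : C) ⊗ₜ[ℤ] m) = (balance φ X).mkQ ((1 : C) ⊗ₜ[ℤ] (b • m))
  rw [← map_smul, ← sub_eq_zero, ← map_sub, ← LinearMap.mem_ker, Submodule.ker_mkQ]
  refine Submodule.subset_span ⟨1, b, m, ?_⟩
  rw [TensorProduct.smul_tmul', smul_eq_mul, mul_one, one_mul]

/-- The map `c ⊗ m ↦ c • g m` on `C ⊗_B X` for a `φ`-semilinear map `g`. -/
def preLift (φ : B →ₐ[k] C) (X : Bimod k B A) {Y : Type*} [AddCommGroup Y] [Module C Y]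
    (g : X.carrier →+ Y) (hg : ∀ (b : B) (m : X.carrier), g (b • m) = φ b • g m) :
    ExtendCarrier φ X →ₗ[C] Y :=
  (balance φ X).liftQ
    (TensorProduct.AlgebraTensorModule.lift
      { toFun := fun c => ((DistribSMul.toAddMonoidHom Y c).comp g).toIntLinearMap
        map_add' := fun c c' => by ext m; simp [add_smul]
        map_smul' := fun c c' => by ext m; simp [mul_smul] })
    (by
      rw [balance, Submodule.span_le]
      rintro _ ⟨c, b, m, rfl⟩
      simp [hg, mul_smul])

theorem preLift_unit (φ : B →ₐ[k] C) (X : Bimod k B A) {Y : Type*} [AddCommGroup Y]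
    [Module C Y] (g : X.carrier →+ Y)
    (hg : ∀ (b : B) (m : X.carrier), g (b • m) = φ b • g m) (m : X.carrier) :
    preLift φ X g hg (preUnit φ X m) = g m := by
  simp [preLift, preUnit]

theorem preExt (φ : B →ₐ[k] C) (X : Bimod k B A) {Y : Type*} [AddCommGroup Y]
    [Module C Y] {f g : ExtendCarrier φ X →ₗ[C] Y}
    (h : ∀ m, f (preUnit φ X m) = g (preUnit φ X m)) : f = g := by
  apply Submodule.linearMap_qext
  apply LinearMap.ext
  intro z
  induction z using TensorProduct.induction_on with
  | zero => simp
  | add a b ha hb => rw [map_add, map_add, ha, hb]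
  | tmul c m =>
    have hc : c ⊗ₜ[ℤ] m = c • ((1 : C) ⊗ₜ[ℤ] m) := by
      rw [TensorProduct.smul_tmul', smul_eq_mul, mul_one]
    rw [hc, map_smul, map_smul]
    exact congrArg (c • ·) (h m)

/-- The right action of `A` on `C ⊗_B X`, namely `(c ⊗ m) a = c ⊗ m a`. -/
def actHom (φ : B →ₐ[k] C) (X : Bimod k B A) :
    Aᵐᵒᵖ →+* Module.End C (ExtendCarrier φ X) where
  toFun a := preLift φ X ((preUnit φ X).comp (DistribSMul.toAddMonoidHom X.carrier a))
    (fun b m => by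
      change preUnit φ X (a • b • m) = φ b • preUnit φ X (a • m)
      rw [← smul_comm b a m, preUnit_smul])
  map_one' := preExt φ X fun m => by simp [preLift_unit]
  map_mul' a b := preExt φ X fun m => by simp [preLift_unit, mul_smul]
  map_zero' := preExt φ X fun m => by simp [preLift_unit]
  map_add' a b := preExt φ X fun m => by simp [preLift_unit, add_smul]

theorem actHom_unit (φ : B →ₐ[k] C) (X : Bimod k B A) (a : Aᵐᵒᵖ) (m : X.carrier) :
    actHom φ X a (preUnit φ X m) = preUnit φ X (a • m) := by
  simp [actHom, preLift_unit]

/-- Extension of scalars `C ⊗_B X` along `φ : B → C`, for a `B`-`A`-bimodule `X`. -/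
def extend (φ : B →ₐ[k] C) (X : Bimod k B A) : Bimod k C A where
  carrier := ExtendCarrier φ X
  right := Module.compHom _ (actHom φ X)
  smulComm :=
    letI : Module Aᵐᵒᵖ (ExtendCarrier φ X) := Module.compHom _ (actHom φ X)
    ⟨fun c a z => (map_smul (actHom φ X a) c z).symm⟩
  central c z := by
    let f : ExtendCarrier φ X →ₗ[C] ExtendCarrier φ X :=
      { toFun := fun z => algebraMap k C c • z
        map_add' := fun z z' => smul_add _ z z'
        map_smul' := fun c' z => by
          rw [RingHom.id_apply, ← mul_smul, ← mul_smul, Algebra.commutes] }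
    have key : f = actHom φ X (MulOpposite.op (algebraMap k A c)) := preExt φ X fun m => by
      rw [actHom_unit, ← X.central, preUnit_smul, AlgHom.commutes]
      rfl
    exact LinearMap.congr_fun key z

/-- The canonical map `X → C ⊗_B X`, `m ↦ 1 ⊗ m`. -/
def unit (φ : B →ₐ[k] C) (X : Bimod k B A) : X.carrier →+ (extend φ X).carrier := preUnit φ X

theorem unit_smul (φ : B →ₐ[k] C) (X : Bimod k B A) (b : B) (m : X.carrier) :
    unit φ X (b • m) = φ b • unit φ X m := preUnit_smul φ X b m

theorem unit_right (φ : B →ₐ[k] C) (X : Bimod k B A) (a : Aᵐᵒᵖ) (m : X.carrier) :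
    unit φ X (a • m) = a • unit φ X m := (actHom_unit φ X a m).symm

/-- The universal property of `C ⊗_B X`. -/
def lift (φ : B →ₐ[k] C) (X : Bimod k B A) {Y : Type*} [AddCommGroup Y] [Module C Y]
    (g : X.carrier →+ Y) (hg : ∀ (b : B) (m : X.carrier), g (b • m) = φ b • g m) :
    (extend φ X).carrier →ₗ[C] Y := preLift φ X g hg

theorem lift_unit (φ : B →ₐ[k] C) (X : Bimod k B A) {Y : Type*} [AddCommGroup Y]
    [Module C Y] (g : X.carrier →+ Y)
    (hg : ∀ (b : B) (m : X.carrier), g (b • m) = φ b • g m) (m : X.carrier) :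
    lift φ X g hg (unit φ X m) = g m := preLift_unit φ X g hg m

theorem extend_ext (φ : B →ₐ[k] C) (X : Bimod k B A) {Y : Type*} [AddCommGroup Y]
    [Module C Y] {f g : (extend φ X).carrier →ₗ[C] Y}
    (h : ∀ m, f (unit φ X m) = g (unit φ X m)) : f = g := preExt φ X h

theorem linear_right (φ : B →ₐ[k] C) (X : Bimod k B A) (Y : Bimod k C A)
    (f : (extend φ X).carrier →ₗ[C] Y.carrier)
    (hr : ∀ (a : Aᵐᵒᵖ) (m : X.carrier), f (unit φ X (a • m)) = a • f (unit φ X m))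
    (a : Aᵐᵒᵖ) (z : (extend φ X).carrier) : f (a • z) = a • f z := by
  let f₁ : (extend φ X).carrier →ₗ[C] Y.carrier :=
    { toFun := fun z => f (a • z)
      map_add' := fun z z' => by rw [smul_add, map_add]
      map_smul' := fun c z => by rw [← smul_comm c a, map_smul, RingHom.id_apply] }
  let f₂ : (extend φ X).carrier →ₗ[C] Y.carrier :=
    { toFun := fun z => a • f z
      map_add' := fun z z' => by rw [map_add, smul_add]
      map_smul' := fun c z => by rw [map_smul, RingHom.id_apply, smul_comm c a] }
  have key : f₁ = f₂ := extend_ext φ X fun m => by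
    change f (a • unit φ X m) = a • f (unit φ X m)
    rw [← unit_right, hr]
  exact LinearMap.congr_fun key z

/-- A `φ`-semilinear bimodule map `g : X → Y` induces an isomorphism `C ⊗_B X ≃ Y` as soon as the
induced map has an inverse. -/
def equivOfLift (φ : B →ₐ[k] C) (X : Bimod k B A) (Y : Bimod k C A)
    (g : X.carrier →+ Y.carrier) (hg : ∀ (b : B) (m : X.carrier), g (b • m) = φ b • g m)
    (hr : ∀ (a : Aᵐᵒᵖ) (m : X.carrier), g (a • m) = a • g m)
    (h : Y.carrier →ₗ[C] (extend φ X).carrier) (h1 : ∀ m, h (g m) = unit φ X m)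
    (h2 : (lift φ X g hg).comp h = LinearMap.id) : Equiv (extend φ X) Y where
  toLin := LinearEquiv.ofLinearMap (lift φ X g hg) h h2
    (extend_ext φ X fun m => by
      rw [LinearMap.comp_apply, lift_unit, h1, LinearMap.id_apply])
  map_right a z := linear_right φ X Y (lift φ X g hg) (fun a m => by
    rw [lift_unit, lift_unit, hr]) a z

theorem equivOfLift_unit (φ : B →ₐ[k] C) (X : Bimod k B A) (Y : Bimod k C A)
    (g : X.carrier →+ Y.carrier) (hg : ∀ (b : B) (m : X.carrier), g (b • m) = φ b • g m)
    (hr : ∀ (a : Aᵐᵒᵖ) (m : X.carrier), g (a • m) = a • g m)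
    (h : Y.carrier →ₗ[C] (extend φ X).carrier) (h1 : ∀ m, h (g m) = unit φ X m)
    (h2 : (lift φ X g hg).comp h = LinearMap.id) (m : X.carrier) :
    (equivOfLift φ X Y g hg hr h h1 h2).toLin (unit φ X m) = g m :=
  lift_unit φ X g hg m

theorem unit_map_smul (φ : B →ₐ[k] C) {X : Bimod k B A} {Y : Bimod k B A}
    (e : X.carrier →ₗ[B] Y.carrier) (b : B) (m : X.carrier) :
    ((unit φ Y).comp e.toAddMonoidHom) (b • m) = φ b • ((unit φ Y).comp e.toAddMonoidHom) m := by
  change unit φ Y (e (b • m)) = φ b • unit φ Y (e m)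
  rw [map_smul, unit_smul]

/-- Functoriality of `C ⊗_B X` in the left `B`-module `X`. -/
def extendMap (φ : B →ₐ[k] C) {X : Bimod k B A} {Y : Bimod k B A}
    (e : X.carrier →ₗ[B] Y.carrier) : (extend φ X).carrier →ₗ[C] (extend φ Y).carrier :=
  lift φ X ((unit φ Y).comp e.toAddMonoidHom) (unit_map_smul φ e)

theorem extendMap_unit (φ : B →ₐ[k] C) {X : Bimod k B A} {Y : Bimod k B A}
    (e : X.carrier →ₗ[B] Y.carrier) (m : X.carrier) :
    extendMap φ e (unit φ X m) = unit φ Y (e m) :=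
  lift_unit φ X ((unit φ Y).comp e.toAddMonoidHom) (unit_map_smul φ e) m

def extendLin (φ : B →ₐ[k] C) {X : Bimod k B A} {Y : Bimod k B A}
    (e : X.carrier ≃ₗ[B] Y.carrier) : (extend φ X).carrier ≃ₗ[C] (extend φ Y).carrier :=
  LinearEquiv.ofLinearMap (extendMap φ e.toLinearMap) (extendMap φ e.symm.toLinearMap)
    (extend_ext φ Y fun m => by simp [extendMap_unit])
    (extend_ext φ X fun m => by simp [extendMap_unit])

theorem extendLin_unit (φ : B →ₐ[k] C) {X : Bimod k B A} {Y : Bimod k B A}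
    (e : X.carrier ≃ₗ[B] Y.carrier) (m : X.carrier) :
    extendLin φ e (unit φ X m) = unit φ Y (e m) :=
  extendMap_unit φ e.toLinearMap m

def extendCongr (φ : B →ₐ[k] C) {X : Bimod k B A} {Y : Bimod k B A} (e : Equiv X Y) :
    Equiv (extend φ X) (extend φ Y) where
  toLin := extendLin φ e.toLin
  map_right a z := linear_right φ X (extend φ Y) (extendMap φ e.toLin.toLinearMap)
    (fun a m => by
      rw [extendMap_unit, extendMap_unit, ← unit_right]
      exact congrArg _ (e.map_right a m)) a z

/-- Extensions of scalars along equal homomorphisms are isomorphic. -/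
def extendOfEq {φ φ' : B →ₐ[k] C} (h : φ = φ') (X : Bimod k B A) :
    Equiv (extend φ X) (extend φ' X) := h ▸ Equiv.refl _

theorem extendOfEq_unit {φ φ' : B →ₐ[k] C} (h : φ = φ') (X : Bimod k B A) (m : X.carrier) :
    (extendOfEq h X).toLin (unit φ X m) = unit φ' X m := by
  subst h; rfl

/-- `B ⊗_B X ≃ X`. -/
def extendId (X : Bimod k B A) : Equiv (extend (AlgHom.id k B) X) X :=
  equivOfLift (AlgHom.id k B) X X (AddMonoidHom.id _) (fun _ _ => rfl) (fun _ _ => rfl)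
    { toFun := unit (AlgHom.id k B) X
      map_add' := map_add _
      map_smul' := unit_smul (AlgHom.id k B) X }
    (fun _ => rfl)
    (LinearMap.ext fun m => lift_unit (AlgHom.id k B) X (AddMonoidHom.id _) (fun _ _ => rfl) m)

theorem extendId_unit (X : Bimod k B A) (m : X.carrier) :
    (extendId X).toLin (unit (AlgHom.id k B) X m) = m :=
  lift_unit (AlgHom.id k B) X (AddMonoidHom.id _) (fun _ _ => rfl) m

/-- A semilinear variant of `lift`. -/
def liftSemi (φ : B →ₐ[k] C) (ψ : C →ₐ[k] D) (X : Bimod k B A) {Y : Type*} [AddCommGroup Y]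
    [Module D Y] (g : X.carrier →+ Y)
    (hg : ∀ (b : B) (m : X.carrier), g (b • m) = (ψ.comp φ) b • g m) :
    (extend φ X).carrier →+ Y :=
  letI : Module C Y := Module.compHom Y ψ.toRingHom
  (lift φ X g hg).toAddMonoidHom

theorem liftSemi_smul (φ : B →ₐ[k] C) (ψ : C →ₐ[k] D) (X : Bimod k B A) {Y : Type*}
    [AddCommGroup Y] [Module D Y] (g : X.carrier →+ Y)
    (hg : ∀ (b : B) (m : X.carrier), g (b • m) = (ψ.comp φ) b • g m) (c : C)
    (z : (extend φ X).carrier) :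
    liftSemi φ ψ X g hg (c • z) = ψ c • liftSemi φ ψ X g hg z :=
  letI : Module C Y := Module.compHom Y ψ.toRingHom
  map_smul (lift φ X g hg) c z

theorem liftSemi_unit (φ : B →ₐ[k] C) (ψ : C →ₐ[k] D) (X : Bimod k B A) {Y : Type*}
    [AddCommGroup Y] [Module D Y] (g : X.carrier →+ Y)
    (hg : ∀ (b : B) (m : X.carrier), g (b • m) = (ψ.comp φ) b • g m) (m : X.carrier) :
    liftSemi φ ψ X g hg (unit φ X m) = g m :=
  letI : Module C Y := Module.compHom Y ψ.toRingHom
  lift_unit φ X g hg m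

theorem liftSemi_ext (φ : B →ₐ[k] C) (ψ : C →ₐ[k] D) (X : Bimod k B A) {Y : Type*}
    [AddCommGroup Y] [Module D Y] {f g : (extend φ X).carrier →+ Y}
    (hf : ∀ (c : C) (z : (extend φ X).carrier), f (c • z) = ψ c • f z)
    (hg : ∀ (c : C) (z : (extend φ X).carrier), g (c • z) = ψ c • g z)
    (h : ∀ m, f (unit φ X m) = g (unit φ X m)) (z : (extend φ X).carrier) : f z = g z :=
  letI : Module C Y := Module.compHom Y ψ.toRingHom
  LinearMap.congr_fun (extend_ext φ X
    (f := { toFun := f, map_add' := map_add f, map_smul' := hf })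
    (g := { toFun := g, map_add' := map_add g, map_smul' := hg }) h) z

theorem unit_unit_smul (φ : B →ₐ[k] C) (ψ : C →ₐ[k] D) (X : Bimod k B A) (b : B)
    (m : X.carrier) : ((unit ψ (extend φ X)).comp (unit φ X)) (b • m) =
      (ψ.comp φ) b • ((unit ψ (extend φ X)).comp (unit φ X)) m := by
  rw [AddMonoidHom.comp_apply, AddMonoidHom.comp_apply, unit_smul, unit_smul]
  rfl

/-- `D ⊗_B X ≃ D ⊗_C (C ⊗_B X)`. -/
def extendComp (φ : B →ₐ[k] C) (ψ : C →ₐ[k] D) (X : Bimod k B A) :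
    Equiv (extend (ψ.comp φ) X) (extend ψ (extend φ X)) :=
  equivOfLift (ψ.comp φ) X (extend ψ (extend φ X))
    ((unit ψ (extend φ X)).comp (unit φ X))
    (unit_unit_smul φ ψ X)
    (fun a m => by
      rw [AddMonoidHom.comp_apply, AddMonoidHom.comp_apply, unit_right, unit_right])
    (lift ψ (extend φ X)
      (liftSemi φ ψ X (unit (ψ.comp φ) X) (unit_smul (ψ.comp φ) X))
      (liftSemi_smul φ ψ X _ _))
    (fun m => by
      rw [AddMonoidHom.comp_apply, lift_unit, liftSemi_unit])
    (extend_ext ψ (extend φ X) fun y => by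
      rw [LinearMap.comp_apply, lift_unit, LinearMap.id_apply]
      refine liftSemi_ext φ ψ X
        (f := (lift (ψ.comp φ) X _ (unit_unit_smul φ ψ X)).toAddMonoidHom.comp
          (liftSemi φ ψ X _ (unit_smul (ψ.comp φ) X)))
        (g := unit ψ (extend φ X)) (fun c z => ?_) (fun c z => unit_smul ψ (extend φ X) c z)
        (fun m => ?_) y
      · rw [AddMonoidHom.comp_apply, liftSemi_smul]
        exact map_smul (lift (ψ.comp φ) X _ (unit_unit_smul φ ψ X)) _ _
      · rw [AddMonoidHom.comp_apply, liftSemi_unit]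
        exact lift_unit _ _ _ (unit_unit_smul φ ψ X) _)

theorem extendComp_unit (φ : B →ₐ[k] C) (ψ : C →ₐ[k] D) (X : Bimod k B A) (m : X.carrier) :
    (extendComp φ ψ X).toLin (unit (ψ.comp φ) X m) = unit ψ (extend φ X) (unit φ X m) := by
  rw [extendComp, equivOfLift_unit]
  rfl

end Bimod

/-! ### Deformations -/

section Deformations

variable {k : Type u} [Field k] (A : Type w) [Ring A] [Algebra k A] {r : ℕ}
variable (M : Fin r → Type v) [∀ i, AddCommGroup (M i)] [∀ i, Module k (M i)]
variable [∀ i, Module Aᵐᵒᵖ (M i)] [∀ i, IsScalarTower k Aᵐᵒᵖ (M i)]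

variable (k) in
/-- The `k^r`-`A`-bimodule `⨁ M_i`. -/
def total : Bimod k (Fin r → k) A where
  carrier := ∀ i, M i
  smulComm := ⟨fun c a m => funext fun i => smul_comm (c i) a (m i)⟩
  central c m := funext fun i => by
    change c • m i = algebraMap k Aᵐᵒᵖ c • m i
    rw [algebraMap_smul]

/-- A deformation of the family `M` of right `A`-modules to the `r`-pointed algebra `S`: an
`S`-`A`-bimodule `M_S` which is isomorphic to `S ⊗_{k^r} ⨁ M_i` as left `S`-module, together with
an isomorphism of bimodules `k^r ⊗_S M_S ≃ ⨁ M_i`. -/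
structure Deformation (S : PointedAlg k r) where
  bimod : Bimod.{u, w, max u v, u} k S.carrier A
  free : Nonempty (bimod.carrier ≃ₗ[S.carrier] (Bimod.extend S.incl (total k A M)).carrier)
  red : Bimod.Equiv (Bimod.extend S.aug bimod) (total k A M)

namespace Deformation

variable {A M}
variable {S S' S'' : PointedAlg k r}

/-- The reduction map `M_S → k^r ⊗_S M_S ≃ ⨁ M_i`. -/
def proj (X : Deformation A M S) : X.bimod.carrier →+ (total k A M).carrier :=
  X.red.toLin.toLinearMap.toAddMonoidHom.comp (Bimod.unit S.aug X.bimod)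

theorem proj_smul (X : Deformation A M S) (s : S.carrier) (m : X.bimod.carrier) :
    X.proj (s • m) = S.aug s • X.proj m := by
  change X.red.toLin (Bimod.unit S.aug X.bimod (s • m)) = _
  rw [Bimod.unit_smul, map_smul]
  rfl

variable (A M S) in
/-- Two deformations are equivalent if there is an isomorphism of bimodules between them which
commutes with the isomorphisms of the reductions with `⨁ M_i`. -/
def setoid : Setoid (Deformation A M S) where
  r X Y := ∃ f : Bimod.Equiv X.bimod Y.bimod, ∀ m, Y.proj (f.toLin m) = X.proj m
  iseqv :=
    { refl := fun X => ⟨Bimod.Equiv.refl _, fun _ => rfl⟩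
      symm := fun {X Y} ⟨f, hf⟩ => ⟨f.symm, fun m => by
        rw [← hf]
        exact congrArg Y.proj (f.toLin.apply_symm_apply m)⟩
      trans := fun {X Y Z} ⟨f, hf⟩ ⟨g, hg⟩ => ⟨f.trans g, fun m =>
        (hg (f.toLin m)).trans (hf m)⟩ }

/-- The deformation `S' ⊗_S M_S` induced by a morphism `S ⟶ S'`. -/
def map (φ : S ⟶ S') (X : Deformation A M S) : Deformation A M S' where
  bimod := Bimod.extend φ.toAlgHom X.bimod
  free := X.free.map fun e =>
    (Bimod.extendLin φ.toAlgHom e).trans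
      ((Bimod.extendComp S.incl φ.toAlgHom (total k A M)).symm.trans
        (Bimod.extendOfEq φ.comp_incl (total k A M))).toLin
  red := ((Bimod.extendComp φ.toAlgHom S'.aug X.bimod).symm.trans
    (Bimod.extendOfEq φ.aug_comp X.bimod)).trans X.red

theorem map_proj (φ : S ⟶ S') (X : Deformation A M S) (m : X.bimod.carrier) :
    (map φ X).proj (Bimod.unit φ.toAlgHom X.bimod m) = X.proj m := by
  change X.red.toLin ((Bimod.extendOfEq φ.aug_comp X.bimod).toLin
    ((Bimod.extendComp φ.toAlgHom S'.aug X.bimod).toLin.symm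
      (Bimod.unit S'.aug _ (Bimod.unit φ.toAlgHom X.bimod m)))) = _
  rw [← Bimod.extendComp_unit, LinearEquiv.symm_apply_apply, Bimod.extendOfEq_unit]
  rfl

theorem map_rel (φ : S ⟶ S') (X : Deformation A M S) (Y : Deformation A M S')
    (f : Bimod.Equiv (Bimod.extend φ.toAlgHom X.bimod) Y.bimod)
    (hf : ∀ m, Y.proj (f.toLin (Bimod.unit φ.toAlgHom X.bimod m)) = X.proj m) :
    (setoid A M S').r (map φ X) Y := by
  refine ⟨f, fun z => ?_⟩
  refine Bimod.liftSemi_ext φ.toAlgHom S'.aug X.bimod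
    (f := Y.proj.comp f.toLin.toLinearMap.toAddMonoidHom) (g := (map φ X).proj)
    (fun c z => ?_) (fun c z => proj_smul (map φ X) c z) (fun m => ?_) z
  · change Y.proj (f.toLin (c • z)) = S'.aug c • Y.proj (f.toLin z)
    rw [map_smul, proj_smul]
  · exact (hf m).trans (map_proj φ X m).symm

/-- The map on equivalence classes induced by a morphism `S ⟶ S'`. -/
def mapClass (φ : S ⟶ S') : Quotient (setoid A M S) → Quotient (setoid A M S') :=
  Quotient.map (map φ) fun X Y h => by
    obtain ⟨f, hf⟩ := h
    refine map_rel φ X (map φ Y) (Bimod.extendCongr φ.toAlgHom f) fun m => ?_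
    have h : (Bimod.extendCongr φ.toAlgHom f).toLin (Bimod.unit φ.toAlgHom X.bimod m) =
      Bimod.unit φ.toAlgHom Y.bimod (f.toLin m) := Bimod.extendLin_unit φ.toAlgHom f.toLin m
    exact (congrArg (map φ Y).proj h).trans ((map_proj φ Y _).trans (hf m))

end Deformation

/-- The noncommutative deformation functor `Def_M`: equivalence classes of deformations of `M`,
with `M_S ↦ S' ⊗_S M_S` for a morphism `S ⟶ S'`. -/
def Def : CategoryTheory.Functor (PointedAlg k r) (Type (max (u + 1) (v + 1) w)) where
  obj S := Quotient (Deformation.setoid A M S)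
  map φ := TypeCat.ofHom (Deformation.mapClass φ)
  map_id S := by
    refine CategoryTheory.ConcreteCategory.hom_ext _ _ fun q => ?_
    induction q using Quotient.inductionOn with
    | h X => exact Quotient.sound (Deformation.map_rel (CategoryTheory.CategoryStruct.id S) X X
        (Bimod.extendId X.bimod) fun m => by
          exact congrArg X.proj (Bimod.extendId_unit X.bimod m))
  map_comp φ ψ := by
    refine CategoryTheory.ConcreteCategory.hom_ext _ _ fun q => ?_
    induction q using Quotient.inductionOn with
    | h X => exact Quotient.sound (Deformation.map_rel (CategoryTheory.CategoryStruct.comp φ ψ) X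
        (Deformation.map ψ (Deformation.map φ X))
        (Bimod.extendComp φ.toAlgHom ψ.toAlgHom X.bimod) fun m => by
          refine (congrArg (Deformation.map ψ (Deformation.map φ X)).proj
            (Bimod.extendComp_unit φ.toAlgHom ψ.toAlgHom X.bimod m)).trans ?_
          exact (Deformation.map_proj ψ (Deformation.map φ X) _).trans
            (Deformation.map_proj φ X m))

end Deformations

/-! ### The free matrix polynomial algebra -/

section FreeMatrix

variable (k : Type u) [Field k] {r : ℕ} (n : Fin r → Fin r → ℕ)

/-- Generators: idempotents `e_i` and variables `x_ij(l)`, `1 ≤ l ≤ n i j`. -/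
inductive Gen : Type
  | e (i : Fin r) : Gen
  | x (i j : Fin r) (l : Fin (n i j)) : Gen

/-- The relations which say that the `e_i` are orthogonal idempotents with sum `1`, and that
`x_ij(l)` lies in the `(i, j)`-component. -/
inductive Rel : FreeAlgebra k (Gen n) → FreeAlgebra k (Gen n) → Prop
  | idem (i : Fin r) :
      Rel (FreeAlgebra.ι k (Gen.e i) * FreeAlgebra.ι k (Gen.e i)) (FreeAlgebra.ι k (Gen.e i))
  | orth (i j : Fin r) : i ≠ j →
      Rel (FreeAlgebra.ι k (Gen.e i) * FreeAlgebra.ι k (Gen.e j)) 0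
  | one : Rel (∑ i, FreeAlgebra.ι k (Gen.e i)) 1
  | left (i j : Fin r) (l : Fin (n i j)) :
      Rel (FreeAlgebra.ι k (Gen.e i) * FreeAlgebra.ι k (Gen.x i j l))
        (FreeAlgebra.ι k (Gen.x i j l))
  | right (i j : Fin r) (l : Fin (n i j)) :
      Rel (FreeAlgebra.ι k (Gen.x i j l) * FreeAlgebra.ι k (Gen.e j))
        (FreeAlgebra.ι k (Gen.x i j l))

/-- The free `r × r` matrix polynomial algebra `k⟨N⟩` in the variables `x_ij(l)`, that is, the
tensor algebra over `k^r` of the bimodule with basis the `x_ij(l)`, here by generators and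
relations. -/
abbrev FreeMat : Type u := RingQuot (Rel k n)

namespace FreeMat

/-- The idempotent `e_i`. -/
def e (i : Fin r) : FreeMat k n := RingQuot.mkAlgHom k (Rel k n) (FreeAlgebra.ι k (Gen.e i))

/-- The variable `x_ij(l)`. -/
def x {i j : Fin r} (l : Fin (n i j)) : FreeMat k n :=
  RingQuot.mkAlgHom k (Rel k n) (FreeAlgebra.ι k (Gen.x i j l))

theorem e_mul_e (i j : Fin r) : e k n i * e k n j = if i = j then e k n i else 0 := by
  split_ifs with h
  · subst h
    rw [e, ← map_mul, RingQuot.mkAlgHom_rel k (Rel.idem i)]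
  · rw [e, e, ← map_mul, RingQuot.mkAlgHom_rel k (Rel.orth i j h), map_zero]

theorem sum_e : ∑ i, e k n i = 1 := by
  simp only [e]
  rw [← map_sum, RingQuot.mkAlgHom_rel k Rel.one, map_one]

/-- The structure map `k^r → k⟨N⟩`. -/
def incl : (Fin r → k) →ₐ[k] FreeMat k n :=
  AlgHom.ofLinearMap (∑ i, (LinearMap.proj i).smulRight (e k n i))
    (by simp [sum_e])
    (fun c d => by
      simp [Finset.sum_mul_sum, e_mul_e, smul_smul, mul_comm])

/-- The augmentation `k⟨N⟩ → k^r`, which sends all `x_ij(l)` to `0`. -/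
def aug : FreeMat k n →ₐ[k] (Fin r → k) :=
  RingQuot.liftAlgHom k ⟨FreeAlgebra.lift k (fun g => match g with
      | Gen.e i => Pi.single i 1
      | Gen.x _ _ _ => 0), by
    intro a b h
    cases h with
    | idem i => ext j; by_cases h : j = i <;> simp [h]
    | orth i j h => ext l; by_cases h' : l = i <;> simp_all [Pi.single_apply]
    | one => ext j; simp [Pi.single_apply]
    | left i j l => simp
    | right i j l => simp⟩

theorem aug_incl (c : Fin r → k) : aug k n (incl k n c) = c := by
  ext j
  simp [aug, incl, e, Pi.single_apply]

/-- The augmentation ideal `𝔪` of `k⟨N⟩`. -/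
def maxIdeal : TwoSidedIdeal (FreeMat k n) := TwoSidedIdeal.ker (aug k n)

end FreeMat

end FreeMatrix

/-- The monomials of the `(i, j)`-component of the free matrix polynomial algebra: composable words
`x_{i i₁}(l₁) x_{i₁ i₂}(l₂) ⋯ x_{i_{s-1} j}(l_s)`. -/
inductive Mono {r : ℕ} (n : Fin r → Fin r → ℕ) : Fin r → Fin r → Type
  | one (i : Fin r) : Mono n i i
  | cons {i j s : Fin r} (l : Fin (n i j)) (p : Mono n j s) : Mono n i s

namespace Mono

variable {r : ℕ} {n : Fin r → Fin r → ℕ}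

/-- The product of two monomials. -/
def mul : {i j s : Fin r} → Mono n i j → Mono n j s → Mono n i s
  | _, _, _, one _, q => q
  | _, _, _, cons l p, q => cons l (p.mul q)

/-- The degree of a monomial. -/
def deg : {i j : Fin r} → Mono n i j → ℕ
  | _, _, one _ => 0
  | _, _, cons _ p => p.deg + 1

/-- The variable `x_ij(l)` as a monomial. -/
def var {i j : Fin r} (l : Fin (n i j)) : Mono n i j := cons l (one j)

/-- The value of a monomial in the free matrix polynomial algebra. -/
def val (k : Type u) [Field k] : {i j : Fin r} → Mono n i j → FreeMat k n
  | _, _, one i => FreeMat.e k n i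
  | _, _, cons l p => FreeMat.x k n l * p.val k

end Mono

/-! ### GMMP-algebras and the algorithm -/

/-- An `r × r` matrix GMMP-algebra `(V, W, ∪, d)`: vector spaces `V = (V_ij)` and `W = (W_ij)`, a
product `∪ : V_ij ⊗ V_js → W_is` and a linear map `d : V_ij → W_ij`. -/
structure GMMP (k : Type u) [Field k] (r : ℕ) where
  V : Fin r → Fin r → Type x
  W : Fin r → Fin r → Type x
  [addCommGroupV : ∀ i j, AddCommGroup (V i j)]
  [moduleV : ∀ i j, Module k (V i j)]
  [addCommGroupW : ∀ i j, AddCommGroup (W i j)]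
  [moduleW : ∀ i j, Module k (W i j)]
  cup : ∀ {i j s : Fin r}, V i j →ₗ[k] V j s →ₗ[k] W i s
  d : ∀ {i j : Fin r}, V i j →ₗ[k] W i j

attribute [instance] GMMP.addCommGroupV GMMP.moduleV GMMP.addCommGroupW GMMP.moduleW

namespace GMMP

variable {k : Type u} [Field k] {r : ℕ} (L : GMMP.{u, x} k r) {n : Fin r → Fin r → ℕ}

/-- The polynomials `f^{N+1}`: for a linear form `y` on `W_ij / im d`,
`f = ∑ y (v_p ∪ v_q) p q`, where `p` and `q` run over the composable pairs of monomials of positive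
degree in the basis `B_0 ∪ ⋯ ∪ B_N`. (The linear forms `y_i^*` of a basis `(y_i)` of `W / im d`
give the same ideal as all linear forms.) -/
def obstr (B : ℕ → ∀ i j : Fin r, Finset (Mono n i j))
    (v : ∀ {i j : Fin r}, Mono n i j → L.V i j) (N : ℕ) {i j : Fin r}
    (y : L.W i j →ₗ[k] k) : FreeMat k n :=
  ∑ a ∈ Finset.Icc 1 N, ∑ b ∈ Finset.Icc 1 N, ∑ s : Fin r, ∑ p ∈ B a i s, ∑ q ∈ B b s j,
    y (L.cup (v p) (v q)) • (p.mul q).val k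

/-- The ideals `J_N` with `H̄_N = k⟨N⟩ / J_N`: `J_0 = 𝔪`, `J_1 = 𝔪²`, and `J_{N+1}` is generated by
`𝔪 J_N + J_N 𝔪` (so that `H_{N+1} = k⟨N⟩ / (𝔪 J_N + J_N 𝔪)`) and the polynomials `f^{N+1}`. -/
def relIdeal (B : ℕ → ∀ i j : Fin r, Finset (Mono n i j))
    (v : ∀ {i j : Fin r}, Mono n i j → L.V i j) : ℕ → TwoSidedIdeal (FreeMat k n)
  | 0 => FreeMat.maxIdeal k n
  | 1 => TwoSidedIdeal.span
      {z | ∃ a ∈ FreeMat.maxIdeal k n, ∃ b ∈ FreeMat.maxIdeal k n, z = a * b}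
  | N + 2 => TwoSidedIdeal.span
      ({z | ∃ a ∈ FreeMat.maxIdeal k n, ∃ b ∈ relIdeal B v (N + 1), z = a * b ∨ z = b * a} ∪
       {z | ∃ (i j : Fin r) (y : L.W i j →ₗ[k] k), y ∘ₗ L.d = 0 ∧
          z = L.obstr B v (N + 1) y})

/-- The algebra `H̄_N = k⟨N⟩ / J_N`. -/
abbrev Hbar (B : ℕ → ∀ i j : Fin r, Finset (Mono n i j))
    (v : ∀ {i j : Fin r}, Mono n i j → L.V i j) (N : ℕ) : Type u :=
  FreeMat k n ⧸ (L.relIdeal B v N).asIdeal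

/-- A run of the algorithm on the GMMP-algebra `L` and the elements `X = (x_ij(l))` of `V`, i.e. the
successive choices of monomial bases `B_N` and of elements `v_p` of `V`. -/
structure Run (X : ∀ i j : Fin r, Fin (n i j) → L.V i j) where
  /-- `B N` are the new monomials of stage `N`, so that `B_0 ∪ ⋯ ∪ B_N` is a basis of `H̄_N`. -/
  B : ℕ → ∀ i j : Fin r, Finset (Mono n i j)
  v : ∀ {i j : Fin r}, Mono n i j → L.V i j
  mem_B_zero : ∀ (i j : Fin r) (p : Mono n i j), p ∈ B 0 i j ↔ p.deg = 0
  mem_B_one : ∀ (i j : Fin r) (p : Mono n i j), p ∈ B 1 i j ↔ p.deg = 1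
  v_var : ∀ (i j : Fin r) (l : Fin (n i j)), v (Mono.var l) = X i j l
  /-- `B (N + 2)` is a monomial basis of the kernel `J_{N+1} / J_{N+2}` of `H̄_{N+2} → H̄_{N+1}`. -/
  linInd : ∀ N : ℕ, LinearIndependent k
    (fun p : Σ i j : Fin r, {p : Mono n i j // p ∈ B (N + 2) i j} =>
      (Ideal.Quotient.mkₐ k (L.relIdeal B v (N + 2)).asIdeal (p.2.2.1.val k) :
        L.Hbar B v (N + 2)))
  span : ∀ (N : ℕ) (h : L.Hbar B v (N + 2)),
    h ∈ Submodule.span k (Set.range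
      (fun p : Σ i j : Fin r, {p : Mono n i j // p ∈ B (N + 2) i j} =>
        (Ideal.Quotient.mkₐ k (L.relIdeal B v (N + 2)).asIdeal (p.2.2.1.val k) :
          L.Hbar B v (N + 2)))) ↔
    ∃ t ∈ L.relIdeal B v (N + 1), Ideal.Quotient.mkₐ k (L.relIdeal B v (N + 2)).asIdeal t = h
  /-- If `t = ∑ β_{t,u} u` in `H̄_{N+2}`, where `u` runs over the monomial basis, then
  `d v_u = - ∑ β_{pq,u} v_p ∪ v_q` for all `u` in `B (N + 2)`, where `p` and `q` run over the
  composable pairs of monomials of positive degree in `B_0 ∪ ⋯ ∪ B_{N+1}`. -/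
  d_v : ∀ N : ℕ, ∃ β : ∀ {i j : Fin r}, Mono n i j → Mono n i j → k,
    (∀ (i j : Fin r) (t : Mono n i j),
      t.val k - ∑ a ∈ Finset.range (N + 3), ∑ u ∈ B a i j, β t u • u.val k ∈
        L.relIdeal B v (N + 2)) ∧
    ∀ (i j : Fin r), ∀ u ∈ B (N + 2) i j,
      L.d (v u) = - ∑ a ∈ Finset.Icc 1 (N + 1), ∑ b ∈ Finset.Icc 1 (N + 1), ∑ s : Fin r,
        ∑ p ∈ B a i s, ∑ q ∈ B b s j, β (p.mul q) u • L.cup (v p) (v q)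

namespace Run

variable {L} {X : ∀ i j : Fin r, Fin (n i j) → L.V i j}

/-- The inverse limit of the algebras `H̄_N`: a family of classes which are, up to any given stage,
the classes of one element of `k⟨N⟩`. -/
def limit (R : L.Run X) : Subalgebra k (∀ N : ℕ, L.Hbar R.B R.v N) where
  carrier := {h | ∀ N : ℕ, ∃ t : FreeMat k n, ∀ m ≤ N,
    Ideal.Quotient.mkₐ k (L.relIdeal R.B R.v m).asIdeal t = h m}
  mul_mem' := fun {a b} ha hb N => by
    obtain ⟨s, hs⟩ := ha N
    obtain ⟨t, ht⟩ := hb N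
    exact ⟨s * t, fun m hm => by rw [map_mul, hs m hm, ht m hm]; rfl⟩
  add_mem' := fun {a b} ha hb N => by
    obtain ⟨s, hs⟩ := ha N
    obtain ⟨t, ht⟩ := hb N
    exact ⟨s + t, fun m hm => by rw [map_add, hs m hm, ht m hm]; rfl⟩
  algebraMap_mem' := fun c N => ⟨algebraMap k _ c, fun m _ => by
    rw [AlgHom.commutes]; rfl⟩

/-- The formal `r`-pointed algebra `Â(L) = lim H̄_N`. -/
def hull (R : L.Run X) : PointedAlg k r where
  carrier := R.limit
  incl := (AlgHom.pi fun N =>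
      (Ideal.Quotient.mkₐ k (L.relIdeal R.B R.v N).asIdeal).comp (FreeMat.incl k n)).codRestrict
    R.limit (fun c _N => ⟨FreeMat.incl k n c, fun _ _ => rfl⟩)
  aug := ((Ideal.Quotient.liftₐ (L.relIdeal R.B R.v 0).asIdeal (FreeMat.aug k n)
      (fun _ ht => (TwoSidedIdeal.mem_ker (FreeMat.aug k n)).1 (TwoSidedIdeal.mem_asIdeal.1 ht))).comp
    (Pi.evalAlgHom k (fun N => L.Hbar R.B R.v N) 0)).comp R.limit.val
  aug_incl c := FreeMat.aug_incl k n c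

end Run

end GMMP

/-! ### The Hochschild complex -/

section Hochschild

variable (k : Type u) [Field k] (A : Type w) [Ring A] [Algebra k A] {r : ℕ}
variable (M : Fin r → Type v) [∀ i, AddCommGroup (M i)] [∀ i, Module k (M i)]
variable [∀ i, Module Aᵐᵒᵖ (M i)] [∀ i, IsScalarTower k Aᵐᵒᵖ (M i)]

/-- The right multiplication `ρ_i : A → End_k (M_i)`, `ρ_i a m = m a`. -/
def rightMul (i : Fin r) : A →ₗ[k] M i →ₗ[k] M i where
  toFun a := Module.toModuleEnd k (S := Aᵐᵒᵖ) (M i) (MulOpposite.op a)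
  map_add' a b := by ext m; simp [add_smul]
  map_smul' c a := by ext m; simp [smul_assoc]

/-- The Hochschild cochains `C^0(A, Hom_k(M_i, M_j))`. -/
abbrev C0 (i j : Fin r) : Type v := M i →ₗ[k] M j

/-- The Hochschild cochains `C^1(A, Hom_k(M_i, M_j))`. -/
abbrev C1 (i j : Fin r) : Type max v w := A →ₗ[k] M i →ₗ[k] M j

/-- The Hochschild cochains `C^2(A, Hom_k(M_i, M_j))`, as bilinear maps. -/
abbrev C2 (i j : Fin r) : Type max v w := A →ₗ[k] A →ₗ[k] M i →ₗ[k] M j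

variable {k A M}

theorem rightMul_mul (i : Fin r) (a b : A) :
    rightMul k A M i (a * b) = rightMul k A M i b ∘ₗ rightMul k A M i a := by
  ext m; simp [rightMul, mul_smul]

/-- The Hochschild differential `(d φ)(a) = a φ - φ a`, i.e. `(d φ)(a)(m) = φ (m a) - φ (m) a`. -/
def d0 {i j : Fin r} : C0 k M i j →ₗ[k] C1 k A M i j where
  toFun φ :=
    { toFun := fun a => φ ∘ₗ rightMul k A M i a - rightMul k A M j a ∘ₗ φ
      map_add' := fun a b => by ext m; simp; abel
      map_smul' := fun c a => by ext m; simp [smul_sub] }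
  map_add' φ ψ := by ext a m; simp; abel
  map_smul' c φ := by ext a m; simp [smul_sub]

/-- The Hochschild differential `(d φ)(a, b) = a φ(b) - φ(a b) + φ(a) b`, i.e.
`(d φ)(a, b)(m) = φ(b)(m a) - φ(a b)(m) + φ(a)(m) b`. -/
def d1 {i j : Fin r} : C1 k A M i j →ₗ[k] C2 k A M i j where
  toFun φ := LinearMap.mk₂ k
    (fun a b => φ b ∘ₗ rightMul k A M i a - φ (a * b) + rightMul k A M j b ∘ₗ φ a)
    (fun a a' b => by ext m; simp [add_mul]; abel)
    (fun c a b => by ext m; simp [smul_sub, smul_add])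
    (fun a b b' => by ext m; simp [mul_add]; abel)
    (fun c a b => by ext m; simp [smul_sub, smul_add])
  map_add' φ ψ := by ext a b m; simp; abel
  map_smul' c φ := by ext a b m; simp [smul_sub, smul_add]

theorem d1_d0 {i j : Fin r} (φ : C0 k M i j) : d1 (d0 (A := A) φ) = 0 := by
  ext a b m
  simp [d1, d0, rightMul_mul]

/-- The cup product `(φ ∪ ψ)(a, b) = ψ(b) ∘ φ(a)`, the product of the values in
`Hom_k(M_i, M_j) ⊗ Hom_k(M_j, M_s) → Hom_k(M_i, M_s)`. -/
def cup {i j s : Fin r} : C1 k A M i j →ₗ[k] C1 k A M j s →ₗ[k] C2 k A M i s :=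
  LinearMap.mk₂ k
    (fun φ ψ => LinearMap.mk₂ k (fun a b => ψ b ∘ₗ φ a)
      (fun a a' b => by ext m; simp) (fun c a b => by ext m; simp)
      (fun a b b' => by ext m; simp) (fun c a b => by ext m; simp))
    (fun φ φ' ψ => by ext a b m; simp) (fun c φ ψ => by ext a b m; simp)
    (fun φ ψ ψ' => by ext a b m; simp) (fun c φ ψ => by ext a b m; simp)

variable (k A M)

/-- The GMMP-algebra `(C^1(A, M), C^2(A, M), ∪, d)`. -/
def hochschildGMMP : GMMP.{u, max v w} k r where
  V := C1 k A M
  W := C2 k A M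
  cup := cup
  d := d1

/-- The Hochschild `1`-cocycles. -/
abbrev Z1 (i j : Fin r) : Submodule k (C1 k A M i j) := LinearMap.ker d1

/-- The Hochschild `1`-coboundaries. -/
abbrev B1 (i j : Fin r) : Submodule k (C1 k A M i j) := LinearMap.range d0

/-- The first cohomology `Z^1 / B^1` of the Hochschild complex `C^•(A, Hom_k(M_i, M_j))`, as a
subspace of `C^1 / B^1`; this is `Ext^1_A(M_i, M_j)`. -/
abbrev Ext1 (i j : Fin r) : Submodule k (C1 k A M i j ⧸ B1 k A M i j) :=
  (Z1 k A M i j).map (B1 k A M i j).mkQ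

/-- The `x_ij(l)`, `1 ≤ l ≤ n i j`, are cocycles whose classes are a basis of
`Ext^1_A(M_i, M_j)`. -/
def RepresentsBasis {n : Fin r → Fin r → ℕ} (X : ∀ i j : Fin r, Fin (n i j) → C1 k A M i j) :
    Prop :=
  ∀ i j : Fin r, (∀ l : Fin (n i j), X i j l ∈ Z1 k A M i j) ∧
    ∃ b : Module.Basis (Fin (n i j)) k (Ext1 k A M i j),
      ∀ l : Fin (n i j), (b l : C1 k A M i j ⧸ B1 k A M i j) = (B1 k A M i j).mkQ (X i j l)

end Hochschild

end NCDef

end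

noncomputable section

namespace NCDef

/-! ### The free matrix polynomial algebra by generators and relations -/

namespace FreeMat

variable {k : Type u} [Field k] {r : ℕ} {n : Fin r → Fin r → ℕ}

/-! Over S in Art_k every deformation is, up to equivalence, the left module S ⊗ ⨁ M_i with a right
action a ↦ act₀(a) + δ(a), where act₀ extends the action on ⨁ M_i and δ reduces to 0
(`Act.exists_rel`). Multiplicativity of the action is the Maurer–Cartan equation dδ + δ ∪ δ = 0
(`Free.act₀_add_mul_iff`), and equivalences are conjugations by automorphisms 1 + ν with ν reducing
to 0.

The algorithm builds a solution ∑ u ⊗ v_u that is as general as possible. The coefficient of a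
monomial u in the Maurer–Cartan equation over H̄_N is exactly the equation imposed on d v_u
(`GMMP.Run.maurerCartan`). That equation is solvable: a linear form y on W / im d takes on its
right-hand side, up to sign, the coefficient of u in f_y, and f_y vanishes in the quotient
(`GMMP.IsStage.exists_d_eq`). Successive polynomials f_y differ by elements of 𝔪 J_N + J_N 𝔪, whence
J_N ⊆ J_{N+1} + 𝔪^{N+1} (`GMMP.relIdeal_le_sup`). So monomials of degree N + 1 span J_N / J_{N+1}
and runs exist (`GMMP.nonempty_run`). The same inclusion identifies I(Â)^{N+1} with the kernel of Â
→ H̄_N (`GMMP.Run.mem_augIdeal_pow_iff`), so Â is formal and every morphism to an object of Art_k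
factors through some H̄_N. Evaluating the universal solution along a morphism defines η
(`GMMP.Run.homAct`).

Smoothness reduces to surjections T → S whose kernel is annihilated by I(T) on both sides
(`GMMP.Run.exists_lift`). Given Â → S and a compatible action over T, lift the morphism to ψ : k⟨N⟩
→ T. The mere existence of the action makes ψ kill the next obstruction polynomials, so ψ factors
through a later H̄ (`GMMP.Run.kills_of_act`). The error between the given action and the one defined
by ψ is then a cocycle with coefficients in the kernel. Its class in Ext¹ is absorbed by changing ψ
on the variables, and the remaining coboundary by conjugation with 1 + ν
(`GMMP.Run.exists_lift_of_isSmall`). Surjectivity of η is smoothness over k^r. Injectivity for I(S)²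
= 0 is the linear independence of the classes of the x_ij(l) in Ext¹
(`GMMP.Run.toDef_homAct_injective`). -/

theorem e_mul_x {i j : Fin r} (l : Fin (n i j)) : e k n i * x k n l = x k n l := by
  rw [e, x, ← map_mul, RingQuot.mkAlgHom_rel k (Rel.left i j l)]

theorem x_mul_e {i j : Fin r} (l : Fin (n i j)) : x k n l * e k n j = x k n l := by
  rw [e, x, ← map_mul, RingQuot.mkAlgHom_rel k (Rel.right i j l)]

theorem aug_e (i : Fin r) : aug k n (e k n i) = Pi.single i 1 := by
  simp [aug, e]

theorem aug_x {i j : Fin r} (l : Fin (n i j)) : aug k n (x k n l) = 0 := by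
  simp [aug, x]

theorem incl_single (i : Fin r) : incl k n (Pi.single i 1) = e k n i := by
  simp [incl, Pi.single_apply]

theorem incl_apply (c : Fin r → k) : incl k n c = ∑ i, c i • e k n i := by
  simp [incl]

section Lift

variable {R : Type*} [Ring R] [Algebra k R]

/-- The algebra homomorphism given by orthogonal idempotents with sum `1` and elements of the
components which they define. -/
def lift (E : Fin r → R) (hE : ∀ i j, E i * E j = if i = j then E i else 0) (h1 : ∑ i, E i = 1)
    (ξ : ∀ i j, Fin (n i j) → R) (hl : ∀ i j l, E i * ξ i j l = ξ i j l)
    (hr : ∀ i j l, ξ i j l * E j = ξ i j l) : FreeMat k n →ₐ[k] R :=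
  RingQuot.liftAlgHom k ⟨FreeAlgebra.lift k (fun g => match g with
      | Gen.e i => E i
      | Gen.x i j l => ξ i j l), by
    intro a b h
    cases h with
    | idem i => simp [hE]
    | orth i j h => simp [hE, h]
    | one => simp [h1]
    | left i j l => simp [hl]
    | right i j l => simp [hr]⟩

variable (E : Fin r → R) (hE : ∀ i j, E i * E j = if i = j then E i else 0) (h1 : ∑ i, E i = 1)
    (ξ : ∀ i j, Fin (n i j) → R) (hl : ∀ i j l, E i * ξ i j l = ξ i j l)
    (hr : ∀ i j l, ξ i j l * E j = ξ i j l)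

theorem lift_e (i : Fin r) : lift (k := k) E hE h1 ξ hl hr (e k n i) = E i := by
  simp [lift, e]

theorem lift_x {i j : Fin r} (l : Fin (n i j)) :
    lift (k := k) E hE h1 ξ hl hr (x k n l) = ξ i j l := by
  simp [lift, x]

theorem hom_ext {f g : FreeMat k n →ₐ[k] R} (he : ∀ i, f (e k n i) = g (e k n i))
    (hx : ∀ i j (l : Fin (n i j)), f (x k n l) = g (x k n l)) : f = g := by
  apply RingQuot.ringQuot_ext'
  ext a
  cases a with
  | e i => exact he i
  | x i j l => exact hx i j l

end Lift

end FreeMat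

/-! ### Monomials -/

namespace Mono

variable {k : Type u} [Field k] {r : ℕ} {n : Fin r → Fin r → ℕ}

open FreeMat

theorem e_mul_val {i j : Fin r} (p : Mono n i j) : e k n i * p.val k = p.val k := by
  cases p with
  | one i => simp [val, e_mul_e]
  | cons l p => rw [val, ← mul_assoc, e_mul_x]

theorem val_mul_e {i j : Fin r} (p : Mono n i j) : p.val k * e k n j = p.val k := by
  induction p with
  | one i => simp [val, e_mul_e]
  | cons l p ih => rw [val, mul_assoc, ih]

theorem val_mul {i j s : Fin r} (p : Mono n i j) (q : Mono n j s) :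
    (p.mul q).val k = p.val k * q.val k := by
  induction p with
  | one i => rw [mul, val, e_mul_val]
  | cons l p ih => rw [mul, val, val, ih, mul_assoc]

theorem val_mul_val_of_ne {i j j' s : Fin r} (p : Mono n i j) (q : Mono n j' s) (h : j ≠ j') :
    p.val k * q.val k = 0 := by
  rw [← val_mul_e p, ← e_mul_val q, mul_assoc, ← mul_assoc (e k n j), e_mul_e, if_neg h]
  simp

theorem val_var {i j : Fin r} (l : Fin (n i j)) : (var l).val k = x k n l := by
  rw [var, val, val, x_mul_e]

theorem deg_mul {i j s : Fin r} (p : Mono n i j) (q : Mono n j s) :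
    (p.mul q).deg = p.deg + q.deg := by
  induction p with
  | one i => simp [mul, deg]
  | cons l p ih => simp [mul, deg, ih]; omega

theorem deg_var {i j : Fin r} (l : Fin (n i j)) : (var l).deg = 1 := rfl

theorem eq_var_of_deg {i j : Fin r} (p : Mono n i j) (h : p.deg = 1) : ∃ l, p = var l := by
  match p, h with
  | cons l (one _), _ => exact ⟨l, rfl⟩

theorem var_injective {i j : Fin r} : Function.Injective (var : Fin (n i j) → Mono n i j) := by
  intro a b h
  simpa [var] using h

theorem finite_deg (d : ℕ) (i j : Fin r) : {p : Mono n i j | p.deg = d}.Finite := by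
  induction d generalizing i with
  | zero =>
    refine Set.Subsingleton.finite ?_
    intro p hp q hq
    match p, q, hp, hq with
    | one _, one _, _, _ => rfl
  | succ d ih =>
    refine (Set.finite_iUnion fun s => (Set.finite_iUnion fun l : Fin (n i s) =>
      ((ih s).image fun p => cons l p))).subset ?_
    intro p hp
    match p, hp with
    | cons l q, hp =>
      simp only [Set.mem_iUnion]
      exact ⟨_, l, q, by simpa [deg] using hp, rfl⟩

end Mono

/-! ### The filtration by degree -/

namespace FreeMat

variable (k : Type u) [Field k] {r : ℕ} (n : Fin r → Fin r → ℕ)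

/-- The span of the monomials of degree at least `d`, i.e. the `d`-th power of the augmentation
ideal. -/
def filt (d : ℕ) : Submodule k (FreeMat k n) :=
  Submodule.span k {t | ∃ (i j : Fin r) (p : Mono n i j), d ≤ p.deg ∧ t = p.val k}

variable {k n}

theorem val_mem_filt {i j : Fin r} (p : Mono n i j) {d : ℕ} (h : d ≤ p.deg) :
    p.val k ∈ filt k n d := Submodule.subset_span ⟨i, j, p, h, rfl⟩

theorem filt_anti {a b : ℕ} (h : a ≤ b) : filt k n b ≤ filt k n a :=
  Submodule.span_mono fun _ ⟨i, j, p, hp, ht⟩ => ⟨i, j, p, h.trans hp, ht⟩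

theorem mul_mem_filt {a b : ℕ} {s t : FreeMat k n} (hs : s ∈ filt k n a) (ht : t ∈ filt k n b) :
    s * t ∈ filt k n (a + b) := by
  have : s * t ∈ filt k n a * filt k n b := Submodule.mul_mem_mul hs ht
  refine SetLike.le_def.1 ?_ this
  rw [filt, filt, Submodule.span_mul_span, Submodule.span_le]
  rintro _ ⟨_, ⟨i, j, p, hp, rfl⟩, _, ⟨i', j', q, hq, rfl⟩, rfl⟩
  by_cases h : j = i'
  · subst h
    change p.val k * q.val k ∈ _
    rw [← Mono.val_mul]
    exact val_mem_filt _ (by rw [Mono.deg_mul]; omega)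
  · change p.val k * q.val k ∈ _
    rw [Mono.val_mul_val_of_ne _ _ h]
    exact zero_mem _

theorem filt_zero : filt k n 0 = ⊤ := by
  have he : ∀ i, e k n i ∈ filt k n 0 := fun i => val_mem_filt (Mono.one i) (Nat.zero_le _)
  have h1 : (1 : FreeMat k n) ∈ filt k n 0 := by
    rw [← sum_e]
    exact Submodule.sum_mem _ fun i _ => he i
  rw [eq_top_iff]
  rintro t -
  obtain ⟨t, rfl⟩ := RingQuot.mkAlgHom_surjective k (Rel k n) t
  induction t with
  | grade0 c =>
    have hc : RingQuot.mkAlgHom k (Rel k n) (algebraMap k _ c) = c • (1 : FreeMat k n) := by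
      rw [Algebra.algebraMap_eq_smul_one, map_smul, map_one]
    exact hc ▸ Submodule.smul_mem _ _ h1
  | grade1 g =>
    cases g with
    | e i => exact he i
    | x i j l =>
      have := val_mem_filt (k := k) (Mono.var l) (Nat.zero_le _)
      rwa [Mono.val_var] at this
  | mul a b ha hb => rw [map_mul]; exact mul_mem_filt (a := 0) (b := 0) ha hb
  | add a b ha hb => rw [map_add]; exact add_mem ha hb

theorem mul_mem_filt_left {a : ℕ} (s : FreeMat k n) {t : FreeMat k n} (ht : t ∈ filt k n a) :
    s * t ∈ filt k n a := by
  have := mul_mem_filt (a := 0) (s := s) (by rw [filt_zero]; trivial) ht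
  rwa [zero_add] at this

theorem mul_mem_filt_right {a : ℕ} {s : FreeMat k n} (hs : s ∈ filt k n a) (t : FreeMat k n) :
    s * t ∈ filt k n a :=
  mul_mem_filt (b := 0) hs (by rw [filt_zero]; trivial)

theorem sub_incl_mem (t : FreeMat k n) : t - incl k n (aug k n t) ∈ filt k n 1 := by
  have ht : t ∈ filt k n 0 := by rw [filt_zero]; trivial
  induction ht using Submodule.span_induction with
  | mem t ht =>
    obtain ⟨i, j, p, -, rfl⟩ := ht
    cases p with
    | one i => rw [Mono.val, aug_e, incl_single, sub_self]; exact zero_mem _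
    | cons l p =>
      have : aug k n (x k n l * p.val k) = 0 := by rw [map_mul, aug_x, zero_mul]
      rw [Mono.val, this, map_zero, sub_zero]
      exact val_mem_filt (Mono.cons l p) (by simp [Mono.deg])
  | zero => simp
  | add s t _ _ hs ht =>
    rw [map_add, map_add, add_sub_add_comm]
    exact add_mem hs ht
  | smul c t _ ht =>
    rw [map_smul, map_smul, ← smul_sub]
    exact Submodule.smul_mem _ _ ht

theorem mem_maxIdeal {t : FreeMat k n} : t ∈ maxIdeal k n ↔ aug k n t = 0 :=
  TwoSidedIdeal.mem_ker _

theorem mem_maxIdeal_iff {t : FreeMat k n} : t ∈ maxIdeal k n ↔ t ∈ filt k n 1 := by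
  rw [mem_maxIdeal]
  constructor
  · intro h
    simpa [h] using sub_incl_mem t
  · intro h
    induction h using Submodule.span_induction with
    | mem t ht =>
      obtain ⟨i, j, p, hp, rfl⟩ := ht
      cases p with
      | one i => simp [Mono.deg] at hp
      | cons l p => rw [Mono.val, map_mul, aug_x, zero_mul]
    | zero => simp
    | add s t _ _ hs ht => rw [map_add, hs, ht, add_zero]
    | smul c t _ ht => rw [map_smul, ht, smul_zero]

theorem x_mem_maxIdeal {i j : Fin r} (l : Fin (n i j)) : x k n l ∈ maxIdeal k n :=
  mem_maxIdeal.2 (aug_x l)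

/-- Every monomial of positive degree has a first letter. Splitting it off lowers the order by one
and leaves a sum over the finitely many variables; applied termwise to a convergent series this
gives membership in powers of the augmentation ideal of Â. -/
theorem exists_of_mem_filt_succ {d : ℕ} {t : FreeMat k n} (ht : t ∈ filt k n (d + 1)) :
    ∃ g : ∀ i j, Fin (n i j) → FreeMat k n, (∀ i j l, g i j l ∈ filt k n d) ∧
      t = ∑ i, ∑ j, ∑ l, x k n l * g i j l := by
  classical
  induction ht using Submodule.span_induction with
  | mem t ht =>
    obtain ⟨i, j, p, hp, rfl⟩ := ht
    cases p with
    | one i => simp [Mono.deg] at hp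
    | @cons i s j l p =>
      refine ⟨fun i' s' l' => if h : i = i' then if h' : s = s' then
        if l' = h ▸ h' ▸ l then p.val k else 0 else 0 else 0, ?_, ?_⟩
      · intro i' s' l'
        have hv : p.val k ∈ filt k n d := val_mem_filt p (by simpa [Mono.deg] using hp)
        dsimp only
        split_ifs
        exacts [hv, zero_mem _, zero_mem _, zero_mem _]
      · rw [Finset.sum_eq_single i, Finset.sum_eq_single s, Finset.sum_eq_single l]
        · simp [Mono.val]
        · intro l' _ h
          simp [h]
        · simp
        · intro s' _ h
          simp [h.symm]
        · simp
        · intro i' _ h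
          simp [h.symm]
        · simp
  | zero => exact ⟨0, fun _ _ _ => zero_mem _, by simp⟩
  | add s t _ _ hs ht =>
    obtain ⟨g, hg, rfl⟩ := hs
    obtain ⟨g', hg', rfl⟩ := ht
    exact ⟨g + g', fun i j l => add_mem (hg i j l) (hg' i j l), by
      simp [mul_add, Finset.sum_add_distrib]⟩
  | smul c t _ ht =>
    obtain ⟨g, hg, rfl⟩ := ht
    exact ⟨c • g, fun i j l => Submodule.smul_mem _ _ (hg i j l), by
      simp [Finset.smul_sum]⟩

/-- The coefficients of linear polynomials are determined modulo the square of the augmentation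
ideal. -/
theorem eq_zero_of_sum_x_mem {i j : Fin r} (c : Fin (n i j) → k)
    (h : ∑ l, c l • x k n l ∈ TwoSidedIdeal.span
      {z : FreeMat k n | ∃ a ∈ maxIdeal k n, ∃ b ∈ maxIdeal k n, z = a * b}) (l : Fin (n i j)) :
    c l = 0 := by
  classical
  -- The representation with e_i ↦ E₁₁, e_j ↦ E₂₂ (e_i ↦ 1 if i = j), x_ij(l) ↦ E₁₂ and all other
  -- generators ↦ 0. It maps 𝔪 into the multiples of E₁₂, hence 𝔪² to 0, while the upper right entry
  -- of the image of a linear polynomial reads off the coefficient c l.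
  let E : Fin r → Matrix (Fin 2) (Fin 2) k := fun s => !![if s = i then 1 else 0, 0;
    0, if s = j then 1 else 0]
  let ξ : ∀ s t, Fin (n s t) → Matrix (Fin 2) (Fin 2) k := fun s t m =>
    !![0, if (⟨s, t, m⟩ : Σ s t, Fin (n s t)) = ⟨i, j, l⟩ then 1 else 0; 0, 0]
  let φ : FreeMat k n →ₐ[k] Matrix (Fin 2) (Fin 2) k := lift E
    (by
      intro s t
      ext a b
      fin_cases a <;> fin_cases b <;> by_cases h : s = t <;>
        simp [E, h, Matrix.mul_apply, Fin.sum_univ_two] <;> (intros; simp_all))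
    (by
      ext a b
      rw [Matrix.sum_apply]
      fin_cases a <;> fin_cases b <;> simp [E])
    ξ
    (by
      intro s t m
      ext a b
      fin_cases a <;> fin_cases b <;> simp [E, ξ, Matrix.mul_apply, Fin.sum_univ_two]
      split_ifs <;> simp_all)
    (by
      intro s t m
      ext a b
      fin_cases a <;> fin_cases b <;> simp [E, ξ, Matrix.mul_apply, Fin.sum_univ_two]
      rintro h1 rfl h2
      cases h2
      exact h1 rfl)
  have hm : ∀ a ∈ maxIdeal k n, φ a 0 0 = 0 ∧ φ a 1 1 = 0 ∧ φ a 1 0 = 0 := by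
    intro a ha
    rw [mem_maxIdeal_iff] at ha
    obtain ⟨g, -, rfl⟩ := exists_of_mem_filt_succ ha
    have h1 : ∀ (t : FreeMat k n), φ t 1 0 = 0 := by
      intro t
      have ht : t ∈ filt k n 0 := by rw [filt_zero]; trivial
      induction ht using Submodule.span_induction with
      | mem t ht =>
        obtain ⟨s, t, p, -, rfl⟩ := ht
        cases p with
        | one s => simp [Mono.val, φ, lift_e, E]
        | cons m p => simp [Mono.val, φ, lift_x, ξ, Matrix.mul_apply, Fin.sum_univ_two]
      | zero => simp
      | add s t _ _ hs ht => simp [hs, ht]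
      | smul c t _ ht => simp [ht]
    have hx : ∀ s t (m : Fin (n s t)), φ (x k n m) = ξ s t m := fun s t m => lift_x _ _ _ _ _ _ m
    refine ⟨?_, ?_, h1 _⟩
    · simp only [map_sum, map_mul, hx, Matrix.sum_apply]
      simp [ξ, Matrix.mul_apply, Fin.sum_univ_two, h1]
    · simp only [map_sum, map_mul, hx, Matrix.sum_apply]
      simp [ξ, Matrix.mul_apply, Fin.sum_univ_two]
  have key : ∀ z ∈ TwoSidedIdeal.span
      {z : FreeMat k n | ∃ a ∈ maxIdeal k n, ∃ b ∈ maxIdeal k n, z = a * b}, φ z = 0 := by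
    intro z hz
    have hle : TwoSidedIdeal.span
      {z : FreeMat k n | ∃ a ∈ maxIdeal k n, ∃ b ∈ maxIdeal k n, z = a * b} ≤
        TwoSidedIdeal.ker φ := by
      rw [TwoSidedIdeal.span_le]
      rintro _ ⟨a, ha, b, hb, rfl⟩
      refine (TwoSidedIdeal.mem_ker φ).2 ?_
      obtain ⟨a1, a2, a3⟩ := hm a ha
      obtain ⟨b1, b2, b3⟩ := hm b hb
      rw [map_mul]
      ext s t
      fin_cases s <;> fin_cases t <;> simp [Matrix.mul_apply, Fin.sum_univ_two, *]
    exact (TwoSidedIdeal.mem_ker φ).1 (hle hz)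
  have := congrFun (congrFun (key _ h) 0) 1
  have hx : ∀ s t (m : Fin (n s t)), φ (x k n m) = ξ s t m := fun s t m => lift_x _ _ _ _ _ _ m
  simpa [hx, ξ, Matrix.sum_apply] using this

end FreeMat

namespace FreeMat

variable {k : Type u} [Field k] {r : ℕ} {n : Fin r → Fin r → ℕ}

variable (k n) in
/-- The two-sided ideal spanned by the monomials of degree at least `d`. -/
def filtIdeal (d : ℕ) : TwoSidedIdeal (FreeMat k n) :=
  TwoSidedIdeal.mk' (filt k n d) (zero_mem _) add_mem neg_mem
    (fun h => mul_mem_filt_left _ h) (fun h => mul_mem_filt_right h _)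

theorem mem_filtIdeal {d : ℕ} {t : FreeMat k n} : t ∈ filtIdeal k n d ↔ t ∈ filt k n d := by
  rw [filtIdeal, TwoSidedIdeal.mem_mk']
  rfl

theorem smul_mem_ideal (I : TwoSidedIdeal (FreeMat k n)) (c : k) {t : FreeMat k n} (h : t ∈ I) :
    c • t ∈ I := by
  rw [Algebra.smul_def]
  exact I.mul_mem_left _ _ h

theorem sum_mem_ideal (I : TwoSidedIdeal (FreeMat k n)) {ι : Type*} (s : Finset ι)
    (f : ι → FreeMat k n) (h : ∀ i ∈ s, f i ∈ I) : ∑ i ∈ s, f i ∈ I :=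
  sum_mem h

end FreeMat

/-! ### The ideals J_N -/

namespace GMMP

open FreeMat

variable {k : Type u} [Field k] {r : ℕ} {L : GMMP.{u, x} k r} {n : Fin r → Fin r → ℕ}

/-- The set of the monomials in `B 1, …, B N` in position `(i, j)`. -/
def monos (B : ℕ → ∀ i j : Fin r, Finset (Mono n i j)) (N : ℕ) (i j : Fin r) :
    Finset (Σ _ : ℕ, Mono n i j) := (Finset.Icc 1 N).sigma fun c => B c i j

/-- The composable pairs of monomials in `B 1, …, B N` in position `(i, j)`. -/
def pairs (B : ℕ → ∀ i j : Fin r, Finset (Mono n i j)) (N : ℕ) (i j : Fin r) :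
    Finset (Σ t : ℕ × ℕ × Fin r, Mono n i t.2.2 × Mono n t.2.2 j) :=
  (Finset.Icc 1 N ×ˢ Finset.Icc 1 N ×ˢ Finset.univ).sigma
    fun t => B t.1 i t.2.2 ×ˢ B t.2.1 t.2.2 j

variable {B : ℕ → ∀ i j : Fin r, Finset (Mono n i j)} {v : ∀ {i j : Fin r}, Mono n i j → L.V i j}

theorem mem_monos {N : ℕ} {i j : Fin r} {z : Σ _ : ℕ, Mono n i j} :
    z ∈ monos B N i j ↔ (1 ≤ z.1 ∧ z.1 ≤ N) ∧ z.2 ∈ B z.1 i j := by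
  simp [monos]

theorem mem_pairs {N : ℕ} {i j : Fin r} {z : Σ t : ℕ × ℕ × Fin r, Mono n i t.2.2 × Mono n t.2.2 j} :
    z ∈ pairs B N i j ↔ ((1 ≤ z.1.1 ∧ z.1.1 ≤ N) ∧ 1 ≤ z.1.2.1 ∧ z.1.2.1 ≤ N) ∧
      z.2.1 ∈ B z.1.1 i z.1.2.2 ∧ z.2.2 ∈ B z.1.2.1 z.1.2.2 j := by
  simp [pairs]

theorem sum_monos {X : Type*} [AddCommMonoid X] (N : ℕ) (i j : Fin r) (g : Mono n i j → X) :
    ∑ z ∈ monos B N i j, g z.2 = ∑ c ∈ Finset.Icc 1 N, ∑ u ∈ B c i j, g u :=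
  Finset.sum_sigma _ _ _

theorem sum_pairs {X : Type*} [AddCommMonoid X] (N : ℕ) (i j : Fin r)
    (g : ∀ s, Mono n i s → Mono n s j → X) :
    ∑ z ∈ pairs B N i j, g z.1.2.2 z.2.1 z.2.2 =
      ∑ a ∈ Finset.Icc 1 N, ∑ b ∈ Finset.Icc 1 N, ∑ s : Fin r, ∑ p ∈ B a i s, ∑ q ∈ B b s j,
        g s p q := by
  rw [pairs, Finset.sum_sigma, Finset.sum_product]
  refine Finset.sum_congr rfl fun a _ => ?_
  rw [Finset.sum_product]
  refine Finset.sum_congr rfl fun b _ => Finset.sum_congr rfl fun s _ => ?_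
  rw [Finset.sum_product]

theorem monos_mono {N N' : ℕ} (h : N ≤ N') (i j : Fin r) : monos B N i j ⊆ monos B N' i j := by
  intro z hz
  rw [mem_monos] at hz ⊢
  exact ⟨⟨hz.1.1, hz.1.2.trans h⟩, hz.2⟩

theorem pairs_mono {N N' : ℕ} (h : N ≤ N') (i j : Fin r) : pairs B N i j ⊆ pairs B N' i j := by
  intro z hz
  rw [mem_pairs] at hz ⊢
  obtain ⟨⟨⟨h1, h2⟩, h3, h4⟩, h5⟩ := hz
  exact ⟨⟨⟨h1, h2.trans h⟩, h3, h4.trans h⟩, h5⟩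

theorem obstr_eq (N : ℕ) {i j : Fin r} (y : L.W i j →ₗ[k] k) :
    L.obstr B v N y = ∑ z ∈ pairs B N i j, y (L.cup (v z.2.1) (v z.2.2)) •
      (z.2.1.val k * z.2.2.val k) := by
  rw [sum_pairs N i j fun s p q => y (L.cup (v p) (v q)) • (p.val k * q.val k), obstr]
  simp only [Mono.val_mul]

/-- `relIdeal` only depends on the earlier stages of the construction. -/
theorem relIdeal_congr {B' : ℕ → ∀ i j : Fin r, Finset (Mono n i j)}
    {v' : ∀ {i j : Fin r}, Mono n i j → L.V i j} (N : ℕ)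
    (hB : ∀ c < N, B c = B' c) (hv : ∀ c < N, ∀ i j, ∀ p ∈ B c i j, v p = v' p) :
    L.relIdeal B v N = L.relIdeal B' v' N := by
  induction N with
  | zero => rfl
  | succ N ih =>
    cases N with
    | zero => rfl
    | succ N =>
      have ih' := ih (fun c hc => hB c (by omega)) (fun c hc => hv c (by omega))
      have ho : ∀ (i j : Fin r) (y : L.W i j →ₗ[k] k),
          L.obstr B v (N + 1) y = L.obstr B' v' (N + 1) y := by
        intro i j y
        unfold obstr
        refine Finset.sum_congr rfl fun a ha => Finset.sum_congr rfl fun b hb =>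
          Finset.sum_congr rfl fun s _ => ?_
        rw [Finset.mem_Icc] at ha hb
        rw [← hB a (by omega), ← hB b (by omega)]
        refine Finset.sum_congr rfl fun p hp => Finset.sum_congr rfl fun q hq => ?_
        beta_reduce
        rw [hv a (by omega) _ _ p hp, hv b (by omega) _ _ q hq]
      rw [relIdeal, relIdeal, ih']
      simp only [ho]

theorem mul_mem_relIdeal_succ (N : ℕ) {a b : FreeMat k n} (ha : a ∈ maxIdeal k n)
    (hb : b ∈ L.relIdeal B v N) : a * b ∈ L.relIdeal B v (N + 1) := by
  cases N with
  | zero => exact TwoSidedIdeal.subset_span ⟨a, ha, b, hb, rfl⟩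
  | succ N => exact TwoSidedIdeal.subset_span (Or.inl ⟨a, ha, b, hb, Or.inl rfl⟩)

theorem mul_mem_relIdeal_succ' (N : ℕ) {a b : FreeMat k n} (ha : a ∈ L.relIdeal B v N)
    (hb : b ∈ maxIdeal k n) : a * b ∈ L.relIdeal B v (N + 1) := by
  cases N with
  | zero => exact TwoSidedIdeal.subset_span ⟨a, ha, b, hb, rfl⟩
  | succ N => exact TwoSidedIdeal.subset_span (Or.inl ⟨b, hb, a, ha, Or.inr rfl⟩)

theorem obstr_mem_relIdeal (N : ℕ) {i j : Fin r} (y : L.W i j →ₗ[k] k) (hy : y ∘ₗ L.d = 0) :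
    L.obstr B v N y ∈ L.relIdeal B v (N + 1) := by
  cases N with
  | zero =>
    rw [obstr]
    simp
  | succ N => exact TwoSidedIdeal.subset_span (Or.inr ⟨i, j, y, hy, rfl⟩)

theorem val_mem_relIdeal (N : ℕ) {i j : Fin r} (p : Mono n i j) (hp : N + 1 ≤ p.deg) :
    p.val k ∈ L.relIdeal B v N := by
  induction N generalizing i with
  | zero => exact mem_maxIdeal_iff.2 (val_mem_filt p hp)
  | succ N ih =>
    cases p with
    | one i => simp [Mono.deg] at hp
    | cons l p =>
      exact mul_mem_relIdeal_succ N (x_mem_maxIdeal l) (ih p (by simpa [Mono.deg] using hp))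

theorem filt_le_relIdeal (N : ℕ) {t : FreeMat k n} (ht : t ∈ filt k n (N + 1)) :
    t ∈ L.relIdeal B v N := by
  induction ht using Submodule.span_induction with
  | mem t ht =>
    obtain ⟨i, j, p, hp, rfl⟩ := ht
    exact val_mem_relIdeal N p hp
  | zero => exact zero_mem _
  | add s t _ _ hs ht => exact add_mem hs ht
  | smul c t _ ht => exact smul_mem_ideal _ c ht

variable (B v) in
/-- The monomials of the stages up to `N` have positive degree and vanish in the algebras of the
earlier stages. -/
def Adapted (N : ℕ) : Prop := ∀ c < N, ∀ i j, ∀ p ∈ B (c + 1) i j,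
  0 < p.deg ∧ p.val k ∈ L.relIdeal B v c

theorem Adapted.mono {N N' : ℕ} (h : Adapted B v N') (hN : N ≤ N') : Adapted B v N :=
  fun c hc => h c (hc.trans_le hN)

theorem Adapted.val_mem_maxIdeal {N : ℕ} (h : Adapted B v N) {c : ℕ} (hc : 1 ≤ c) (hc' : c ≤ N)
    {i j : Fin r} {p : Mono n i j} (hp : p ∈ B c i j) : p.val k ∈ maxIdeal k n := by
  obtain ⟨c, rfl⟩ := Nat.exists_eq_add_of_le' hc
  exact mem_maxIdeal_iff.2 (val_mem_filt p (h c hc' i j p hp).1)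

/-- Two successive obstruction polynomials differ by an element of `𝔪 J_N + J_N 𝔪`. -/
theorem obstr_sub_mem {N : ℕ} (h : Adapted B v (N + 1)) (Q : TwoSidedIdeal (FreeMat k n))
    (h1 : ∀ a ∈ maxIdeal k n, ∀ b ∈ L.relIdeal B v N, a * b ∈ Q)
    (h2 : ∀ a ∈ L.relIdeal B v N, ∀ b ∈ maxIdeal k n, a * b ∈ Q)
    {i j : Fin r} (y : L.W i j →ₗ[k] k) :
    L.obstr B v (N + 1) y - L.obstr B v N y ∈ Q := by
  classical
  rw [obstr_eq, obstr_eq, ← Finset.sum_sdiff (pairs_mono (Nat.le_succ N) i j), add_sub_cancel_right]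
  refine sum_mem_ideal Q _ _ fun z hz => smul_mem_ideal Q _ ?_
  rw [Finset.mem_sdiff, mem_pairs, mem_pairs] at hz
  obtain ⟨⟨⟨⟨ha, ha'⟩, hb, hb'⟩, hp, hq⟩, hn⟩ := hz
  have hp' := h.val_mem_maxIdeal ha ha' hp
  have hq' := h.val_mem_maxIdeal hb hb' hq
  -- A pair that occurs only in the later sum has a member of stage N + 1. That member lies in J_N
  -- because the stages are adapted, and the other one lies in 𝔪.
  by_cases hcase : z.1.1 = N + 1
  · exact h2 _ (h N (by omega) _ _ _ (hcase ▸ hp)).2 _ hq'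
  · have hcase' : z.1.2.1 = N + 1 := by
      by_contra hne
      exact hn ⟨⟨⟨ha, by omega⟩, hb, by omega⟩, hp, hq⟩
    exact h1 _ hp' _ (h N (by omega) _ _ _ (hcase' ▸ hq)).2

/-- Only the generators f_y of the larger index need an argument. They differ from the previous
polynomials f_y, which already belong to the ideal, by elements of 𝔪 J + J 𝔪 one step earlier. -/
theorem relIdeal_succ_le {N : ℕ} (h : Adapted B v N) :
    L.relIdeal B v (N + 1) ≤ L.relIdeal B v N := by
  cases N with
  | zero =>
    refine TwoSidedIdeal.span_le.2 ?_
    rintro _ ⟨a, ha, b, hb, rfl⟩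
    exact TwoSidedIdeal.mul_mem_left _ _ _ hb
  | succ N =>
    refine TwoSidedIdeal.span_le.2 ?_
    rintro _ (⟨a, ha, b, hb, rfl | rfl⟩ | ⟨i, j, y, hy, rfl⟩)
    · exact TwoSidedIdeal.mul_mem_left _ _ _ hb
    · exact TwoSidedIdeal.mul_mem_right _ _ _ hb
    · have h1 := obstr_sub_mem h (L.relIdeal B v (N + 1))
        (fun a ha b hb => mul_mem_relIdeal_succ N ha hb)
        (fun a ha b hb => mul_mem_relIdeal_succ' N ha hb) y
      have h2 := add_mem h1 (obstr_mem_relIdeal (B := B) (v := v) N y hy)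
      rwa [sub_add_cancel] at h2

theorem relIdeal_le {N a b : ℕ} (h : Adapted B v N) (hab : a ≤ b) (hb : b ≤ N + 1) :
    L.relIdeal B v b ≤ L.relIdeal B v a := by
  induction b, hab using Nat.le_induction with
  | base => exact le_rfl
  | succ b _ ih => exact (relIdeal_succ_le (h.mono (by omega))).trans (ih (by omega))

/-- By induction: J_N ⊆ J_{N+1} + 𝔪^{N+1} gives 𝔪 J_N ⊆ J_{N+2} + 𝔪^{N+2} and likewise on the right.
The generators f_y of J_{N+1} agree with those of J_{N+2} modulo 𝔪 J_N + J_N 𝔪. This is what makes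
monomials of a single degree sufficient at each stage, and what allows lifts from one stage to the
next to be corrected in high order. -/
theorem relIdeal_le_sup {N : ℕ} (h : Adapted B v N) :
    L.relIdeal B v N ≤ L.relIdeal B v (N + 1) ⊔ filtIdeal k n (N + 1) := by
  induction N with
  | zero =>
    intro t ht
    exact TwoSidedIdeal.mem_sup_right (mem_filtIdeal.2 (mem_maxIdeal_iff.1 ht))
  | succ N ih =>
    have hl : ∀ a ∈ maxIdeal k n, ∀ b ∈ L.relIdeal B v N,
        a * b ∈ L.relIdeal B v (N + 2) ⊔ filtIdeal k n (N + 2) := by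
      intro a ha b hb
      obtain ⟨s, hs, t, ht, rfl⟩ := TwoSidedIdeal.mem_sup.1 (ih (h.mono (by omega)) hb)
      rw [mul_add]
      refine add_mem (TwoSidedIdeal.mem_sup_left (mul_mem_relIdeal_succ (N + 1) ha hs))
        (TwoSidedIdeal.mem_sup_right (mem_filtIdeal.2 ?_))
      have := mul_mem_filt (mem_maxIdeal_iff.1 ha) (mem_filtIdeal.1 ht)
      rwa [show N + 2 = 1 + (N + 1) by omega]
    have hr : ∀ a ∈ L.relIdeal B v N, ∀ b ∈ maxIdeal k n,
        a * b ∈ L.relIdeal B v (N + 2) ⊔ filtIdeal k n (N + 2) := by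
      intro b hb a ha
      obtain ⟨s, hs, t, ht, rfl⟩ := TwoSidedIdeal.mem_sup.1 (ih (h.mono (by omega)) hb)
      rw [add_mul]
      exact add_mem (TwoSidedIdeal.mem_sup_left (mul_mem_relIdeal_succ' (N + 1) hs ha))
        (TwoSidedIdeal.mem_sup_right (mem_filtIdeal.2
          (mul_mem_filt (a := N + 1) (b := 1) (mem_filtIdeal.1 ht) (mem_maxIdeal_iff.1 ha))))
    cases N with
    | zero =>
      refine TwoSidedIdeal.span_le.2 ?_
      rintro _ ⟨a, ha, b, hb, rfl⟩
      exact hl a ha b hb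
    | succ N =>
      refine TwoSidedIdeal.span_le.2 ?_
      rintro _ (⟨a, ha, b, hb, rfl | rfl⟩ | ⟨i, j, y, hy, rfl⟩)
      · exact hl a ha b hb
      · exact hr b hb a ha
      · have h1 := obstr_sub_mem h _ hl hr y
        have h2 := sub_mem (TwoSidedIdeal.mem_sup_left (J := filtIdeal k n (N + 1 + 2))
          (obstr_mem_relIdeal (B := B) (v := v) (N + 1 + 1) y hy)) h1
        rwa [sub_sub_cancel] at h2

end GMMP

/-! ### Linear independence and spanning of the monomial bases -/

namespace GMMP

open FreeMat

variable {k : Type u} [Field k] {r : ℕ} {L : GMMP.{u, x} k r} {n : Fin r → Fin r → ℕ}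
variable {B : ℕ → ∀ i j : Fin r, Finset (Mono n i j)} {v : ∀ {i j : Fin r}, Mono n i j → L.V i j}

variable (B v) in
/-- The sets `B 0, …, B N` are the monomial bases of the first stages of the construction. -/
structure IsStage (N : ℕ) : Prop where
  zero : ∀ (i j : Fin r) (p : Mono n i j), p ∈ B 0 i j ↔ p.deg = 0
  one : ∀ (i j : Fin r) (p : Mono n i j), p ∈ B 1 i j ↔ p.deg = 1
  mem : ∀ c, c + 2 ≤ N → ∀ i j, ∀ p ∈ B (c + 2) i j, p.val k ∈ L.relIdeal B v (c + 1)
  ind : ∀ c, c + 2 ≤ N → ∀ (i j : Fin r) (a : Mono n i j → k),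
    ∑ p ∈ B (c + 2) i j, a p • p.val k ∈ L.relIdeal B v (c + 2) → ∀ p ∈ B (c + 2) i j, a p = 0
  span : ∀ c, c + 2 ≤ N → ∀ t ∈ L.relIdeal B v (c + 1), ∃ a : ∀ i j : Fin r, Mono n i j → k,
    t - ∑ i, ∑ j, ∑ p ∈ B (c + 2) i j, a i j p • p.val k ∈ L.relIdeal B v (c + 2)

theorem IsStage.mono {N N' : ℕ} (h : IsStage B v N') (hN : N ≤ N') : IsStage B v N where
  zero := h.zero
  one := h.one
  mem c hc := h.mem c (hc.trans hN)
  ind c hc := h.ind c (hc.trans hN)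
  span c hc := h.span c (hc.trans hN)

theorem aug_val_ne_zero {i j : Fin r} (p : Mono n i j) (hp : p.deg = 0) :
    aug k n (p.val k) ≠ 0 := by
  match p, hp with
  | Mono.one i, _ =>
    intro h
    rw [Mono.val, aug_e] at h
    simpa using congrFun h i

/-- The degree is positive because J_{c+1} ⊆ J_0 = ker(aug) contains no idempotent e_i. That
inclusion itself rests on adaptedness of the earlier stages, hence the induction. -/
theorem IsStage.adapted {N : ℕ} (h : IsStage B v N) : Adapted B v N := by
  induction N with
  | zero => intro c hc; omega
  | succ N ih =>
    have ih := ih (h.mono (by omega))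
    intro c hc i j p hp
    by_cases hcN : c < N
    · exact ih c hcN i j p hp
    obtain rfl : c = N := by omega
    cases c with
    | zero =>
      have hd := (h.one i j p).1 hp
      exact ⟨by omega, val_mem_relIdeal 0 p (by omega)⟩
    | succ c =>
      have hm := h.mem c le_rfl i j p hp
      refine ⟨?_, hm⟩
      by_contra hd
      exact aug_val_ne_zero (k := k) p (by omega)
        (mem_maxIdeal.1 (relIdeal_le ih (Nat.zero_le _) (by omega) hm))

theorem IsStage.eq_var {N : ℕ} (h : IsStage B v N) {i j : Fin r} {p : Mono n i j}
    (hp : p ∈ B 1 i j) : ∃ l, p = Mono.var l := p.eq_var_of_deg ((h.one i j p).1 hp)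

theorem IsStage.sum_B_one {N : ℕ} (h : IsStage B v N) (i j : Fin r) {X : Type*} [AddCommMonoid X]
    (g : Mono n i j → X) : ∑ p ∈ B 1 i j, g p = ∑ l, g (Mono.var l) := by
  classical
  have : B 1 i j = Finset.univ.map ⟨Mono.var, Mono.var_injective⟩ := by
    ext p
    rw [Finset.mem_map]
    constructor
    · intro hp
      obtain ⟨l, rfl⟩ := h.eq_var hp
      exact ⟨l, Finset.mem_univ _, rfl⟩
    · rintro ⟨l, -, rfl⟩
      exact (h.one i j _).2 rfl
  rw [this, Finset.sum_map]
  rfl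

/-- The monomials of `B 0, …, B N` are linearly independent modulo `J_N`. -/
theorem IsStage.eq_zero {N : ℕ} (h : IsStage B v N) {i j : Fin r} (a : Mono n i j → k)
    (ha : ∑ c ∈ Finset.range (N + 1), ∑ p ∈ B c i j, a p • p.val k ∈ L.relIdeal B v N)
    {c : ℕ} (hc : c ≤ N) {p : Mono n i j} (hp : p ∈ B c i j) : a p = 0 := by
  classical
  induction N generalizing c p with
  | zero =>
    obtain rfl : c = 0 := by omega
    rw [zero_add, Finset.sum_range_one] at ha
    have hs : ∑ q ∈ B 0 i j, a q • q.val k = a p • p.val k := by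
      refine Finset.sum_eq_single_of_mem p hp fun q hq hne => absurd ?_ hne
      have hq := (h.zero i j q).1 hq
      have hp := (h.zero i j p).1 hp
      match p, q, hp, hq with
      | Mono.one _, Mono.one _, _, _ => rfl
    rw [hs] at ha
    have h0 := mem_maxIdeal.1 ha
    rw [map_smul] at h0
    exact (smul_eq_zero.1 h0).resolve_right (aug_val_ne_zero p ((h.zero i j p).1 hp))
  | succ N ih =>
    have had := h.adapted
    have hlast : ∑ p ∈ B (N + 1) i j, a p • p.val k ∈ L.relIdeal B v N :=
      sum_mem_ideal _ _ _ fun q hq => smul_mem_ideal _ _ (had N (by omega) i j q hq).2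
    -- Modulo J_N the monomials of stage N + 1 vanish, so the induction hypothesis already kills all
    -- earlier coefficients; the last stage is then treated alone.
    have hprev : ∀ {c : ℕ}, c ≤ N → ∀ {p : Mono n i j}, p ∈ B c i j → a p = 0 := by
      intro c hc p hp
      refine ih (h.mono (by omega)) ?_ hc hp
      have := sub_mem (relIdeal_succ_le (had.mono (by omega)) ha) hlast
      rwa [Finset.sum_range_succ, add_sub_cancel_right] at this
    by_cases hcN : c ≤ N
    · exact hprev hcN hp
    obtain rfl : c = N + 1 := by omega
    rw [Finset.sum_range_succ, Finset.sum_eq_zero, zero_add] at ha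
    · cases N with
      | zero =>
        obtain ⟨l, rfl⟩ := h.eq_var hp
        rw [zero_add, h.sum_B_one] at ha
        simp only [Mono.val_var] at ha
        exact eq_zero_of_sum_x_mem (fun l => a (Mono.var l)) ha l
      | succ N => exact h.ind N le_rfl i j a ha p hp
    · intro c hc
      rw [Finset.mem_range] at hc
      exact Finset.sum_eq_zero fun q hq => by rw [hprev (by omega) hq, zero_smul]

/-- If a linear combination of the monomials of `B 0, …, B N` represents an element of `J_c`, then
the coefficients of the monomials of `B 0, …, B c` vanish. -/
theorem IsStage.eq_zero_of_sub_mem {N : ℕ} (h : IsStage B v N) {i j : Fin r} (a : Mono n i j → k)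
    {t : FreeMat k n}
    (ha : t - ∑ c ∈ Finset.range (N + 1), ∑ p ∈ B c i j, a p • p.val k ∈ L.relIdeal B v N)
    {c : ℕ} (hcN : c ≤ N) (ht : t ∈ L.relIdeal B v c) {b : ℕ} (hb : b ≤ c) {p : Mono n i j}
    (hp : p ∈ B b i j) : a p = 0 := by
  have had := h.adapted
  refine (h.mono hcN).eq_zero a ?_ hb hp
  have h1 := sub_mem ht (relIdeal_le had hcN (by omega) ha)
  rw [sub_sub_cancel, ← Finset.sum_range_add_sum_Ico _ (show c + 1 ≤ N + 1 by omega)] at h1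
  have h2 : ∑ d ∈ Finset.Ico (c + 1) (N + 1), ∑ p ∈ B d i j, a p • p.val k ∈
      L.relIdeal B v c := by
    refine sum_mem_ideal _ _ _ fun d hd => sum_mem_ideal _ _ _ fun q hq => smul_mem_ideal _ _ ?_
    rw [Finset.mem_Ico] at hd
    obtain ⟨d, rfl⟩ : ∃ e, d = e + 1 := ⟨d - 1, by omega⟩
    exact relIdeal_le had (show c ≤ d by omega) (by omega) (had d (by omega) i j q hq).2
  have := sub_mem h1 h2
  rwa [add_sub_cancel_right] at this

/-- Independence of stage c applied to a single monomial. Since the monomials of later stages do lie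
in J_c, it follows that the stages are disjoint. -/
theorem IsStage.val_notMem {N : ℕ} (h : IsStage B v N) {c : ℕ} (hc : c ≤ N) {i j : Fin r}
    {p : Mono n i j} (hp : p ∈ B c i j) : p.val k ∉ L.relIdeal B v c := by
  classical
  intro hm
  have hs : ∑ q ∈ B c i j, (if q = p then (1 : k) else 0) • q.val k = p.val k := by
    rw [Finset.sum_eq_single_of_mem p hp fun q _ hq => by rw [if_neg hq, zero_smul], if_pos rfl,
      one_smul]
  match c with
  | 0 => exact aug_val_ne_zero p ((h.zero i j p).1 hp) (mem_maxIdeal.1 hm)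
  | 1 =>
    obtain ⟨l, rfl⟩ := h.eq_var hp
    rw [← hs, h.sum_B_one] at hm
    simp only [Mono.val_var] at hm
    simpa using eq_zero_of_sum_x_mem (fun m => if Mono.var m = Mono.var l then (1 : k) else 0) hm l
  | c + 2 =>
    have := h.ind c hc i j (fun q => if q = p then 1 else 0) (by rwa [hs]) p hp
    simp at this

theorem IsStage.notMem {N : ℕ} (h : IsStage B v N) {c d : ℕ} (hcd : c < d) (hd : d ≤ N)
    {i j : Fin r} {p : Mono n i j} (hp : p ∈ B c i j) : p ∉ B d i j := by
  intro hp'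
  obtain ⟨d, rfl⟩ : ∃ e, d = e + 1 := ⟨d - 1, by omega⟩
  exact h.val_notMem (by omega) hp
    (relIdeal_le h.adapted (show c ≤ d by omega) (by omega) (h.adapted d (by omega) i j p hp').2)

/-- The monomials of `B 0, …, B N` span `k⟨N⟩` modulo `J_N`. -/
theorem IsStage.exists_sub_mem {N : ℕ} (h : IsStage B v N) (t : FreeMat k n) :
    ∃ a : ∀ i j : Fin r, Mono n i j → k,
      t - ∑ i, ∑ j, ∑ c ∈ Finset.range (N + 1), ∑ p ∈ B c i j, a i j p • p.val k ∈
        L.relIdeal B v N := by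
  classical
  induction N with
  | zero =>
    refine ⟨fun i _ _ => aug k n t i, ?_⟩
    have hsum : ∑ i, ∑ j, ∑ c ∈ Finset.range (0 + 1), ∑ p ∈ B c i j, aug k n t i • p.val k =
        incl k n (aug k n t) := by
      rw [incl_apply]
      refine Finset.sum_congr rfl fun i _ => ?_
      rw [Finset.sum_eq_single_of_mem i (Finset.mem_univ _)]
      · rw [zero_add, Finset.sum_range_one, Finset.sum_eq_single_of_mem (Mono.one i)
          ((h.zero i i _).2 rfl)]
        · rfl
        · intro p hp hne
          have hp := (h.zero i i p).1 hp
          match p, hp with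
          | Mono.one _, _ => exact absurd rfl hne
      · intro j _ hj
        rw [zero_add, Finset.sum_range_one]
        refine Finset.sum_eq_zero fun p hp => ?_
        have hp := (h.zero i j p).1 hp
        match p, hp with
        | Mono.one _, _ => exact absurd rfl hj
    rw [hsum]
    exact mem_maxIdeal_iff.2 (sub_incl_mem t)
  | succ N ih =>
    obtain ⟨a, ha⟩ := ih (h.mono (Nat.le_succ N))
    obtain ⟨b, hb⟩ : ∃ b : ∀ i j : Fin r, Mono n i j → k,
        t - ∑ i, ∑ j, ∑ c ∈ Finset.range (N + 1), ∑ p ∈ B c i j, a i j p • p.val k -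
          ∑ i, ∑ j, ∑ p ∈ B (N + 1) i j, b i j p • p.val k ∈ L.relIdeal B v (N + 1) := by
      cases N with
      | zero =>
        obtain ⟨g, -, hg⟩ := exists_of_mem_filt_succ (mem_maxIdeal_iff.1 ha)
        have hx : ∀ i j (l : Fin (n i j)), x k n l * g i j l -
            aug k n (g i j l) j • x k n l ∈ L.relIdeal B v 1 := by
          intro i j l
          have h1 : aug k n (g i j l) j • x k n l = x k n l * incl k n (aug k n (g i j l)) := by
            rw [← x_mul_e, mul_assoc, incl_apply, Finset.mul_sum, Finset.sum_eq_single j]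
            · rw [mul_smul_comm, e_mul_e, if_pos rfl, mul_smul_comm]
            · intro s _ hs
              rw [mul_smul_comm, e_mul_e, if_neg (Ne.symm hs), smul_zero]
            · simp
          rw [h1, ← mul_sub]
          exact mul_mem_relIdeal_succ 0 (x_mem_maxIdeal l) (mem_maxIdeal_iff.2 (sub_incl_mem _))
        choose b hb using fun i j => show ∃ b : Mono n i j → k, ∀ l, b (Mono.var l) =
            aug k n (g i j l) j from
          ⟨Function.extend Mono.var (fun l => aug k n (g i j l) j) 0, fun l =>
            Mono.var_injective.extend_apply _ _ l⟩
        refine ⟨b, ?_⟩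
        rw [hg, ← Finset.sum_sub_distrib]
        refine sum_mem_ideal _ _ _ fun i _ => ?_
        rw [← Finset.sum_sub_distrib]
        refine sum_mem_ideal _ _ _ fun j _ => ?_
        rw [zero_add, h.sum_B_one, ← Finset.sum_sub_distrib]
        refine sum_mem_ideal _ _ _ fun l _ => ?_
        rw [hb, Mono.val_var]
        exact hx i j l
      | succ N => exact h.span N le_rfl _ ha
    -- The stages are disjoint, so the coefficients found for stage N + 1 and those for the earlier
    -- stages glue to one function of the monomial.
    refine ⟨fun i j p => if p ∈ B (N + 1) i j then b i j p else a i j p, ?_⟩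
    convert hb using 1
    rw [sub_sub, ← Finset.sum_add_distrib]
    congr 1
    refine Finset.sum_congr rfl fun i _ => ?_
    rw [← Finset.sum_add_distrib]
    refine Finset.sum_congr rfl fun j _ => ?_
    rw [Finset.sum_range_succ]
    beta_reduce
    congr 1
    · refine Finset.sum_congr rfl fun c hc => Finset.sum_congr rfl fun p hp => ?_
      rw [Finset.mem_range] at hc
      rw [if_neg (h.notMem hc le_rfl hp)]
    · exact Finset.sum_congr rfl fun p hp => by rw [if_pos hp]

/-- The monomials of `B 0, …, B N` in position `(i, j)` span the `(i, j)`-component of `k⟨N⟩`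
modulo `J_N`. -/
theorem IsStage.exists_coeff {N : ℕ} (h : IsStage B v N) {i j : Fin r} (t : FreeMat k n)
    (ht : e k n i * t * e k n j = t) :
    ∃ a : Mono n i j → k,
      t - ∑ c ∈ Finset.range (N + 1), ∑ p ∈ B c i j, a p • p.val k ∈ L.relIdeal B v N := by
  classical
  obtain ⟨a, ha⟩ := h.exists_sub_mem t
  refine ⟨a i j, ?_⟩
  -- Multiplication by e_i on the left and e_j on the right fixes t and retains only the monomials
  -- in position (i, j).
  have h1 := TwoSidedIdeal.mul_mem_right _ _ (e k n j) (TwoSidedIdeal.mul_mem_left _ (e k n i) _ ha)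
  rw [mul_sub, sub_mul, ht] at h1
  convert h1 using 2
  have hv : ∀ (i' j' : Fin r) (p : Mono n i' j'), e k n i * p.val k * e k n j =
      if i = i' ∧ j' = j then p.val k else 0 := by
    intro i' j' p
    rw [← p.e_mul_val, ← mul_assoc, e_mul_e, p.e_mul_val, ite_mul, zero_mul, ite_mul, zero_mul]
    by_cases hi : i = i'
    · subst hi
      rw [if_pos rfl, p.e_mul_val, ← p.val_mul_e, mul_assoc, e_mul_e]
      by_cases hj : j' = j
      · simp [hj]
      · simp [hj]
    · simp [hi]
  rw [Finset.mul_sum, Finset.sum_mul, Finset.sum_eq_single_of_mem i (Finset.mem_univ _),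
    Finset.mul_sum, Finset.sum_mul, Finset.sum_eq_single_of_mem j (Finset.mem_univ _)]
  · simp only [Finset.mul_sum, Finset.sum_mul, mul_smul_comm, smul_mul_assoc, hv]
    simp
  · intro j' _ hj
    simp only [Finset.mul_sum, Finset.sum_mul, mul_smul_comm, smul_mul_assoc, hv]
    simp [hj]
  · intro i' _ hi
    simp only [Finset.mul_sum, Finset.sum_mul, mul_smul_comm, smul_mul_assoc, hv]
    simp [Ne.symm hi]

end GMMP

/-! ### Runs and their Maurer–Cartan equation -/

namespace GMMP

open FreeMat

variable {k : Type u} [Field k] {r : ℕ} {L : GMMP.{u, x} k r} {n : Fin r → Fin r → ℕ}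

theorem mkₐ_eq_iff {I : TwoSidedIdeal (FreeMat k n)} {s t : FreeMat k n} :
    Ideal.Quotient.mkₐ k I.asIdeal s = Ideal.Quotient.mkₐ k I.asIdeal t ↔ s - t ∈ I := by
  rw [Ideal.Quotient.mkₐ_eq_mk, Ideal.Quotient.mk_eq_mk_iff_sub_mem, TwoSidedIdeal.mem_asIdeal]

theorem mkₐ_eq_zero_iff {I : TwoSidedIdeal (FreeMat k n)} {s : FreeMat k n} :
    Ideal.Quotient.mkₐ k I.asIdeal s = 0 ↔ s ∈ I := by
  rw [← map_zero (Ideal.Quotient.mkₐ k I.asIdeal), mkₐ_eq_iff, sub_zero]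

/-- The monomials of `C` are a basis of the kernel `J / J'` of `k⟨N⟩ / J' → k⟨N⟩ / J`. -/
def IsBasisOf (J J' : TwoSidedIdeal (FreeMat k n)) (C : ∀ i j : Fin r, Finset (Mono n i j)) :
    Prop :=
  LinearIndependent k (fun p : Σ i j : Fin r, {p : Mono n i j // p ∈ C i j} =>
    (Ideal.Quotient.mkₐ k J'.asIdeal (p.2.2.1.val k) : FreeMat k n ⧸ J'.asIdeal)) ∧
  ∀ h : FreeMat k n ⧸ J'.asIdeal,
    h ∈ Submodule.span k (Set.range (fun p : Σ i j : Fin r, {p : Mono n i j // p ∈ C i j} =>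
      (Ideal.Quotient.mkₐ k J'.asIdeal (p.2.2.1.val k) : FreeMat k n ⧸ J'.asIdeal))) ↔
    ∃ t ∈ J, Ideal.Quotient.mkₐ k J'.asIdeal t = h

namespace IsBasisOf

variable {J J' : TwoSidedIdeal (FreeMat k n)} {C : ∀ i j : Fin r, Finset (Mono n i j)}

theorem val_mem (h : IsBasisOf J J' C) (hJ : J' ≤ J) {i j : Fin r} {p : Mono n i j}
    (hp : p ∈ C i j) : p.val k ∈ J := by
  obtain ⟨t, ht, hpt⟩ := (h.2 (Ideal.Quotient.mkₐ k _ (p.val k))).1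
    (Submodule.subset_span ⟨⟨i, j, p, hp⟩, rfl⟩)
  have h2 := sub_mem ht (hJ (mkₐ_eq_iff.1 hpt))
  rwa [sub_sub_cancel] at h2

theorem eq_zero (h : IsBasisOf J J' C) {i j : Fin r} (a : Mono n i j → k)
    (ha : ∑ p ∈ C i j, a p • p.val k ∈ J') {p : Mono n i j} (hp : p ∈ C i j) : a p = 0 := by
  have hinj : Function.Injective (fun q : {q : Mono n i j // q ∈ C i j} =>
      (⟨i, j, q⟩ : Σ i j : Fin r, {p : Mono n i j // p ∈ C i j})) := by
    intro q q' h
    simpa using h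
  have hli := h.1.comp _ hinj
  rw [Fintype.linearIndependent_iff] at hli
  refine hli (fun q => a q.1) ?_ ⟨p, hp⟩
  rw [← mkₐ_eq_zero_iff] at ha
  rw [← ha, map_sum, ← Finset.sum_coe_sort (C i j)]
  rfl

theorem exists_sub_mem (h : IsBasisOf J J' C) {t : FreeMat k n} (ht : t ∈ J) :
    ∃ a : ∀ i j : Fin r, Mono n i j → k,
      t - ∑ i, ∑ j, ∑ p ∈ C i j, a i j p • p.val k ∈ J' := by
  classical
  have h1 := (h.2 (Ideal.Quotient.mkₐ k _ t)).2 ⟨t, ht, rfl⟩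
  obtain ⟨a, ha⟩ := (Submodule.mem_span_range_iff_exists_fun k).1 h1
  refine ⟨fun i j p => if hp : p ∈ C i j then a ⟨i, j, p, hp⟩ else 0, ?_⟩
  rw [← mkₐ_eq_iff, ← ha, map_sum, Fintype.sum_sigma]
  refine Finset.sum_congr rfl fun i _ => ?_
  rw [map_sum, Fintype.sum_sigma]
  refine Finset.sum_congr rfl fun j _ => ?_
  rw [map_sum, ← Finset.sum_coe_sort (C i j)]
  refine Finset.sum_congr rfl fun p _ => ?_
  beta_reduce
  rw [dif_pos p.2, map_smul]

end IsBasisOf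

/-- Translates the basis conditions from the quotients to congruences in k⟨N⟩. The inclusion J_{c+2}
⊆ J_{c+1}, needed to see the new monomials in J_{c+1}, comes from the stages already treated. -/
theorem isStage_of_isBasisOf {B : ℕ → ∀ i j : Fin r, Finset (Mono n i j)}
    {v : ∀ {i j : Fin r}, Mono n i j → L.V i j} {N : ℕ}
    (zero : ∀ (i j : Fin r) (p : Mono n i j), p ∈ B 0 i j ↔ p.deg = 0)
    (one : ∀ (i j : Fin r) (p : Mono n i j), p ∈ B 1 i j ↔ p.deg = 1)
    (h : ∀ c, c + 2 ≤ N → IsBasisOf (L.relIdeal B v (c + 1)) (L.relIdeal B v (c + 2)) (B (c + 2))) :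
    IsStage B v N := by
  induction N with
  | zero => exact ⟨zero, one, fun c hc => by omega, fun c hc => by omega, fun c hc => by omega⟩
  | succ N ih =>
    have ih := ih fun c hc => h c (by omega)
    exact ⟨zero, one, fun c hc i j p hp =>
      (h c hc).val_mem (relIdeal_succ_le (ih.adapted.mono (by omega))) hp,
      fun c hc i j a ha p hp => (h c hc).eq_zero a ha hp,
      fun c hc t ht => (h c hc).exists_sub_mem ht⟩

namespace Run

variable {X : ∀ i j : Fin r, Fin (n i j) → L.V i j}

theorem isStage (R : L.Run X) (N : ℕ) : IsStage R.B R.v N :=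
  isStage_of_isBasisOf R.mem_B_zero R.mem_B_one fun c _ => ⟨R.linInd c, R.span c⟩

theorem adapted (R : L.Run X) (N : ℕ) : Adapted R.B R.v N := (R.isStage N).adapted

theorem relIdeal_le (R : L.Run X) {a b : ℕ} (hab : a ≤ b) :
    L.relIdeal R.B R.v b ≤ L.relIdeal R.B R.v a :=
  GMMP.relIdeal_le (R.adapted b) hab (Nat.le_succ b)

theorem val_mem (R : L.Run X) {c : ℕ} {i j : Fin r} {p : Mono n i j} (hp : p ∈ R.B (c + 1) i j) :
    p.val k ∈ L.relIdeal R.B R.v c := (R.adapted (c + 1) c (Nat.lt_succ_self c) i j p hp).2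

theorem val_mem_maxIdeal (R : L.Run X) {c : ℕ} (hc : 1 ≤ c) {i j : Fin r} {p : Mono n i j}
    (hp : p ∈ R.B c i j) : p.val k ∈ maxIdeal k n :=
  (R.adapted c).val_mem_maxIdeal hc le_rfl hp

/-- A product of monomials one of which belongs to a stage from the `c`-th on vanishes in
`H̄_c`. -/
theorem mul_mem (R : L.Run X) {a b c : ℕ} (ha : 1 ≤ a) (hb : 1 ≤ b) (hc : c ≤ a ∨ c ≤ b)
    {i s j : Fin r} {p : Mono n i s} {q : Mono n s j} (hp : p ∈ R.B a i s) (hq : q ∈ R.B b s j) :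
    p.val k * q.val k ∈ L.relIdeal R.B R.v c := by
  have hp' := R.val_mem_maxIdeal ha hp
  have hq' := R.val_mem_maxIdeal hb hq
  obtain ⟨a, rfl⟩ : ∃ e, a = e + 1 := ⟨a - 1, by omega⟩
  obtain ⟨b, rfl⟩ : ∃ e, b = e + 1 := ⟨b - 1, by omega⟩
  rcases hc with hc | hc
  · exact R.relIdeal_le hc (mul_mem_relIdeal_succ' a (R.val_mem hp) hq')
  · exact R.relIdeal_le hc (mul_mem_relIdeal_succ b hp' (R.val_mem hq))

/-- The Maurer–Cartan equation of the element `∑ u ⊗ v_u` over `H̄_{N+2}`. -/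
theorem maurerCartan (R : L.Run X) (hX : ∀ i j l, L.d (X i j l) = 0) (N : ℕ) (i j : Fin r)
    (f : FreeMat k n →ₗ[k] k) (hf : ∀ t ∈ L.relIdeal R.B R.v (N + 2), f t = 0) :
    ∑ z ∈ monos R.B (N + 2) i j, f (z.2.val k) • L.d (R.v z.2) +
      ∑ z ∈ pairs R.B (N + 2) i j, f (z.2.1.val k * z.2.2.val k) •
        L.cup (R.v z.2.1) (R.v z.2.2) = 0 := by
  classical
  obtain ⟨β, hβ, -⟩ := R.d_v N
  -- the coefficients of a product of two monomials
  have hcoef : ∀ z ∈ pairs R.B (N + 2) i j, ∀ c ≤ N + 2,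
      z.2.1.val k * z.2.2.val k ∈ L.relIdeal R.B R.v c → ∀ b ≤ c, ∀ u ∈ R.B b i j,
        β (z.2.1.mul z.2.2) u = 0 := by
    intro z _ c hc hz b hb u hu
    refine (R.isStage (N + 2)).eq_zero_of_sub_mem (β (z.2.1.mul z.2.2)) (hβ i j _) hc ?_ hb hu
    rwa [Mono.val_mul]
  have hz1 : ∀ z ∈ pairs R.B (N + 2) i j, z.2.1.val k * z.2.2.val k ∈ L.relIdeal R.B R.v 1 := by
    intro z hz
    rw [mem_pairs] at hz
    exact R.mul_mem hz.1.1.1 hz.1.2.1 (Or.inl hz.1.1.1) hz.2.1 hz.2.2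
  have hprod : ∀ z ∈ pairs R.B (N + 2) i j, f (z.2.1.val k * z.2.2.val k) =
      ∑ u ∈ monos R.B (N + 2) i j, β (z.2.1.mul z.2.2) u.2 * f (u.2.val k) := by
    intro z hz
    have h1 := hf _ (hβ i j (z.2.1.mul z.2.2))
    rw [Finset.range_eq_Ico, Finset.sum_eq_sum_Ico_succ_bot (by omega),
      Finset.sum_eq_zero fun u hu => by rw [hcoef z hz 1 (by omega) (hz1 z hz) 0 (by omega) u hu,
        zero_smul], zero_add, map_sub, sub_eq_zero, Mono.val_mul] at h1
    rw [h1, map_sum, sum_monos (N + 2) i j fun u => β (z.2.1.mul z.2.2) u * f (u.val k)]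
    refine Finset.sum_congr (by ext; simp; omega) fun c _ => ?_
    rw [map_sum]
    exact Finset.sum_congr rfl fun u _ => by rw [map_smul, smul_eq_mul]
  -- Expand every product pq in the monomial basis and exchange the sums; the total then vanishes
  -- separately for each basis monomial u.
  have hswap : ∑ z ∈ pairs R.B (N + 2) i j, f (z.2.1.val k * z.2.2.val k) •
      L.cup (R.v z.2.1) (R.v z.2.2) = ∑ u ∈ monos R.B (N + 2) i j,
        ∑ z ∈ pairs R.B (N + 2) i j, (β (z.2.1.mul z.2.2) u.2 * f (u.2.val k)) •
          L.cup (R.v z.2.1) (R.v z.2.2) := by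
    rw [Finset.sum_comm]
    exact Finset.sum_congr rfl fun z hz => by rw [hprod z hz, Finset.sum_smul]
  rw [hswap, ← Finset.sum_add_distrib]
  refine Finset.sum_eq_zero fun u hu => ?_
  obtain ⟨⟨hu1, hu2⟩, hu⟩ := mem_monos.1 hu
  rw [Finset.sum_congr rfl fun z _ => by rw [mul_comm, mul_smul], ← Finset.smul_sum, ← smul_add]
  rw [show L.d (R.v u.2) + ∑ z ∈ pairs R.B (N + 2) i j, β (z.2.1.mul z.2.2) u.2 •
    L.cup (R.v z.2.1) (R.v z.2.2) = 0 from ?_, smul_zero]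
  obtain ⟨c, u⟩ := u
  dsimp only at hu hu1 hu2 ⊢
  match c, hu1 with
  | 1, _ =>
    -- If u is a variable, v_u is a cocycle, and the products pq lie in J_1, so they have no
    -- component along u.
    obtain ⟨l, rfl⟩ := (R.isStage 1).eq_var hu
    rw [R.v_var, hX, zero_add]
    exact Finset.sum_eq_zero fun z hz => by
      rw [hcoef z hz 1 (by omega) (hz1 z hz) 1 le_rfl _ hu, zero_smul]
  | c + 2, _ =>
    obtain ⟨γ, hγ, hd⟩ := R.d_v c
    rw [hd i j u hu, ← sum_pairs (B := R.B) (c + 1) i j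
      fun s p q => γ (p.mul q) u • L.cup (R.v p) (R.v q), neg_add_eq_zero]
    -- The coefficients used in defining v_u were chosen at stage c + 2, the present ones at stage N
    -- + 2. They agree on u by independence modulo J_{c+2}, where the monomials of later stages
    -- vanish.
    have hβγ : ∀ z ∈ pairs R.B (c + 1) i j, γ (z.2.1.mul z.2.2) u = β (z.2.1.mul z.2.2) u := by
      intro z _
      set t := z.2.1.mul z.2.2
      rw [← sub_eq_zero]
      refine (R.isStage (c + 2)).eq_zero (fun u => γ t u - β t u) ?_ le_rfl hu
      have h1 : ∑ d ∈ Finset.Ico (c + 3) (N + 3), ∑ p ∈ R.B d i j, β t p • p.val k ∈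
          L.relIdeal R.B R.v (c + 2) := by
        refine sum_mem_ideal _ _ _ fun d hd => sum_mem_ideal _ _ _ fun q hq =>
          smul_mem_ideal _ _ ?_
        rw [Finset.mem_Ico] at hd
        obtain ⟨d, rfl⟩ : ∃ e, d = e + 1 := ⟨d - 1, by omega⟩
        exact R.relIdeal_le (by omega) (R.val_mem hq)
      have h2 := R.relIdeal_le hu2 (hβ i j t)
      rw [← Finset.sum_range_add_sum_Ico _ (show c + 3 ≤ N + 3 by omega)] at h2
      have h3 := sub_mem (add_mem h2 h1) (hγ i j t)
      have h4 : ∑ d ∈ Finset.range (c + 2 + 1), ∑ p ∈ R.B d i j, (γ t p - β t p) • p.val k =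
          ∑ d ∈ Finset.range (c + 3), ∑ p ∈ R.B d i j, γ t p • p.val k -
            ∑ d ∈ Finset.range (c + 3), ∑ p ∈ R.B d i j, β t p • p.val k := by
        rw [← Finset.sum_sub_distrib]
        refine Finset.sum_congr rfl fun d _ => ?_
        rw [← Finset.sum_sub_distrib]
        exact Finset.sum_congr rfl fun p _ => sub_smul (γ t p) (β t p) (p.val k)
      rw [h4]
      convert h3 using 1
      abel
    rw [Finset.sum_congr rfl fun z hz => by rw [hβγ z hz]]
    -- A pair absent from the sum defining d v_u has a member of stage at least c + 2. Its product
    -- lies in J_{c+2} and so has coefficient 0 at u.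
    refine Finset.sum_subset (pairs_mono (by omega) i j) fun z hz hz' => ?_
    rw [mem_pairs] at hz hz'
    have hzm := mem_pairs.2 hz
    obtain ⟨⟨⟨ha, ha'⟩, hb, hb'⟩, hp, hq⟩ := hz
    have : c + 2 ≤ z.1.1 ∨ c + 2 ≤ z.1.2.1 := by
      by_contra hne
      exact hz' ⟨⟨⟨ha, by omega⟩, hb, by omega⟩, hp, hq⟩
    rw [hcoef z hzm (c + 2) hu2 (R.mul_mem ha hb this hp hq) (c + 2) le_rfl u hu, zero_smul]

end Run

end GMMP

/-! ### Existence of runs -/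

namespace GMMP

open FreeMat

variable {k : Type u} [Field k] {r : ℕ} {L : GMMP.{u, x} k r} {n : Fin r → Fin r → ℕ}

/-- A kernel which is generated by monomials of one degree has a basis of such monomials. -/
theorem exists_isBasisOf {J J' : TwoSidedIdeal (FreeMat k n)} {d : ℕ}
    (hJ : J ≤ J' ⊔ filtIdeal k n d) (hd : ∀ t ∈ filt k n d, t ∈ J)
    (hd' : ∀ t ∈ filt k n (d + 1), t ∈ J') :
    ∃ C : ∀ i j : Fin r, Finset (Mono n i j), IsBasisOf J J' C ∧
      ∀ i j, ∀ p ∈ C i j, p.deg = d := by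
  classical
  let f : (Σ i j : Fin r, Mono n i j) → FreeMat k n ⧸ J'.asIdeal := fun p =>
    Ideal.Quotient.mkₐ k J'.asIdeal (p.2.2.val k)
  let ι := {p : Σ i j : Fin r, Mono n i j // p.2.2.deg = d}
  -- A maximal independent subfamily, modulo J', of the monomials of degree d. It spans J / J'
  -- because monomials of higher degree vanish modulo J'.
  obtain ⟨κ, a, hinj, hspan, hli⟩ := exists_linearIndependent' k (fun p : ι => f p.1)
  have hli' := (linearIndepOn_range_iff hinj (fun p : ι => f p.1)).2 hli
  have hfin : ∀ i j, {p : Mono n i j | ∃ q, (a q).1 = ⟨i, j, p⟩}.Finite := by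
    intro i j
    refine (Mono.finite_deg d i j).subset ?_
    rintro p ⟨q, hq⟩
    have := (a q).2
    rwa [hq] at this
  refine ⟨fun i j => (hfin i j).toFinset, ⟨?_, ?_⟩, ?_⟩
  · let g : (Σ i j : Fin r, {p : Mono n i j // p ∈ (hfin i j).toFinset}) → Set.range a := fun p =>
      ⟨⟨⟨p.1, p.2.1, p.2.2.1⟩, by
        obtain ⟨q, hq⟩ := (hfin _ _).mem_toFinset.1 p.2.2.2
        have := (a q).2
        rwa [hq] at this⟩, by
        obtain ⟨q, hq⟩ := (hfin _ _).mem_toFinset.1 p.2.2.2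
        exact ⟨q, Subtype.ext hq⟩⟩
    have hg : Function.Injective g := by
      rintro ⟨i, j, p, hp⟩ ⟨i', j', p', hp'⟩ h
      have h1 : (⟨i, j, p⟩ : Σ i j : Fin r, Mono n i j) = ⟨i', j', p'⟩ :=
        congrArg (fun z : Set.range a => z.1.1) h
      cases h1
      rfl
    exact hli'.comp g hg
  · have hrange : Set.range (fun p : Σ i j : Fin r, {p : Mono n i j // p ∈ (hfin i j).toFinset} =>
        (Ideal.Quotient.mkₐ k J'.asIdeal (p.2.2.1.val k) : FreeMat k n ⧸ J'.asIdeal)) =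
        Set.range ((fun p : ι => f p.1) ∘ a) := by
      ext h
      constructor
      · rintro ⟨⟨i, j, p, hp⟩, rfl⟩
        obtain ⟨q, hq⟩ := (hfin i j).mem_toFinset.1 hp
        exact ⟨q, congrArg f hq⟩
      · rintro ⟨q, rfl⟩
        exact ⟨⟨(a q).1.1, (a q).1.2.1, (a q).1.2.2, (hfin _ _).mem_toFinset.2 ⟨q, rfl⟩⟩, rfl⟩
    rw [hrange, hspan]
    intro h
    constructor
    · intro hh
      induction hh using Submodule.span_induction with
      | mem h hh =>
        obtain ⟨⟨p, hp⟩, rfl⟩ := hh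
        exact ⟨p.2.2.val k, hd _ (val_mem_filt _ hp.ge), rfl⟩
      | zero => exact ⟨0, zero_mem _, map_zero _⟩
      | add s t _ _ hs ht =>
        obtain ⟨s, hs, rfl⟩ := hs
        obtain ⟨t, ht, rfl⟩ := ht
        exact ⟨s + t, add_mem hs ht, map_add _ _ _⟩
      | smul c t _ ht =>
        obtain ⟨t, ht, rfl⟩ := ht
        exact ⟨c • t, smul_mem_ideal _ c ht, map_smul _ _ _⟩
    · rintro ⟨t, ht, rfl⟩
      obtain ⟨s, hs, t, ht', rfl⟩ := TwoSidedIdeal.mem_sup.1 (hJ ht)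
      rw [map_add, mkₐ_eq_zero_iff.2 hs, zero_add]
      rw [mem_filtIdeal] at ht'
      clear hs ht
      induction ht' using Submodule.span_induction with
      | mem t ht =>
        obtain ⟨i, j, p, hp, rfl⟩ := ht
        rcases hp.eq_or_lt with hp | hp
        · exact Submodule.subset_span ⟨⟨⟨i, j, p⟩, hp.symm⟩, rfl⟩
        · rw [mkₐ_eq_zero_iff.2 (hd' _ (val_mem_filt p hp))]
          exact zero_mem _
      | zero => rw [map_zero]; exact zero_mem _
      | add s t _ _ hs ht => rw [map_add]; exact add_mem hs ht
      | smul c t _ ht => rw [map_smul]; exact Submodule.smul_mem _ c ht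
  · intro i j p hp
    obtain ⟨q, hq⟩ := (hfin i j).mem_toFinset.1 hp
    have := (a q).2
    rwa [hq] at this

/-- The obstructions to the choice of the elements `v_u` vanish in `H̄_{N+2}`. -/
theorem IsStage.exists_d_eq {B : ℕ → ∀ i j : Fin r, Finset (Mono n i j)}
    {v : ∀ {i j : Fin r}, Mono n i j → L.V i j} {N : ℕ} (h : IsStage B v (N + 2)) :
    ∃ β : ∀ {i j : Fin r}, Mono n i j → Mono n i j → k,
      (∀ (i j : Fin r) (t : Mono n i j),
        t.val k - ∑ a ∈ Finset.range (N + 3), ∑ u ∈ B a i j, β t u • u.val k ∈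
          L.relIdeal B v (N + 2)) ∧
      ∀ (i j : Fin r), ∀ u ∈ B (N + 2) i j, ∃ w : L.V i j,
        L.d w = - ∑ a ∈ Finset.Icc 1 (N + 1), ∑ b ∈ Finset.Icc 1 (N + 1), ∑ s : Fin r,
          ∑ p ∈ B a i s, ∑ q ∈ B b s j, β (p.mul q) u • L.cup (v p) (v q) := by
  choose β hβ using fun (i j : Fin r) (t : Mono n i j) => h.exists_coeff (i := i) (j := j)
    (t.val k) (by rw [t.e_mul_val, t.val_mul_e])
  refine ⟨fun {i j} => β i j, hβ, fun i j u hu => ?_⟩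
  rw [← sum_pairs (B := B) (N + 1) i j fun s p q => β i j (p.mul q) u • L.cup (v p) (v q)]
  change _ ∈ LinearMap.range (L.d (i := i) (j := j))
  refine neg_mem ?_
  by_contra hne
  -- If the sum of cup products were not a coboundary, a linear form vanishing on im d would detect
  -- it; the polynomial f_y of this form lies in J_{N+2}.
  obtain ⟨y, hy, hle⟩ := Submodule.exists_le_ker_of_notMem hne
  apply hy
  have hyd : y ∘ₗ L.d = 0 := LinearMap.range_le_ker_iff.1 hle
  have hob := obstr_mem_relIdeal (B := B) (v := v) (N + 1) y hyd
  rw [obstr_eq] at hob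
  -- The expansion of f_y in the monomial basis: its coefficient at u is the value of y on the sum
  -- of cup products, and independence modulo J_{N+2} forces it to be 0.
  have key : ∑ c ∈ Finset.range (N + 3), ∑ u ∈ B c i j,
      (∑ z ∈ pairs B (N + 1) i j, y (L.cup (v z.2.1) (v z.2.2)) * β i j (z.2.1.mul z.2.2) u) •
        u.val k ∈ L.relIdeal B v (N + 2) := by
    have h1 : ∑ z ∈ pairs B (N + 1) i j, y (L.cup (v z.2.1) (v z.2.2)) •
        (z.2.1.val k * z.2.2.val k - ∑ a ∈ Finset.range (N + 3), ∑ u ∈ B a i j,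
          β i j (z.2.1.mul z.2.2) u • u.val k) ∈ L.relIdeal B v (N + 2) := by
      refine sum_mem_ideal _ _ _ fun z _ => smul_mem_ideal _ _ ?_
      rw [← Mono.val_mul]
      exact hβ i j _
    have h2 := sub_mem hob h1
    rw [← Finset.sum_sub_distrib] at h2
    convert h2 using 1
    have h3 : ∀ z ∈ pairs B (N + 1) i j, y (L.cup (v z.2.1) (v z.2.2)) •
          (z.2.1.val k * z.2.2.val k) - y (L.cup (v z.2.1) (v z.2.2)) •
        (z.2.1.val k * z.2.2.val k - ∑ a ∈ Finset.range (N + 3), ∑ u ∈ B a i j,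
          β i j (z.2.1.mul z.2.2) u • u.val k) = ∑ a ∈ Finset.range (N + 3), ∑ u ∈ B a i j,
          (y (L.cup (v z.2.1) (v z.2.2)) * β i j (z.2.1.mul z.2.2) u) • u.val k := by
      intro z _
      rw [Algebra.smul_def, Algebra.smul_def, mul_sub, sub_sub_cancel, ← Algebra.smul_def,
        Finset.smul_sum]
      refine Finset.sum_congr rfl fun a _ => ?_
      rw [Finset.smul_sum]
      exact Finset.sum_congr rfl fun u _ => by rw [mul_smul]
    rw [Finset.sum_congr rfl h3, Finset.sum_comm]
    refine Finset.sum_congr rfl fun a _ => ?_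
    rw [Finset.sum_comm]
    exact Finset.sum_congr rfl fun u _ => by rw [Finset.sum_smul]
  have h0 := h.eq_zero _ key le_rfl hu
  rw [map_sum, ← h0]
  exact Finset.sum_congr rfl fun z _ => by rw [map_smul, smul_eq_mul, mul_comm]

/-- The conditions on the choices of the stage `c + 2`. -/
def StepSpec (L : GMMP.{u, x} k r) (B : ℕ → ∀ i j : Fin r, Finset (Mono n i j))
    (v : ∀ i j : Fin r, Mono n i j → L.V i j) (c : ℕ) : Prop :=
  IsBasisOf (L.relIdeal B (v _ _) (c + 1)) (L.relIdeal B (v _ _) (c + 2)) (B (c + 2)) ∧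
  (∀ i j, ∀ p ∈ B (c + 2) i j, p.deg = c + 2) ∧
  ∃ β : ∀ {i j : Fin r}, Mono n i j → Mono n i j → k,
    (∀ (i j : Fin r) (t : Mono n i j),
      t.val k - ∑ a ∈ Finset.range (c + 3), ∑ u ∈ B a i j, β t u • u.val k ∈
        L.relIdeal B (v _ _) (c + 2)) ∧
    ∀ (i j : Fin r), ∀ u ∈ B (c + 2) i j,
      L.d (v i j u) = - ∑ a ∈ Finset.Icc 1 (c + 1), ∑ b ∈ Finset.Icc 1 (c + 1), ∑ s : Fin r,
        ∑ p ∈ B a i s, ∑ q ∈ B b s j, β (p.mul q) u • L.cup (v i s p) (v s j q)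

theorem StepSpec.congr {B B' : ℕ → ∀ i j : Fin r, Finset (Mono n i j)}
    {v v' : ∀ i j : Fin r, Mono n i j → L.V i j} {c : ℕ} (h : StepSpec L B v c)
    (hB : ∀ a ≤ c + 2, B a = B' a) (hv : ∀ a ≤ c + 2, ∀ i j, ∀ p ∈ B a i j, v i j p = v' i j p) :
    StepSpec L B' v' c := by
  have h1 := relIdeal_congr (v := v _ _) (v' := v' _ _) (c + 1) (fun a ha => hB a (by omega))
    (fun a ha => hv a (by omega))
  have h2 := relIdeal_congr (v := v _ _) (v' := v' _ _) (c + 2) (fun a ha => hB a (by omega))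
    (fun a ha => hv a (by omega))
  obtain ⟨hb, hdeg, β, hβ, hd⟩ := h
  refine ⟨?_, ?_, β, ?_, ?_⟩
  · rwa [← h1, ← h2, ← hB _ le_rfl]
  · rwa [← hB _ le_rfl]
  · intro i j t
    rw [← h2]
    convert hβ i j t using 2
    refine Finset.sum_congr rfl fun a ha => ?_
    rw [Finset.mem_range] at ha
    rw [hB a (by omega)]
  · intro i j u hu
    rw [← hB _ le_rfl] at hu
    rw [← hv _ le_rfl i j u hu, hd i j u hu]
    congr 1
    refine Finset.sum_congr rfl fun a ha => Finset.sum_congr rfl fun b hb =>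
      Finset.sum_congr rfl fun s _ => ?_
    rw [Finset.mem_Icc] at ha hb
    rw [← hB a (by omega), ← hB b (by omega)]
    refine Finset.sum_congr rfl fun p hp => Finset.sum_congr rfl fun q hq => ?_
    rw [hv a (by omega) _ _ p hp, hv b (by omega) _ _ q hq]

/-- The first `N` steps of a run which always chooses monomials of the smallest degree. -/
structure IsPartialRun (X : ∀ i j : Fin r, Fin (n i j) → L.V i j)
    (B : ℕ → ∀ i j : Fin r, Finset (Mono n i j)) (v : ∀ i j : Fin r, Mono n i j → L.V i j)
    (N : ℕ) : Prop where
  zero : ∀ (i j : Fin r) (p : Mono n i j), p ∈ B 0 i j ↔ p.deg = 0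
  one : ∀ (i j : Fin r) (p : Mono n i j), p ∈ B 1 i j ↔ p.deg = 1
  var : ∀ (i j : Fin r) (l : Fin (n i j)), v i j (Mono.var l) = X i j l
  step : ∀ c < N, StepSpec L B v c

variable {X : ∀ i j : Fin r, Fin (n i j) → L.V i j}

theorem IsPartialRun.deg {B : ℕ → ∀ i j : Fin r, Finset (Mono n i j)}
    {v : ∀ i j : Fin r, Mono n i j → L.V i j} {N : ℕ} (h : IsPartialRun X B v N) {c : ℕ}
    (hc : c ≤ N + 1) {i j : Fin r} {p : Mono n i j} (hp : p ∈ B c i j) : p.deg = c := by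
  match c with
  | 0 => exact (h.zero i j p).1 hp
  | 1 => exact (h.one i j p).1 hp
  | c + 2 => exact (h.step c (by omega)).2.1 i j p hp

variable (X) in
theorem exists_isPartialRun_zero : ∃ (B : ℕ → ∀ i j : Fin r, Finset (Mono n i j))
    (v : ∀ i j : Fin r, Mono n i j → L.V i j), IsPartialRun X B v 0 := by
  -- Only the first two stages and the values on variables matter here. The later B and the value 0
  -- on other monomials are placeholders, to be replaced when the corresponding stage is reached.
  refine ⟨fun N i j => (Mono.finite_deg N i j).toFinset,
    fun i j => Function.extend Mono.var (X i j) 0, ?_, ?_, ?_, ?_⟩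
  · simp
  · simp
  · intro i j l
    exact Mono.var_injective.extend_apply _ _ l
  · intro c hc
    omega

/-- The new basis monomials can be taken of degree exactly N + 2, so extending v to them changes
nothing on the earlier stages. This stability in low degree is what allows a passage to the limit
over all stages. -/
theorem IsPartialRun.exists_succ {B : ℕ → ∀ i j : Fin r, Finset (Mono n i j)}
    {v : ∀ i j : Fin r, Mono n i j → L.V i j} {N : ℕ} (h : IsPartialRun X B v N) :
    ∃ (B' : ℕ → ∀ i j : Fin r, Finset (Mono n i j)) (v' : ∀ i j : Fin r, Mono n i j → L.V i j),
      IsPartialRun X B' v' (N + 1) ∧ (∀ c ≤ N + 1, B' c = B c) ∧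
      ∀ (i j : Fin r) (p : Mono n i j), p.deg ≤ N + 1 → v' i j p = v i j p := by
  classical
  have hst : IsStage B (v _ _) (N + 1) := isStage_of_isBasisOf h.zero h.one
    fun c hc => (h.step c (by omega)).1
  obtain ⟨C, hC, hCdeg⟩ := exists_isBasisOf (relIdeal_le_sup hst.adapted) (fun t ht => filt_le_relIdeal (N + 1) ht)
    (fun t ht => filt_le_relIdeal (N + 2) ht)
  let B' := Function.update B (N + 2) C
  have hB' : ∀ c, c ≠ N + 2 → B' c = B c := fun c hc => Function.update_of_ne hc _ _
  have hBC : B' (N + 2) = C := Function.update_self _ _ _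
  have hJ1 : L.relIdeal B' (v _ _) (N + 1) = L.relIdeal B (v _ _) (N + 1) :=
    relIdeal_congr _ (fun c hc => hB' c (by omega)) fun _ _ _ _ _ _ => rfl
  have hJ2 : L.relIdeal B' (v _ _) (N + 2) = L.relIdeal B (v _ _) (N + 2) :=
    relIdeal_congr _ (fun c hc => hB' c (by omega)) fun _ _ _ _ _ _ => rfl
  have hstep : ∀ c < N, StepSpec L B' v c := fun c hc =>
    (h.step c hc).congr (fun a ha => (hB' a (by omega)).symm) fun _ _ _ _ _ _ => rfl
  have hbasis : IsBasisOf (L.relIdeal B' (v _ _) (N + 1)) (L.relIdeal B' (v _ _) (N + 2))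
      (B' (N + 2)) := by
    rw [hJ1, hJ2, hBC]
    exact hC
  have hst' : IsStage B' (v _ _) (N + 2) := by
    refine isStage_of_isBasisOf (fun i j p => ?_) (fun i j p => ?_) fun c hc => ?_
    · rw [hB' 0 (by omega)]; exact h.zero i j p
    · rw [hB' 1 (by omega)]; exact h.one i j p
    · rcases (show c ≤ N by omega).eq_or_lt with rfl | hc
      · exact hbasis
      · exact (hstep c hc).1
  obtain ⟨β, hβ, hw⟩ := hst'.exists_d_eq
  choose w hw using hw
  let v' : ∀ i j : Fin r, Mono n i j → L.V i j := fun i j p =>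
    if hp : p ∈ B' (N + 2) i j then w i j p hp else v i j p
  have hv' : ∀ (i j : Fin r) (p : Mono n i j), p.deg ≤ N + 1 → v' i j p = v i j p := by
    intro i j p hp
    refine dif_neg fun hp' => ?_
    rw [hBC] at hp'
    have := hCdeg i j p hp'
    omega
  have hdeg : ∀ a ≤ N + 1, ∀ i j, ∀ p ∈ B' a i j, p.deg ≤ N + 1 := by
    intro a ha i j p hp
    rw [hB' a (by omega)] at hp
    rw [h.deg ha hp]
    exact ha
  have hvB : ∀ a ≤ N + 1, ∀ i j, ∀ p ∈ B' a i j, v i j p = v' i j p := fun a ha i j p hp =>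
    (hv' i j p (hdeg a ha i j p hp)).symm
  refine ⟨B', v', ⟨fun i j p => ?_, fun i j p => ?_, fun i j l => ?_, fun c hc => ?_⟩,
    fun c hc => hB' c (by omega), hv'⟩
  · rw [hB' 0 (by omega)]; exact h.zero i j p
  · rw [hB' 1 (by omega)]; exact h.one i j p
  · rw [hv' i j _ (by rw [Mono.deg_var]; omega)]
    exact h.var i j l
  · rcases (show c ≤ N by omega).eq_or_lt with rfl | hc
    · have hJ1' := relIdeal_congr (v := v _ _) (v' := v' _ _) (c + 1) (fun _ _ => rfl)
        (fun a ha => hvB a (by omega))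
      have hJ2' := relIdeal_congr (v := v _ _) (v' := v' _ _) (c + 2) (fun _ _ => rfl)
        (fun a ha => hvB a (by omega))
      refine ⟨?_, ?_, β, ?_, ?_⟩
      · rw [← hJ1', ← hJ2']
        exact hbasis
      · rw [hBC]
        exact hCdeg
      · rw [← hJ2']
        exact hβ
      · intro i j u hu
        rw [show v' i j u = w i j u hu from dif_pos hu, hw i j u hu]
        congr 1
        refine Finset.sum_congr rfl fun a ha => Finset.sum_congr rfl fun b hb =>
          Finset.sum_congr rfl fun s _ => ?_
        rw [Finset.mem_Icc] at ha hb
        refine Finset.sum_congr rfl fun p hp => Finset.sum_congr rfl fun q hq => ?_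
        rw [hvB a (by omega) _ _ p hp, hvB b (by omega) _ _ q hq]
    · exact (hstep c hc).congr (fun _ _ => rfl) fun a ha => hvB a (by omega)

/-- The choices of the algorithm can be made at all stages. -/
theorem nonempty_run (X : ∀ i j : Fin r, Fin (n i j) → L.V i j) : Nonempty (L.Run X) := by
  obtain ⟨B₀, v₀, h₀⟩ := exists_isPartialRun_zero X
  choose nB nv hn hnB hnv using fun (N : ℕ) (B : ℕ → ∀ i j : Fin r, Finset (Mono n i j))
    (v : ∀ i j : Fin r, Mono n i j → L.V i j) (h : IsPartialRun X B v N) => h.exists_succ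
  let S : ∀ N : ℕ, {s : (ℕ → ∀ i j : Fin r, Finset (Mono n i j)) ×
      (∀ i j : Fin r, Mono n i j → L.V i j) // IsPartialRun X s.1 s.2 N} := fun N =>
    Nat.rec ⟨(B₀, v₀), h₀⟩ (fun N s => ⟨(nB N s.1.1 s.1.2 s.2, nv N s.1.1 s.1.2 s.2),
      hn N s.1.1 s.1.2 s.2⟩) N
  have hSB : ∀ N M, N ≤ M → ∀ c ≤ N + 1, (S M).1.1 c = (S N).1.1 c := by
    intro N M hNM c hc
    induction M, hNM using Nat.le_induction with
    | base => rfl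
    | succ M hM ih => exact (hnB M _ _ (S M).2 c (by omega)).trans ih
  have hSv : ∀ N M, N ≤ M → ∀ (i j : Fin r) (p : Mono n i j), p.deg ≤ N + 1 →
      (S M).1.2 i j p = (S N).1.2 i j p := by
    intro N M hNM i j p hp
    induction M, hNM using Nat.le_induction with
    | base => rfl
    | succ M hM ih => exact (hnv M _ _ (S M).2 i j p (by omega)).trans ih
  -- Diagonal choice: after c steps the set B c is final, and after deg p steps the cochain v_p is
  -- final.
  let B : ℕ → ∀ i j : Fin r, Finset (Mono n i j) := fun c => (S c).1.1 c
  let v : ∀ i j : Fin r, Mono n i j → L.V i j := fun i j p => (S p.deg).1.2 i j p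
  have hstep : ∀ c, StepSpec L B v c := by
    intro c
    have hB : ∀ a ≤ c + 2, (S (c + 1)).1.1 a = B a := by
      intro a ha
      rcases le_total a (c + 1) with h | h
      · exact hSB a (c + 1) h a (by omega)
      · exact (hSB (c + 1) a h a ha).symm
    refine ((S (c + 1)).2.step c (Nat.lt_succ_self c)).congr hB fun a ha i j p hp => ?_
    have hdeg := (S (c + 1)).2.deg ha hp
    rcases le_total p.deg (c + 1) with h | h
    · exact hSv p.deg (c + 1) h i j p (by omega)
    · exact (hSv (c + 1) p.deg h i j p (by omega)).symm
  exact ⟨{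
    B := B
    v := v _ _
    mem_B_zero := (S 0).2.zero
    mem_B_one := (S 1).2.one
    v_var := fun i j l => (S 1).2.var i j l
    linInd := fun N => (hstep N).1.1
    span := fun N => (hstep N).1.2
    d_v := fun N => (hstep N).2.2 }⟩

end GMMP

/-! ### The limit Â is a formal pointed algebra -/

namespace PointedAlg

variable {k : Type u} [Field k] {r : ℕ}

theorem mem_augIdeal {R : PointedAlg k r} {a : R.carrier} : a ∈ R.augIdeal ↔ R.aug a = 0 :=
  Iff.rfl

theorem Hom.apply_incl {R S : PointedAlg k r} (f : R ⟶ S) (c : Fin r → k) :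
    f.toAlgHom (R.incl c) = S.incl c := DFunLike.congr_fun f.comp_incl c

theorem Hom.aug_apply {R S : PointedAlg k r} (f : R ⟶ S) (a : R.carrier) :
    S.aug (f.toAlgHom a) = R.aug a := DFunLike.congr_fun f.aug_comp a

theorem Hom.map_pow_mem {R S : PointedAlg k r} (f : R ⟶ S) {m : ℕ} {a : R.carrier}
    (ha : a ∈ R.augIdeal ^ m) : f.toAlgHom a ∈ S.augIdeal ^ m := by
  induction m generalizing a with
  | zero =>
    rw [Submodule.pow_zero, Ideal.one_eq_top]
    trivial
  | succ m ih =>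
    have hle : R.augIdeal ^ (m + 1) ≤ (S.augIdeal ^ (m + 1)).comap f.toAlgHom.toRingHom := by
      rw [Ideal.IsTwoSided.pow_succ, Ideal.mul_le]
      intro a ha b hb
      rw [Ideal.mem_comap, Ideal.IsTwoSided.pow_succ, map_mul]
      refine Ideal.mul_mem_mul ?_ (ih hb)
      exact mem_augIdeal.2 ((Hom.aug_apply f a).trans ha)
    exact hle ha

end PointedAlg

namespace GMMP

open FreeMat

variable {k : Type u} [Field k] {r : ℕ} {L : GMMP.{u, x} k r} {n : Fin r → Fin r → ℕ}

namespace Run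

variable {X : ∀ i j : Fin r, Fin (n i j) → L.V i j} (R : L.Run X)

/-- The projection `Â(L) → H̄_N`. -/
def toHbar (N : ℕ) : R.hull.carrier →ₐ[k] L.Hbar R.B R.v N :=
  (Pi.evalAlgHom k (fun N => L.Hbar R.B R.v N) N).comp R.limit.val

/-- The canonical homomorphism `k⟨N⟩ → Â(L)`. -/
def ofFree : FreeMat k n →ₐ[k] R.hull.carrier :=
  (AlgHom.pi fun N => Ideal.Quotient.mkₐ k (L.relIdeal R.B R.v N).asIdeal).codRestrict
    R.limit fun t _ => ⟨t, fun _ _ => rfl⟩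

theorem toHbar_ofFree (N : ℕ) (t : FreeMat k n) :
    R.toHbar N (R.ofFree t) = Ideal.Quotient.mkₐ k (L.relIdeal R.B R.v N).asIdeal t := rfl

theorem hull_ext {a b : R.hull.carrier} (h : ∀ N, R.toHbar N a = R.toHbar N b) : a = b :=
  Subtype.ext (funext h)

theorem exists_ofFree (a : R.hull.carrier) (N : ℕ) :
    ∃ t, ∀ m ≤ N, R.toHbar m (R.ofFree t) = R.toHbar m a := by
  obtain ⟨t, ht⟩ := a.2 N
  exact ⟨t, ht⟩

theorem toHbar_eq_zero_of_le {a : R.hull.carrier} {m N : ℕ} (h : m ≤ N) (ha : R.toHbar N a = 0) :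
    R.toHbar m a = 0 := by
  obtain ⟨t, ht⟩ := R.exists_ofFree a N
  rw [← ht m h, toHbar_ofFree, mkₐ_eq_zero_iff]
  refine R.relIdeal_le h (mkₐ_eq_zero_iff.1 ?_)
  rw [← toHbar_ofFree, ht N le_rfl, ha]

/-- Compatible sequences of polynomials define elements of `Â(L)`. -/
theorem exists_toHbar_eq (t : ℕ → FreeMat k n)
    (ht : ∀ N, t (N + 1) - t N ∈ L.relIdeal R.B R.v N) :
    ∃ a : R.hull.carrier, ∀ N, R.toHbar N a =
      Ideal.Quotient.mkₐ k (L.relIdeal R.B R.v N).asIdeal (t N) := by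
  have key : ∀ m N, m ≤ N → t N - t m ∈ L.relIdeal R.B R.v m := by
    intro m N h
    induction N, h using Nat.le_induction with
    | base => rw [sub_self]; exact zero_mem _
    | succ N h ih =>
      have := add_mem (R.relIdeal_le h (ht N)) ih
      rwa [sub_add_sub_cancel] at this
  exact ⟨⟨fun N => Ideal.Quotient.mkₐ k (L.relIdeal R.B R.v N).asIdeal (t N),
    fun N => ⟨t N, fun m hm => mkₐ_eq_iff.2 (key m N hm)⟩⟩, fun N => rfl⟩

theorem aug_ofFree (t : FreeMat k n) : R.hull.aug (R.ofFree t) = aug k n t := rfl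

theorem aug_eq_of_toHbar {a b : R.hull.carrier} (h : R.toHbar 0 a = R.toHbar 0 b) :
    R.hull.aug a = R.hull.aug b :=
  congrArg (Ideal.Quotient.liftₐ (L.relIdeal R.B R.v 0).asIdeal (FreeMat.aug k n)
      (fun _ ht => (TwoSidedIdeal.mem_ker (FreeMat.aug k n)).1 (TwoSidedIdeal.mem_asIdeal.1 ht))) h

theorem mem_augIdeal_hull {a : R.hull.carrier} :
    a ∈ R.hull.augIdeal ↔ R.toHbar 0 a = 0 := by
  obtain ⟨t, ht⟩ := R.exists_ofFree a 0
  rw [PointedAlg.mem_augIdeal, ← aug_eq_of_toHbar R (ht 0 le_rfl), ← ht 0 le_rfl, aug_ofFree,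
    toHbar_ofFree, mkₐ_eq_zero_iff]
  exact mem_maxIdeal.symm

theorem toHbar_eq_zero_of_mem {N : ℕ} {a : R.hull.carrier} (ha : a ∈ R.hull.augIdeal ^ (N + 1)) :
    R.toHbar N a = 0 := by
  induction N generalizing a with
  | zero =>
    rw [zero_add, Submodule.pow_one] at ha
    exact R.mem_augIdeal_hull.1 ha
  | succ N ih =>
    have hle : R.hull.augIdeal ^ (N + 1 + 1) ≤ RingHom.ker (R.toHbar (N + 1)) := by
      rw [Ideal.IsTwoSided.pow_succ, Ideal.mul_le]
      intro a ha b hb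
      obtain ⟨s, hs⟩ := R.exists_ofFree a (N + 1)
      obtain ⟨t, ht⟩ := R.exists_ofFree b (N + 1)
      have h1 := R.mem_augIdeal_hull.1 ha
      have h2 := ih hb
      rw [← hs 0 (by omega), toHbar_ofFree, mkₐ_eq_zero_iff] at h1
      rw [← ht N (by omega), toHbar_ofFree, mkₐ_eq_zero_iff] at h2
      rw [RingHom.mem_ker, map_mul, ← hs _ le_rfl, ← ht _ le_rfl, ← map_mul, ← map_mul,
        toHbar_ofFree, mkₐ_eq_zero_iff]
      exact mul_mem_relIdeal_succ N h1 h2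
    exact hle ha

/-- A lift to `k⟨N⟩` of the class of an element of `Â(L)` in `H̄_N` can be corrected by polynomials
of order greater than `N` to a lift of its class in `H̄_{N+1}`. -/
theorem exists_correction (a : R.hull.carrier) (N : ℕ) (s : FreeMat k n)
    (hs : R.toHbar N (R.ofFree s) = R.toHbar N a) :
    ∃ d ∈ filt k n (N + 1), R.toHbar (N + 1) (R.ofFree (s + d)) = R.toHbar (N + 1) a := by
  obtain ⟨t, ht⟩ := R.exists_ofFree a (N + 1)
  rw [← ht N (by omega), toHbar_ofFree, toHbar_ofFree, mkₐ_eq_iff] at hs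
  obtain ⟨b, hb, d, hd, hbd⟩ := TwoSidedIdeal.mem_sup.1 (relIdeal_le_sup (R.adapted N) hs)
  refine ⟨-d, neg_mem (mem_filtIdeal.1 hd), ?_⟩
  rw [← ht _ le_rfl, toHbar_ofFree, toHbar_ofFree, mkₐ_eq_iff]
  convert hb using 1
  rw [← sub_eq_iff_eq_add.2 hbd.symm]
  abel

/-- Identifies an algebraic power of the ideal with a closed ideal. An element of the kernel is a
convergent series of polynomials of growing order. Splitting off first letters writes it as a finite
sum ∑ x_ij(l) b_ij(l), there being finitely many variables, and the series b_ij(l) lie in the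
previous power by induction. -/
theorem mem_augIdeal_pow_iff {N : ℕ} {a : R.hull.carrier} :
    a ∈ R.hull.augIdeal ^ (N + 1) ↔ R.toHbar N a = 0 := by
  refine ⟨R.toHbar_eq_zero_of_mem, fun ha => ?_⟩
  induction N generalizing a with
  | zero =>
    rw [zero_add, Submodule.pow_one]
    exact R.mem_augIdeal_hull.2 ha
  | succ N ih =>
    choose d hd hds using R.exists_correction a
    -- the successive lifts of `a`
    let S : ∀ m : ℕ, {s : FreeMat k n // R.toHbar (N + 1 + m) (R.ofFree s) =
        R.toHbar (N + 1 + m) a} := fun m =>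
      Nat.rec ⟨0, by rw [map_zero, map_zero]; exact ha.symm⟩
        (fun m s => ⟨s.1 + d (N + 1 + m) s.1 s.2, hds (N + 1 + m) s.1 s.2⟩) m
    let D : ℕ → FreeMat k n := fun m => d (N + 1 + m) (S m).1 (S m).2
    have hD : ∀ m, D m ∈ filt k n (N + 1 + m + 1) := fun m => hd (N + 1 + m) (S m).1 (S m).2
    have hS : ∀ m, (S m).1 = ∑ m' ∈ Finset.range m, D m' := by
      intro m
      induction m with
      | zero => rfl
      | succ m ih =>
        rw [Finset.sum_range_succ, ← ih]
    choose g hg hDg using fun m => exists_of_mem_filt_succ (hD m)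
    -- The term g m' has order at least N + 1 + m', so modulo J_M only the terms with m' < M - N
    -- count. For M = N the sum is empty, which places b in the kernel of Â → H̄_N.
    have hG : ∀ i j (l : Fin (n i j)), ∃ b : R.hull.carrier, ∀ M, R.toHbar M b =
        Ideal.Quotient.mkₐ k (L.relIdeal R.B R.v M).asIdeal
          (∑ m' ∈ Finset.range (M - N), g m' i j l) := by
      intro i j l
      refine R.exists_toHbar_eq (fun M => ∑ m' ∈ Finset.range (M - N), g m' i j l) fun M => ?_
      by_cases hM : N ≤ M
      · rw [show M + 1 - N = M - N + 1 by omega, Finset.sum_range_succ, add_sub_cancel_left]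
        exact filt_le_relIdeal M (filt_anti (by omega) (hg (M - N) i j l))
      · rw [show M + 1 - N = M - N by omega, sub_self]
        exact zero_mem _
    choose b hb using hG
    have hab : a = ∑ i, ∑ j, ∑ l, R.ofFree (x k n l) * b i j l := by
      have hlarge : ∀ m, R.toHbar (N + 1 + m) (a - ∑ i, ∑ j, ∑ l, R.ofFree (x k n l) * b i j l) =
          0 := by
        intro m
        rw [map_sub, ← (S m).2, map_sum, sub_eq_zero]
        have h1 : ∀ i j (l : Fin (n i j)), R.toHbar (N + 1 + m) (R.ofFree (x k n l) * b i j l) =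
            R.toHbar (N + 1 + m) (R.ofFree (∑ m' ∈ Finset.range (m + 1),
              x k n l * g m' i j l)) := by
          intro i j l
          rw [map_mul, hb, ← toHbar_ofFree, ← map_mul, ← map_mul, Finset.mul_sum,
            show N + 1 + m - N = m + 1 by omega]
        simp only [map_sum, h1]
        have h2 : (∑ m' ∈ Finset.range (m + 1), D m') =
            ∑ i, ∑ j, ∑ l, ∑ m' ∈ Finset.range (m + 1), x k n l * g m' i j l := by
          rw [Finset.sum_congr rfl fun m' _ => hDg m', Finset.sum_comm]
          refine Finset.sum_congr rfl fun i _ => ?_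
          rw [Finset.sum_comm]
          refine Finset.sum_congr rfl fun j _ => ?_
          rw [Finset.sum_comm]
        have h3 : R.toHbar (N + 1 + m) (R.ofFree (S m).1) =
            R.toHbar (N + 1 + m) (R.ofFree (∑ m' ∈ Finset.range (m + 1), D m')) := by
          rw [hS, Finset.sum_range_succ, toHbar_ofFree, toHbar_ofFree, mkₐ_eq_iff,
            sub_add_cancel_left]
          exact neg_mem (filt_le_relIdeal _ (hD m))
        rw [h3, h2]
        simp only [map_sum]
      refine R.hull_ext fun M => ?_
      rw [← sub_eq_zero, ← map_sub]
      exact R.toHbar_eq_zero_of_le (show M ≤ N + 1 + M by omega) (hlarge M)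
    rw [hab, Ideal.IsTwoSided.pow_succ]
    refine sum_mem fun i _ => sum_mem fun j _ => sum_mem fun l _ => Ideal.mul_mem_mul ?_ (ih ?_)
    · exact PointedAlg.mem_augIdeal.2 ((R.aug_ofFree _).trans (aug_x l))
    · rw [hb, Nat.sub_self, Finset.sum_range_zero, map_zero]

theorem finite_hbar (N : ℕ) : Module.Finite k (L.Hbar R.B R.v N) := by
  classical
  let s : Finset (L.Hbar R.B R.v N) := (Finset.univ : Finset (Fin r × Fin r)).biUnion fun ij =>
    (Finset.range (N + 1)).biUnion fun c => (R.B c ij.1 ij.2).image fun p =>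
      Ideal.Quotient.mkₐ k (L.relIdeal R.B R.v N).asIdeal (p.val k)
  refine ⟨⟨s, ?_⟩⟩
  rw [eq_top_iff]
  rintro h -
  obtain ⟨t, rfl⟩ := Ideal.Quotient.mkₐ_surjective k _ h
  obtain ⟨a, ha⟩ := (R.isStage N).exists_sub_mem t
  rw [mkₐ_eq_iff.2 ha]
  simp only [map_sum, map_smul]
  refine sum_mem fun i _ => sum_mem fun j _ => sum_mem fun c hc => sum_mem fun p hp =>
    Submodule.smul_mem _ _ (Submodule.subset_span ?_)
  rw [Finset.mem_coe, Finset.mem_biUnion]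
  exact ⟨(i, j), Finset.mem_univ _, Finset.mem_biUnion.2 ⟨c, hc, Finset.mem_image_of_mem _ hp⟩⟩

theorem isFormal_hull : R.hull.IsFormal := by
  refine ⟨fun N => ?_, fun a ha => R.hull_ext fun N => ?_, fun a ha => ?_⟩
  · cases N with
    | zero =>
      have : Subsingleton (R.hull.carrier ⧸ R.hull.augIdeal ^ 0) := by
        rw [Submodule.pow_zero, Ideal.one_eq_top]
        exact Ideal.Quotient.subsingleton_iff.2 rfl
      infer_instance
    | succ N =>
      have := R.finite_hbar N
      let f : (R.hull.carrier ⧸ R.hull.augIdeal ^ (N + 1)) →ₗ[k] L.Hbar R.B R.v N :=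
        (Ideal.Quotient.liftₐ (R.hull.augIdeal ^ (N + 1)) (R.toHbar N)
          fun a ha => R.toHbar_eq_zero_of_mem ha).toLinearMap
      refine Module.Finite.of_injective f ((injective_iff_map_eq_zero f).2 fun h hh => ?_)
      obtain ⟨a, rfl⟩ := Ideal.Quotient.mk_surjective h
      exact Ideal.Quotient.eq_zero_iff_mem.2 (R.mem_augIdeal_pow_iff.2 hh)
  · rw [map_zero]
    exact R.toHbar_eq_zero_of_mem (ha (N + 1))
  · have hcomp : ∀ N, R.toHbar N (a (N + 2)) = R.toHbar N (a (N + 1)) := fun N => by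
      rw [← sub_eq_zero, ← map_sub]
      exact R.toHbar_eq_zero_of_mem (ha (N + 1))
    choose t ht using fun N => R.exists_ofFree (a (N + 1)) N
    obtain ⟨l, hl⟩ := R.exists_toHbar_eq t fun N => by
      rw [← mkₐ_eq_iff, ← toHbar_ofFree, ← toHbar_ofFree, ht (N + 1) N (by omega), ht N N le_rfl,
        hcomp]
    refine ⟨l, fun N => ?_⟩
    cases N with
    | zero =>
      rw [Submodule.pow_zero, Ideal.one_eq_top]
      trivial
    | succ N =>
      rw [mem_augIdeal_pow_iff, map_sub, hl, ← toHbar_ofFree, ht N N le_rfl, sub_self]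

/-- Morphisms to algebras in `Art_k` factor through some `H̄_N`. -/
theorem hom_eq_zero {S : PointedAlg k r} {m : ℕ} (hS : S.augIdeal ^ m = ⊥) (f : R.hull ⟶ S)
    {a : R.hull.carrier} {N : ℕ} (hN : m ≤ N + 1) (ha : R.toHbar N a = 0) : f.toAlgHom a = 0 := by
  have h1 := f.map_pow_mem (Ideal.pow_le_pow_right hN (R.mem_augIdeal_pow_iff.2 ha))
  rw [hS] at h1
  exact h1

theorem hom_ofFree_eq_zero {S : PointedAlg k r} {m : ℕ} (hS : S.augIdeal ^ m = ⊥) (f : R.hull ⟶ S)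
    {t : FreeMat k n} {N : ℕ} (hN : m ≤ N + 1) (ht : t ∈ L.relIdeal R.B R.v N) :
    f.toAlgHom (R.ofFree t) = 0 :=
  R.hom_eq_zero hS f hN (mkₐ_eq_zero_iff.2 ht)

/-- Continuity is automatic: by nilpotency of I(S) both morphisms factor through a common H̄_m,
which is a quotient of k⟨N⟩. -/
theorem hom_ext {S : PointedAlg k r} (hS : S.IsArt) {f g : R.hull ⟶ S}
    (h : ∀ t, f.toAlgHom (R.ofFree t) = g.toAlgHom (R.ofFree t)) : f = g := by
  obtain ⟨-, m, hm⟩ := hS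
  refine PointedAlg.Hom.ext (AlgHom.ext fun a => ?_)
  obtain ⟨t, ht⟩ := R.exists_ofFree a m
  have h0 : R.toHbar m (a - R.ofFree t) = 0 := by rw [map_sub, ht m le_rfl, sub_self]
  have hf := R.hom_eq_zero hm f (Nat.le_succ m) h0
  have hg := R.hom_eq_zero hm g (Nat.le_succ m) h0
  rw [map_sub, sub_eq_zero] at hf hg
  rw [hf, hg, h]

/-- A homomorphism from `k⟨N⟩` which vanishes on some `J_N` extends to `Â(L)`. -/
theorem exists_hom {S : PointedAlg k r} (ψ : FreeMat k n →ₐ[k] S.carrier)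
    (hincl : ∀ c, ψ (incl k n c) = S.incl c) (haug : ∀ t, S.aug (ψ t) = aug k n t) {N : ℕ}
    (hN : ∀ t ∈ L.relIdeal R.B R.v N, ψ t = 0) :
    ∃ f : R.hull ⟶ S, ∀ t, f.toAlgHom (R.ofFree t) = ψ t := by
  let F : R.hull.carrier →ₐ[k] S.carrier :=
    (Ideal.Quotient.liftₐ (L.relIdeal R.B R.v N).asIdeal ψ
      fun t ht => hN t (TwoSidedIdeal.mem_asIdeal.1 ht)).comp (R.toHbar N)
  have hF : ∀ t, F (R.ofFree t) = ψ t := fun t => rfl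
  refine ⟨⟨F, AlgHom.ext fun c => ?_, AlgHom.ext fun a => ?_⟩, hF⟩
  · exact hincl c
  · obtain ⟨t, ht⟩ := R.exists_ofFree a N
    have h1 : F a = ψ t := by
      rw [← hF]
      exact congrArg (Ideal.Quotient.liftₐ (L.relIdeal R.B R.v N).asIdeal ψ
        fun t ht => hN t (TwoSidedIdeal.mem_asIdeal.1 ht)) (ht N le_rfl).symm
    change S.aug (F a) = R.hull.aug a
    rw [h1, haug, ← aug_eq_of_toHbar R (ht 0 (Nat.zero_le _)), aug_ofFree]

end Run

end GMMP

/-! ### Idempotents of a pointed algebra and the left module S ⊗ ⨁ M_i -/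

namespace PointedAlg

variable {k : Type u} [Field k] {r : ℕ}

/-- The idempotent `e_i` of an `r`-pointed algebra. -/
def e (S : PointedAlg k r) (i : Fin r) : S.carrier := S.incl (Pi.single i 1)

variable (S : PointedAlg k r)

theorem e_mul_e (i j : Fin r) : S.e i * S.e j = if i = j then S.e i else 0 := by
  rw [e, e, ← map_mul]
  split_ifs with h
  · subst h
    rw [← Pi.single_mul, one_mul]
  · rw [show (Pi.single i 1 * Pi.single j 1 : Fin r → k) = 0 from ?_, map_zero]
    ext l
    by_cases hl : l = i
    · subst hl
      simp [h]
    · simp [hl]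

theorem e_mul_self (i : Fin r) : S.e i * S.e i = S.e i := by rw [e_mul_e, if_pos rfl]

theorem sum_e : ∑ i, S.e i = 1 := by
  simp only [e]
  rw [← map_sum, ← map_one S.incl]
  congr 1
  ext l
  simp [Pi.single_apply]

theorem incl_mul_e (c : Fin r → k) (i : Fin r) : S.incl c * S.e i = c i • S.e i := by
  rw [e, ← map_mul, ← map_smul]
  congr 1
  ext l
  by_cases hl : l = i
  · subst hl
    simp
  · simp [hl]

theorem aug_e (i : Fin r) : S.aug (S.e i) = Pi.single i 1 := S.aug_incl _

theorem Hom.map_e {R S : PointedAlg k r} (f : R ⟶ S) (i : Fin r) :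
    f.toAlgHom (R.e i) = S.e i := f.apply_incl _

end PointedAlg

section FreeModule

variable {k : Type u} [Field k] (A : Type w) [Ring A] [Algebra k A] {r : ℕ}
variable (M : Fin r → Type v) [∀ i, AddCommGroup (M i)] [∀ i, Module k (M i)]
variable [∀ i, Module Aᵐᵒᵖ (M i)] [∀ i, IsScalarTower k Aᵐᵒᵖ (M i)]

/-- The left `S`-module `S ⊗_{k^r} ⨁ M_i`. -/
def Free (S : PointedAlg k r) : Type max u v := (Bimod.extend S.incl (total k A M)).carrier

namespace Free

variable {A M} {R S : PointedAlg k r}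

instance : AddCommGroup (Free A M S) :=
  inferInstanceAs (AddCommGroup (Bimod.extend S.incl (total k A M)).carrier)

instance : Module S.carrier (Free A M S) :=
  inferInstanceAs (Module S.carrier (Bimod.extend S.incl (total k A M)).carrier)

instance : Module k (Free A M S) := Module.compHom _ (algebraMap k S.carrier)

instance : IsScalarTower k S.carrier (Free A M S) :=
  ⟨fun c s z => by
    rw [Algebra.smul_def, mul_smul]
    rfl⟩

theorem algebraMap_smul (c : k) (z : Free A M S) : algebraMap k S.carrier c • z = c • z := rfl

variable (A M S) in
/-- The canonical map `⨁ M_i → S ⊗_{k^r} ⨁ M_i`. -/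
def unit : (∀ i, M i) →+ Free A M S := Bimod.unit S.incl (total k A M)

theorem unit_smul (c : Fin r → k) (m : ∀ i, M i) :
    unit A M S (c • m) = S.incl c • unit A M S m :=
  Bimod.unit_smul S.incl (total k A M) c m

variable (A M S) in
/-- The canonical map `M_i → S ⊗_{k^r} ⨁ M_i`. -/
def of (i : Fin r) : M i →ₗ[k] Free A M S where
  toFun m := unit A M S (Pi.single i m)
  map_add' m m' := by rw [Pi.single_add, map_add]
  map_smul' c m := by
    have h : (Pi.single i (c • m) : ∀ i, M i) = (algebraMap k (Fin r → k) c) • Pi.single i m := by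
      ext l
      by_cases hl : l = i
      · subst hl
        simp
      · simp [hl]
    rw [h, unit_smul, AlgHom.commutes]
    rfl

theorem e_smul_of (i : Fin r) (m : M i) : S.e i • of A M S i m = of A M S i m := by
  change S.incl (Pi.single i 1) • unit A M S (Pi.single i m) = unit A M S (Pi.single i m)
  rw [← unit_smul]
  congr 1
  ext l
  by_cases hl : l = i
  · subst hl
    simp
  · simp [hl]

theorem unit_eq_sum (m : ∀ i, M i) : unit A M S m = ∑ i, of A M S i (m i) := by
  change _ = ∑ i, unit A M S (Pi.single i (m i))
  rw [← map_sum, Finset.univ_sum_single]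

section Desc

variable {Y : Type*} [AddCommGroup Y] [Module S.carrier Y] [Module k Y] [IsScalarTower k S.carrier Y]

/-- The `S`-linear map given by linear maps on the `M_i`. -/
def desc (h : ∀ i, M i →ₗ[k] Y) : Free A M S →ₗ[S.carrier] Y :=
  Bimod.lift S.incl (total k A M)
    -- The factors e_i make the formula linear over k^r, since h i is not required to take values in
    -- e_i Y.
    { toFun := fun m => ∑ i, S.e i • h i (m i)
      map_zero' := Finset.sum_eq_zero fun i _ => by
        change S.e i • h i 0 = 0
        rw [map_zero, smul_zero]
      map_add' := fun m m' => by
        rw [← Finset.sum_add_distrib]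
        refine Finset.sum_congr rfl fun i _ => ?_
        rw [← smul_add, ← map_add]
        rfl }
    (fun c m => by
      change ∑ i, S.e i • h i (c i • m i) = S.incl c • ∑ i, S.e i • h i (m i)
      rw [Finset.smul_sum]
      refine Finset.sum_congr rfl fun i _ => ?_
      rw [← mul_smul, S.incl_mul_e, map_smul, smul_assoc, smul_comm])

theorem desc_unit (h : ∀ i, M i →ₗ[k] Y) (m : ∀ i, M i) :
    desc h (unit A M S m) = ∑ i, S.e i • h i (m i) :=
  Bimod.lift_unit S.incl (total k A M) _ _ m

theorem desc_of (h : ∀ i, M i →ₗ[k] Y) (i : Fin r) (m : M i) :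
    desc h (of A M S i m) = S.e i • h i m := by
  change desc h (unit A M S (Pi.single i m)) = _
  rw [desc_unit, Finset.sum_eq_single_of_mem i (Finset.mem_univ i), Pi.single_eq_same]
  intro j _ hj
  rw [Pi.single_eq_of_ne hj, map_zero, smul_zero]

end Desc

theorem hom_ext {Y : Type*} [AddCommGroup Y] [Module S.carrier Y]
    {f g : Free A M S →ₗ[S.carrier] Y} (h : ∀ i m, f (of A M S i m) = g (of A M S i m)) :
    f = g :=
  have key : ∀ m : ∀ i, M i, f (unit A M S m) = g (unit A M S m) := fun m => by
    rw [unit_eq_sum, map_sum, map_sum]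
    exact Finset.sum_congr rfl fun i _ => h i (m i)
  Bimod.extend_ext S.incl (total k A M) key

@[elab_as_elim]
theorem induction {P : Free A M S → Prop} (zero : P 0) (add : ∀ y z, P y → P z → P (y + z))
    (of : ∀ (s : S.carrier) i m, P (s • of A M S i m)) (z : Free A M S) : P z := by
  let N : Submodule S.carrier (Free A M S) :=
    Submodule.span S.carrier {z | ∃ i m, z = Free.of A M S i m}
  have hN : ∀ z, z ∈ N := by
    have : N.mkQ = 0 := hom_ext fun i m => by
      rw [LinearMap.zero_apply, Submodule.mkQ_apply, Submodule.Quotient.mk_eq_zero]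
      exact Submodule.subset_span ⟨i, m, rfl⟩
    intro z
    rw [← Submodule.ker_mkQ N, this]
    exact LinearMap.mem_ker.2 rfl
  refine Submodule.closure_induction (p := fun z _ => P z) zero (fun y z _ _ => add y z) ?_ (hN z)
  rintro s _ ⟨i, m, rfl⟩
  exact of s i m

variable (A M S) in
/-- The reduction `S ⊗_{k^r} ⨁ M_i → ⨁ M_i`. -/
def proj : Free A M S →+ ∀ i, M i :=
  Bimod.liftSemi S.incl S.aug (total k A M) (AddMonoidHom.id _) (fun c m => by
    change c • m = S.aug (S.incl c) • m
    rw [S.aug_incl])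

theorem proj_smul (s : S.carrier) (z : Free A M S) :
    proj A M S (s • z) = S.aug s • proj A M S z :=
  Bimod.liftSemi_smul S.incl S.aug (total k A M) _ _ s z

theorem proj_unit (m : ∀ i, M i) : proj A M S (unit A M S m) = m :=
  Bimod.liftSemi_unit S.incl S.aug (total k A M) _ _ m

theorem proj_of (i : Fin r) (m : M i) : proj A M S (of A M S i m) = Pi.single i m := proj_unit _

variable (A M) in
/-- The semilinear map `R ⊗_{k^r} ⨁ M_i → S ⊗_{k^r} ⨁ M_i` induced by `R ⟶ S`. -/
def map (f : R ⟶ S) : Free A M R →+ Free A M S :=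
  Bimod.liftSemi R.incl f.toAlgHom (total k A M) (unit A M S) (fun c m => by
    rw [f.comp_incl]
    exact unit_smul c m)

theorem map_smul' (f : R ⟶ S) (s : R.carrier) (z : Free A M R) :
    map A M f (s • z) = f.toAlgHom s • map A M f z :=
  Bimod.liftSemi_smul R.incl f.toAlgHom (total k A M) _ _ s z

theorem map_unit (f : R ⟶ S) (m : ∀ i, M i) : map A M f (unit A M R m) = unit A M S m :=
  Bimod.liftSemi_unit R.incl f.toAlgHom (total k A M) _ _ m

theorem map_of (f : R ⟶ S) (i : Fin r) (m : M i) : map A M f (of A M R i m) = of A M S i m :=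
  map_unit f _

theorem proj_map (f : R ⟶ S) (z : Free A M R) : proj A M S (map A M f z) = proj A M R z := by
  induction z using induction with
  | zero => simp
  | add y z hy hz => rw [map_add, map_add, map_add, hy, hz]
  | of s i m => rw [map_smul', map_of, proj_smul, proj_smul, proj_of, proj_of, f.aug_apply]

variable (A M) in
/-- The semilinear map of a morphism as a linear map over `k`. -/
def mapₗ (f : R ⟶ S) : Free A M R →ₗ[k] Free A M S where
  toFun := map A M f
  map_add' := map_add _
  map_smul' c z := by
    rw [← algebraMap_smul, map_smul', AlgHom.commutes]
    rfl

theorem mapₗ_surjective (f : R ⟶ S) (hf : Function.Surjective f.toAlgHom) :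
    Function.Surjective (mapₗ A M f) := by
  intro z
  induction z using induction with
  | zero => exact ⟨0, map_zero _⟩
  | add y z hy hz =>
    obtain ⟨y, rfl⟩ := hy
    obtain ⟨z, rfl⟩ := hz
    exact ⟨y + z, map_add _ _ _⟩
  | of s i m =>
    obtain ⟨s, rfl⟩ := hf s
    have h : map A M f (s • of A M R i m) = f.toAlgHom s • of A M S i m := by
      rw [map_smul', map_of]
    exact ⟨s • of A M R i m, h⟩

variable (A M) in
/-- The coordinate `S ⊗_{k^r} ⨁ M_i → M_j` defined by a linear form on `S`. -/
def coord (ℓ : S.carrier →ₗ[k] k) (j : Fin r) : Free A M S →ₗ[k] M j :=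
  (TensorProduct.lid k (M j)).toLinearMap ∘ₗ (LinearMap.rTensor (M j) ℓ) ∘ₗ
    (desc (S := S) (Y := S.carrier ⊗[k] M j) fun i =>
      (TensorProduct.mk k S.carrier (M j) (S.e j)) ∘ₗ LinearMap.proj j ∘ₗ
        LinearMap.single k M i).restrictScalars k

theorem coord_smul_of (ℓ : S.carrier →ₗ[k] k) (j : Fin r) (s : S.carrier) (m : M j) :
    coord A M ℓ j (s • of A M S j m) = ℓ (s * S.e j) • m := by
  simp [coord, desc_of, TensorProduct.smul_tmul', S.e_mul_self]

theorem coord_smul_of_ne (ℓ : S.carrier →ₗ[k] k) {i j : Fin r} (h : i ≠ j) (s : S.carrier)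
    (m : M i) : coord A M ℓ j (s • of A M S i m) = 0 := by
  simp [coord, desc_of, Pi.single_eq_of_ne (Ne.symm h)]

theorem coord_map (f : R ⟶ S) (ℓ : S.carrier →ₗ[k] k) (j : Fin r) (z : Free A M R) :
    coord A M ℓ j (map A M f z) = coord A M (ℓ ∘ₗ f.toAlgHom.toLinearMap) j z := by
  induction z using induction with
  | zero => simp
  | add y z hy hz => rw [map_add, map_add, map_add, hy, hz]
  | of s i m =>
    rw [map_smul', map_of]
    by_cases h : i = j
    · subst h
      rw [coord_smul_of, coord_smul_of, LinearMap.comp_apply, AlgHom.toLinearMap_apply,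
        map_mul f.toAlgHom, f.map_e]
    · rw [coord_smul_of_ne _ h, coord_smul_of_ne _ h]

/-- Expansion of the elements of `S ⊗_{k^r} ⨁ M_i` along an expansion of the elements of `S`. -/
theorem eq_sum_coord {ι : Type*} [Fintype ι] (ρ : ι → S.carrier) (ℓ : ι → S.carrier →ₗ[k] k)
    (h : ∀ s, ∑ t, ℓ t s • ρ t = s) (z : Free A M S) :
    z = ∑ j, ∑ t, ρ t • of A M S j (coord A M (ℓ t) j z) := by
  induction z using induction with
  | zero => simp
  | add y z hy hz =>
    simp only [map_add, smul_add, Finset.sum_add_distrib]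
    rw [← hy, ← hz]
  | of s i m =>
    rw [Finset.sum_eq_single_of_mem i (Finset.mem_univ i)]
    · simp only [coord_smul_of, map_smul]
      simp only [smul_comm (ρ _), ← smul_assoc]
      rw [← Finset.sum_smul, h, mul_smul, e_smul_of]
    · intro j _ hj
      exact Finset.sum_eq_zero fun t _ => by
        rw [coord_smul_of_ne _ (Ne.symm hj), map_zero, smul_zero]

/-- Expansion of the elements of the kernel of `R ⊗_{k^r} ⨁ M_i → S ⊗_{k^r} ⨁ M_i`. -/
theorem exists_eq_sum_of_map_eq_zero [Module.Finite k R.carrier] [Module.Finite k S.carrier]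
    (f : R ⟶ S) (hf : Function.Surjective f.toAlgHom) :
    ∃ (d : ℕ) (ρ : Fin d → R.carrier) (ℓ : Fin d → R.carrier →ₗ[k] k),
      (∀ t, f.toAlgHom (ρ t) = 0) ∧ ∀ z : Free A M R, map A M f z = 0 →
        z = ∑ j, ∑ t, ρ t • of A M R j (coord A M (ℓ t) j z) := by
  -- A k-linear section σ splits R into ker f and σ(S). In a basis adapted to this splitting, the
  -- coordinates along σ(S) factor through f, so they vanish on z.
  obtain ⟨σ, hσ⟩ := f.toAlgHom.toLinearMap.exists_rightInverse_of_surjective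
    (LinearMap.range_eq_top.2 hf)
  have hσ' : ∀ s, f.toAlgHom (σ s) = s := fun s => LinearMap.congr_fun hσ s
  let K := LinearMap.ker f.toAlgHom.toLinearMap
  let π : R.carrier →ₗ[k] K := (LinearMap.id - σ ∘ₗ f.toAlgHom.toLinearMap).codRestrict K
    fun s => by
      rw [LinearMap.mem_ker]
      simp [hσ']
  let b := Module.finBasis k K
  let c := Module.finBasis k S.carrier
  refine ⟨_, fun t => (b t : R.carrier), fun t => b.coord t ∘ₗ π, fun t => (b t).2,
    fun z hz => ?_⟩
  have key := eq_sum_coord (A := A) (M := M)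
    (Sum.elim (fun t => (b t : R.carrier)) fun t => σ (c t))
    (Sum.elim (fun t => b.coord t ∘ₗ π) fun t => c.coord t ∘ₗ f.toAlgHom.toLinearMap)
    (fun s => by
      have h1 : ∑ t, b.coord t (π s) • (b t : R.carrier) = s - σ (f.toAlgHom s) := by
        have := congrArg Subtype.val (b.sum_repr (π s))
        rw [AddSubmonoidClass.coe_finsetSum] at this
        exact this
      have h2 : ∑ t, c.coord t (f.toAlgHom s) • σ (c t) = σ (f.toAlgHom s) := by
        conv_rhs => rw [← c.sum_repr (f.toAlgHom s)]
        rw [map_sum]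
        simp
      rw [Fintype.sum_sum_type]
      simp only [Sum.elim_inl, Sum.elim_inr, LinearMap.comp_apply, AlgHom.toLinearMap_apply]
      rw [h1, h2, sub_add_cancel]) z
  conv_lhs => rw [key]
  refine Finset.sum_congr rfl fun j _ => ?_
  rw [Fintype.sum_sum_type]
  simp only [Sum.elim_inl, Sum.elim_inr, ← coord_map, hz, map_zero, smul_zero,
    Finset.sum_const_zero, add_zero]

/-- Two elements with the same coordinates coincide. -/
theorem eq_of_coord [Module.Finite k S.carrier] {y z : Free A M S}
    (h : ∀ ℓ j, coord A M ℓ j y = coord A M ℓ j z) : y = z := by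
  let b := Module.finBasis k S.carrier
  have hb : ∀ s, ∑ t, b.coord t s • b t = s := fun s => b.sum_repr s
  rw [eq_sum_coord _ _ hb y, eq_sum_coord _ _ hb z]
  simp only [h]

theorem sub_unit_mem (z : Free A M S) :
    z - unit A M S (proj A M S z) ∈ S.augIdeal • (⊤ : Submodule S.carrier (Free A M S)) := by
  induction z using induction with
  | zero => simp
  | add y z hy hz =>
    rw [map_add, map_add, add_sub_add_comm]
    exact add_mem hy hz
  | of s i m =>
    have h : s • of A M S i m - unit A M S (proj A M S (s • of A M S i m)) =
        (s - S.incl (S.aug s)) • of A M S i m := by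
      rw [proj_smul, unit_smul, proj_of, sub_smul]
      rfl
    rw [h]
    refine Submodule.smul_mem_smul (PointedAlg.mem_augIdeal.2 ?_) trivial
    rw [map_sub, S.aug_incl, sub_self]

/-- An endomorphism which induces the identity on the reduction is bijective. -/
theorem bijective_of_proj (hS : S.IsArt) (g : Free A M S →ₗ[S.carrier] Free A M S)
    (hg : ∀ z, proj A M S (g z) = proj A M S z) : Function.Bijective g := by
  obtain ⟨-, m, hm⟩ := hS
  -- ν maps the module into its multiple by I(S); by linearity its l-th power maps into the multiple
  -- by I(S)^l. Hence ν is nilpotent and g = 1 + ν is invertible.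
  let ν : Module.End S.carrier (Free A M S) := g - 1
  have hν : ∀ (l : ℕ) (z : Free A M S),
      (ν ^ l) z ∈ (S.augIdeal ^ l) • (⊤ : Submodule S.carrier (Free A M S)) := by
    have h1 : ∀ z, ν z ∈ S.augIdeal • (⊤ : Submodule S.carrier (Free A M S)) := by
      intro z
      have h0 : proj A M S (ν z) = 0 := by
        change proj A M S (g z - z) = 0
        rw [map_sub, hg, sub_self]
      have := sub_unit_mem (ν z)
      rwa [h0, map_zero, sub_zero] at this
    intro l
    induction l with
    | zero =>
      intro z
      rw [Submodule.pow_zero, Ideal.one_eq_top, Submodule.top_smul]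
      trivial
    | succ l ih =>
      intro z
      rw [_root_.pow_succ', Module.End.mul_apply]
      have hle : (S.augIdeal ^ l) • (⊤ : Submodule S.carrier (Free A M S)) ≤
          ((S.augIdeal ^ (l + 1)) • (⊤ : Submodule S.carrier (Free A M S))).comap ν := by
        rw [Submodule.smul_le]
        intro s hs z _
        rw [Submodule.mem_comap, map_smul, Ideal.IsTwoSided.pow_add, Submodule.pow_one,
          Submodule.mul_smul]
        exact Submodule.smul_mem_smul hs (h1 z)
      exact hle (ih z)
  have hnil : IsNilpotent ν := ⟨m, LinearMap.ext fun z => by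
    have := hν m z
    rw [hm, Submodule.bot_smul] at this
    exact this⟩
  have hu := hnil.isUnit_one_add
  rw [add_sub_cancel] at hu
  exact (Module.End.isUnit_iff g).1 hu

end Free

end FreeModule

/-! ### Deformations as actions on S ⊗ ⨁ M_i -/

section Actions

variable {k : Type u} [Field k] (A : Type w) [Ring A] [Algebra k A] {r : ℕ}
variable (M : Fin r → Type v) [∀ i, AddCommGroup (M i)] [∀ i, Module k (M i)]
variable [∀ i, Module Aᵐᵒᵖ (M i)] [∀ i, IsScalarTower k Aᵐᵒᵖ (M i)]

/-- A right action of `A` on `S ⊗_{k^r} ⨁ M_i` by `S`-linear maps which reduces to the given action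
on `⨁ M_i`. -/
structure Act (S : PointedAlg k r) where
  toLin : A →ₗ[k] Module.End S.carrier (Free A M S)
  map_one : toLin 1 = 1
  map_mul : ∀ a b, toLin (a * b) = toLin b * toLin a
  proj : ∀ a z, Free.proj A M S (toLin a z) = MulOpposite.op a • Free.proj A M S z

namespace Act

variable {A M} {R S : PointedAlg k r}

/-- The action as a ring homomorphism. -/
def ringHom (ρ : Act A M S) : Aᵐᵒᵖ →+* Module.End S.carrier (Free A M S) where
  toFun a := ρ.toLin a.unop
  map_one' := ρ.map_one
  map_mul' a b := ρ.map_mul b.unop a.unop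
  map_zero' := _root_.map_zero ρ.toLin
  map_add' a b := _root_.map_add ρ.toLin a.unop b.unop

/-- The bimodule given by an action. -/
def bimod (ρ : Act A M S) : Bimod.{u, w, max u v, u} k S.carrier A where
  carrier := Free A M S
  right := Module.compHom _ ρ.ringHom
  smulComm :=
    letI : Module Aᵐᵒᵖ (Free A M S) := Module.compHom _ ρ.ringHom
    ⟨fun s a z => (_root_.map_smul (ρ.toLin a.unop) s z).symm⟩
  central c z := by
    change c • z = ρ.toLin (algebraMap k A c) z
    rw [Algebra.algebraMap_eq_smul_one, _root_.map_smul, ρ.map_one]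
    rfl

/-- The reduction of the bimodule given by an action. -/
def red (ρ : Act A M S) : Bimod.Equiv (Bimod.extend S.aug ρ.bimod) (total k A M) :=
  Bimod.equivOfLift S.aug ρ.bimod (total k A M) (Free.proj A M S)
    (fun s z => Free.proj_smul s z)
    (fun a z => ρ.proj a.unop z)
    { toFun := fun m => Bimod.unit S.aug ρ.bimod (Free.unit A M S m)
      map_add' := fun m m' => (congrArg (Bimod.unit S.aug ρ.bimod)
        (_root_.map_add (Free.unit A M S) m m')).trans
          (_root_.map_add (Bimod.unit S.aug ρ.bimod) _ _)
      map_smul' := fun c m => by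
        have h : Bimod.unit S.aug ρ.bimod (S.incl c • Free.unit A M S m) =
            S.aug (S.incl c) • Bimod.unit S.aug ρ.bimod (Free.unit A M S m) :=
          Bimod.unit_smul S.aug ρ.bimod (S.incl c) (Free.unit A M S m)
        rw [S.aug_incl] at h
        exact (congrArg (Bimod.unit S.aug ρ.bimod) (Free.unit_smul c m)).trans h }
    (fun z => by
      change Bimod.unit S.aug ρ.bimod (Free.unit A M S (Free.proj A M S z)) =
        Bimod.unit S.aug ρ.bimod z
      induction z using Free.induction with
      | zero => rw [_root_.map_zero, _root_.map_zero]
      | add y z hy hz =>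
        rw [_root_.map_add, _root_.map_add]
        exact (_root_.map_add (Bimod.unit S.aug ρ.bimod) _ _).trans
          ((congrArg₂ (· + ·) hy hz).trans (_root_.map_add (Bimod.unit S.aug ρ.bimod) _ _).symm)
      | of s i m =>
        have h1 : Bimod.unit S.aug ρ.bimod (s • Free.of A M S i m) =
            S.aug s • Bimod.unit S.aug ρ.bimod (Free.of A M S i m) :=
          Bimod.unit_smul S.aug ρ.bimod s _
        have h2 : Bimod.unit S.aug ρ.bimod (S.incl (S.aug s) • Free.of A M S i m) =
            S.aug (S.incl (S.aug s)) • Bimod.unit S.aug ρ.bimod (Free.of A M S i m) :=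
          Bimod.unit_smul S.aug ρ.bimod (S.incl (S.aug s)) _
        rw [S.aug_incl] at h2
        rw [Free.proj_smul, Free.unit_smul, Free.proj_of]
        exact h2.trans h1.symm)
    (LinearMap.ext fun m =>
      (Bimod.lift_unit S.aug ρ.bimod (Y := (total k A M).carrier) (Free.proj A M S)
        (fun s z => Free.proj_smul s z) (Free.unit A M S m)).trans (Free.proj_unit m))

/-- The deformation given by an action. -/
def deformation (ρ : Act A M S) : Deformation A M S where
  bimod := ρ.bimod
  free := ⟨LinearEquiv.refl _ _⟩
  red := ρ.red

theorem deformation_proj (ρ : Act A M S) (z : Free A M S) :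
    ρ.deformation.proj z = Free.proj A M S z :=
  Bimod.lift_unit S.aug ρ.bimod (Y := (total k A M).carrier) (Free.proj A M S)
    (fun s z => Free.proj_smul s z) z

theorem rel_iff {ρ σ : Act A M S} : (Deformation.setoid A M S).r ρ.deformation σ.deformation ↔
    ∃ g : Free A M S ≃ₗ[S.carrier] Free A M S, (∀ a z, g (ρ.toLin a z) = σ.toLin a (g z)) ∧
      ∀ z, Free.proj A M S (g z) = Free.proj A M S z := by
  constructor
  · rintro ⟨f, hf⟩
    exact ⟨f.toLin, fun a z => f.map_right (MulOpposite.op a) z, fun z =>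
      (σ.deformation_proj _).symm.trans ((hf z).trans (ρ.deformation_proj z))⟩
  · rintro ⟨g, hg, hp⟩
    exact ⟨⟨g, fun a z => hg a.unop z⟩, fun z =>
      (σ.deformation_proj _).trans ((hp z).trans (ρ.deformation_proj z).symm)⟩

/-- The base change of a free module is free on the same ⨁ M_i, which supplies the inverse H of the
induced map; the intertwining hypothesis then makes it an isomorphism of bimodules. -/
theorem map_rel (f : R ⟶ S) {ρ : Act A M R} {σ : Act A M S}
    (h : ∀ a z, Free.map A M f (ρ.toLin a z) = σ.toLin a (Free.map A M f z)) :
    (Deformation.setoid A M S).r (Deformation.map f ρ.deformation) σ.deformation := by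
  let u : (total k A M).carrier →+ (Bimod.extend f.toAlgHom ρ.bimod).carrier :=
    (Bimod.unit f.toAlgHom ρ.bimod).comp (Free.unit A M R)
  have hu : ∀ (c : Fin r → k) (m : (total k A M).carrier), u (c • m) = S.incl c • u m := by
    intro c m
    have h1 : Bimod.unit f.toAlgHom ρ.bimod (R.incl c • Free.unit A M R m) =
        f.toAlgHom (R.incl c) • Bimod.unit f.toAlgHom ρ.bimod (Free.unit A M R m) :=
      Bimod.unit_smul f.toAlgHom ρ.bimod (R.incl c) _
    rw [f.apply_incl] at h1
    exact (congrArg (Bimod.unit f.toAlgHom ρ.bimod) (Free.unit_smul c m)).trans h1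
  let H : Free A M S →ₗ[S.carrier] (Bimod.extend f.toAlgHom ρ.bimod).carrier :=
    Bimod.lift S.incl (total k A M) u hu
  have hH : ∀ i m, H (Free.of A M S i m) = Bimod.unit f.toAlgHom ρ.bimod (Free.of A M R i m) :=
    fun i m => Bimod.lift_unit S.incl (total k A M) u hu _
  have hmap : ∀ (s : R.carrier) (z : Free A M R),
      Free.map A M f (s • z) = f.toAlgHom s • Free.map A M f z := Free.map_smul' f
  have h1 : ∀ z : Free A M R, H (Free.map A M f z) = Bimod.unit f.toAlgHom ρ.bimod z := by
    intro z
    induction z using Free.induction with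
    | zero =>
      rw [_root_.map_zero, _root_.map_zero]
      exact (_root_.map_zero (Bimod.unit f.toAlgHom ρ.bimod)).symm
    | add y z hy hz =>
      rw [_root_.map_add, _root_.map_add, hy, hz]
      exact (_root_.map_add (Bimod.unit f.toAlgHom ρ.bimod) _ _).symm
    | of s i m =>
      rw [Free.map_smul', _root_.map_smul, Free.map_of, hH]
      exact (Bimod.unit_smul f.toAlgHom ρ.bimod s _).symm
  have h2 : (Bimod.lift f.toAlgHom ρ.bimod (Y := σ.bimod.carrier) (Free.map A M f) hmap).comp
      (show σ.bimod.carrier →ₗ[S.carrier] _ from H) = LinearMap.id := by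
    refine Free.hom_ext (S := S) (A := A) (M := M) fun i m => ?_
    refine (congrArg (Bimod.lift f.toAlgHom ρ.bimod (Y := σ.bimod.carrier) (Free.map A M f) hmap)
      (hH i m)).trans ?_
    exact (Bimod.lift_unit f.toAlgHom ρ.bimod (Y := σ.bimod.carrier) (Free.map A M f) hmap
      _).trans (Free.map_of f i m)
  refine Deformation.map_rel f ρ.deformation σ.deformation
    (Bimod.equivOfLift f.toAlgHom ρ.bimod σ.bimod (Free.map A M f) hmap
      (fun a z => h a.unop z) H h1 h2) fun z => ?_
  refine (congrArg σ.deformation.proj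
    (Bimod.lift_unit f.toAlgHom ρ.bimod (Y := σ.bimod.carrier) (Free.map A M f) hmap z)).trans ?_
  exact (σ.deformation_proj _).trans ((Free.proj_map f z).trans (ρ.deformation_proj z).symm)

theorem exists_of_map_rel (f : R ⟶ S) {ρ : Act A M R} {σ : Act A M S}
    (h : (Deformation.setoid A M S).r (Deformation.map f ρ.deformation) σ.deformation) :
    ∃ G : Free A M R →+ Free A M S, (∀ s z, G (s • z) = f.toAlgHom s • G z) ∧
      (∀ a z, G (ρ.toLin a z) = σ.toLin a (G z)) ∧
      ∀ z, Free.proj A M S (G z) = Free.proj A M R z := by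
  obtain ⟨g, hg⟩ := h
  let G : Free A M R →+ Free A M S :=
    g.toLin.toLinearMap.toAddMonoidHom.comp (Bimod.unit f.toAlgHom ρ.bimod)
  have hG : ∀ z, G z = g.toLin (Bimod.unit f.toAlgHom ρ.bimod z) := fun z => rfl
  refine ⟨G, fun s z => ?_, fun a z => ?_, fun z => ?_⟩
  · have h1 : Bimod.unit f.toAlgHom ρ.bimod (s • z) =
        f.toAlgHom s • Bimod.unit f.toAlgHom ρ.bimod z := Bimod.unit_smul f.toAlgHom ρ.bimod s z
    rw [hG, hG, h1]
    exact _root_.map_smul g.toLin _ _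
  · have h1 : Bimod.unit f.toAlgHom ρ.bimod (ρ.toLin a z) =
        MulOpposite.op a • Bimod.unit f.toAlgHom ρ.bimod z :=
      Bimod.unit_right f.toAlgHom ρ.bimod (MulOpposite.op a) z
    rw [hG, hG, h1]
    exact g.map_right _ _
  · have h1 := hg (Bimod.unit f.toAlgHom ρ.bimod z)
    exact (σ.deformation_proj _).symm.trans (h1.trans
      ((Deformation.map_proj f ρ.deformation z).trans (ρ.deformation_proj z)))

/-- An isomorphism of left modules with S ⊗ ⨁ M_i need not respect the reductions: it induces some
k^r-linear automorphism ε of ⨁ M_i. Composing with the inverse of S ⊗ ε repairs this, after which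
the right action is transported. -/
theorem exists_rel (X : Deformation A M S) :
    ∃ ρ : Act A M S, (Deformation.setoid A M S).r X ρ.deformation := by
  obtain ⟨e⟩ := X.free
  let T := Bimod.extend S.incl (total k A M)
  have hid : S.aug.comp S.incl = AlgHom.id k (Fin r → k) := AlgHom.ext S.aug_incl
  let red₀ : Bimod.Equiv (Bimod.extend S.aug T) (total k A M) :=
    ((Bimod.extendComp S.incl S.aug (total k A M)).symm.trans
      (Bimod.extendOfEq hid (total k A M))).trans (Bimod.extendId (total k A M))
  have hred_unit : ∀ m : (total k A M).carrier,
      red₀.toLin (Bimod.unit S.aug T (Bimod.unit S.incl (total k A M) m)) = m := by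
    intro m
    change (Bimod.extendId (total k A M)).toLin ((Bimod.extendOfEq hid (total k A M)).toLin
      ((Bimod.extendComp S.incl S.aug (total k A M)).toLin.symm
        (Bimod.unit S.aug T (Bimod.unit S.incl (total k A M) m)))) = m
    rw [← Bimod.extendComp_unit, LinearEquiv.symm_apply_apply, Bimod.extendOfEq_unit,
      Bimod.extendId_unit]
  have hred : ∀ z : Free A M S, red₀.toLin (Bimod.unit S.aug T z) = Free.proj A M S z := by
    refine Bimod.liftSemi_ext S.incl S.aug (total k A M)
      (f := red₀.toLin.toLinearMap.toAddMonoidHom.comp (Bimod.unit S.aug T))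
      (g := Free.proj A M S) (fun s z => ?_) Free.proj_smul
      (fun m => (hred_unit m).trans (Free.proj_unit m).symm)
    change red₀.toLin (Bimod.unit S.aug T (s • z)) = S.aug s • red₀.toLin (Bimod.unit S.aug T z)
    rw [Bimod.unit_smul, _root_.map_smul]
  let ε : (total k A M).carrier ≃ₗ[Fin r → k] (total k A M).carrier :=
    X.red.toLin.symm.trans ((Bimod.extendLin (Y := T) S.aug e).trans red₀.toLin)
  have hε : ∀ x, Free.proj A M S (e x) = ε (X.proj x) := by
    intro x
    have h1 : X.red.toLin.symm (X.proj x) = Bimod.unit S.aug X.bimod x :=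
      X.red.toLin.symm_apply_apply _
    change _ = red₀.toLin (Bimod.extendLin (Y := T) S.aug e (X.red.toLin.symm (X.proj x)))
    rw [h1, Bimod.extendLin_unit]
    exact (hred (e x)).symm
  let E : Free A M S ≃ₗ[S.carrier] Free A M S := Bimod.extendLin S.incl ε
  have hE : ∀ z, Free.proj A M S (E z) = ε (Free.proj A M S z) := by
    refine Bimod.liftSemi_ext S.incl S.aug (total k A M)
      (f := (Free.proj A M S).comp E.toLinearMap.toAddMonoidHom)
      (g := ε.toLinearMap.toAddMonoidHom.comp (Free.proj A M S)) (fun s z => ?_) (fun s z => ?_)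
      (fun m => ?_)
    · exact (congrArg _ (_root_.map_smul E s z)).trans (Free.proj_smul s _)
    · exact (congrArg ε (Free.proj_smul s z)).trans (_root_.map_smul ε _ _)
    · have h1 : E (Free.unit A M S m) = Free.unit A M S (ε m) := Bimod.extendLin_unit S.incl ε m
      exact (congrArg _ h1).trans ((Free.proj_unit _).trans
        (congrArg ε (Free.proj_unit (A := A) (S := S) m).symm))
  let e' : X.bimod.carrier ≃ₗ[S.carrier] Free A M S := e.trans E.symm
  have he' : ∀ x, Free.proj A M S (e' x) = X.proj x := by
    intro x
    apply ε.injective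
    rw [← hE, ← hε]
    exact congrArg _ (E.apply_symm_apply (e x))
  have hsymm : ∀ z, X.proj (e'.symm z) = Free.proj A M S z := fun z => by
    rw [← he', e'.apply_symm_apply]
  have hright : ∀ (a : Aᵐᵒᵖ) (x : X.bimod.carrier), X.proj (a • x) = a • X.proj x := by
    intro a x
    change X.red.toLin (Bimod.unit S.aug X.bimod (a • x)) = _
    rw [Bimod.unit_right, X.red.map_right]
    rfl
  let ρ : Act A M S :=
    { toLin :=
        { toFun := fun a =>
            { toFun := fun z => e' (MulOpposite.op a • e'.symm z)
              map_add' := fun y z => by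
                rw [_root_.map_add, smul_add, _root_.map_add]
              map_smul' := fun s z => by
                rw [_root_.map_smul e'.symm s z, ← smul_comm s, _root_.map_smul e',
                  RingHom.id_apply] }
          map_add' := fun a b => LinearMap.ext fun z => by
            change e' (MulOpposite.op (a + b) • e'.symm z) =
              e' (MulOpposite.op a • e'.symm z) + e' (MulOpposite.op b • e'.symm z)
            rw [MulOpposite.op_add, add_smul, _root_.map_add]
          map_smul' := fun c a => LinearMap.ext fun z => by
            change e' (MulOpposite.op (c • a) • e'.symm z) =
              algebraMap k S.carrier c • e' (MulOpposite.op a • e'.symm z)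
            rw [Algebra.smul_def, MulOpposite.op_mul, mul_smul, ← X.bimod.central,
              ← smul_comm (algebraMap k S.carrier c), _root_.map_smul e'] }
      map_one := LinearMap.ext fun z => by
        change e' (MulOpposite.op 1 • e'.symm z) = z
        rw [MulOpposite.op_one, one_smul, e'.apply_symm_apply]
      map_mul := fun a b => LinearMap.ext fun z => by
        change e' (MulOpposite.op (a * b) • e'.symm z) =
          e' (MulOpposite.op b • e'.symm (e' (MulOpposite.op a • e'.symm z)))
        rw [e'.symm_apply_apply, MulOpposite.op_mul, mul_smul]
      proj := fun a z => by
        change Free.proj A M S (e' (MulOpposite.op a • e'.symm z)) = _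
        rw [he', hright, hsymm]
        rfl }
  refine ⟨ρ, ⟨e', fun a x => ?_⟩, fun x => (ρ.deformation_proj _).trans (he' x)⟩
  change e' (a • x) = e' (MulOpposite.op a.unop • e'.symm (e' x))
  rw [e'.symm_apply_apply, MulOpposite.op_unop]

end Act

end Actions

/-! ### Matrix units and the Hochschild differential on endomorphisms -/

theorem GMMP.sum_pairs_eq {r : ℕ} {n : Fin r → Fin r → ℕ}
    {B : ℕ → ∀ i j : Fin r, Finset (Mono n i j)} {Y : Type*} [AddCommMonoid Y] (N : ℕ)
    (i j : Fin r) (g : ∀ s, Mono n i s → Mono n s j → Y) :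
    ∑ z ∈ pairs B N i j, g z.1.2.2 z.2.1 z.2.2 =
      ∑ s, ∑ z ∈ monos B N i s, ∑ z' ∈ monos B N s j, g s z.2 z'.2 := by
  rw [sum_pairs N i j g]
  have h' : ∀ s (p : Mono n i s), ∑ z' ∈ monos B N s j, g s p z'.2 =
      ∑ b ∈ Finset.Icc 1 N, ∑ q ∈ B b s j, g s p q := fun s p => sum_monos N s j (g s p)
  simp only [h']
  have h : ∀ s, ∑ z ∈ monos B N i s, ∑ b ∈ Finset.Icc 1 N, ∑ q ∈ B b s j, g s z.2 q =
      ∑ a ∈ Finset.Icc 1 N, ∑ p ∈ B a i s, ∑ b ∈ Finset.Icc 1 N, ∑ q ∈ B b s j, g s p q :=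
    fun s => sum_monos N i s fun p => ∑ b ∈ Finset.Icc 1 N, ∑ q ∈ B b s j, g s p q
  simp only [h]
  refine (Finset.sum_congr rfl fun a _ => ?_).trans Finset.sum_comm
  exact Finset.sum_comm.trans (Finset.sum_congr rfl fun s _ => Finset.sum_comm)

section MatrixUnits

variable {k : Type u} [Field k] {A : Type w} [Ring A] [Algebra k A] {r : ℕ}
variable {M : Fin r → Type v} [∀ i, AddCommGroup (M i)] [∀ i, Module k (M i)]
variable [∀ i, Module Aᵐᵒᵖ (M i)] [∀ i, IsScalarTower k Aᵐᵒᵖ (M i)]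

namespace Free

variable {R S : PointedAlg k r}

variable (A M) in
/-- The endomorphism of `S ⊗_{k^r} ⨁ M_i` which sends `m` in `M_i` to `e_i s ⊗ φ m`. -/
def el (S : PointedAlg k r) {i j : Fin r} :
    S.carrier →ₗ[k] (M i →ₗ[k] M j) →ₗ[k] Module.End S.carrier (Free A M S) :=
  LinearMap.mk₂ k
    (fun s φ => desc fun l =>
      { toFun := fun m => s • of A M S j (φ ((Pi.single l m : ∀ l, M l) i))
        map_add' := fun m m' => by rw [Pi.single_add, Pi.add_apply, map_add, map_add, smul_add]
        map_smul' := fun c m => by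
          rw [Pi.single_smul, Pi.smul_apply, map_smul, map_smul, smul_comm, RingHom.id_apply] })
    (fun s s' φ => hom_ext fun l m => by simp [desc_of, add_smul])
    (fun c s φ => hom_ext fun l m => by simp [desc_of, smul_comm (S.e _) c])
    (fun s φ φ' => hom_ext fun l m => by simp [desc_of])
    (fun c s φ => hom_ext fun l m => by simp [desc_of, smul_comm _ c])

theorem el_of {i j : Fin r} (s : S.carrier) (φ : M i →ₗ[k] M j) (m : M i) :
    el A M S s φ (of A M S i m) = (S.e i * s) • of A M S j (φ m) := by
  simp [el, desc_of, mul_smul]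

theorem el_of_ne {i j l : Fin r} (h : l ≠ i) (s : S.carrier) (φ : M i →ₗ[k] M j) (m : M l) :
    el A M S s φ (of A M S l m) = 0 := by
  simp [el, desc_of, Pi.single_eq_of_ne (Ne.symm h)]

/-- Endomorphisms that are linear for the left action multiply their S-coefficients in reverse
order. The order in (φ ∪ ψ)(a, b) = ψ(b) ∘ φ(a) matches this, so that a product pq of monomials
accompanies v_p ∪ v_q. -/
theorem el_mul_el {i j l : Fin r} (s t : S.carrier) (φ : M j →ₗ[k] M l) (ψ : M i →ₗ[k] M j) :
    el A M S s φ * el A M S t ψ = el A M S (t * S.e j * s) (φ ∘ₗ ψ) := by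
  refine hom_ext fun i' m => ?_
  rw [Module.End.mul_apply]
  by_cases h : i' = i
  · subst h
    rw [el_of, el_of, map_smul, el_of, ← mul_smul, mul_assoc, mul_assoc]
    rfl
  · rw [el_of_ne h, el_of_ne h, map_zero]

theorem el_mul_el_of_ne {i j j' l : Fin r} (h : j ≠ j') (s t : S.carrier) (φ : M j' →ₗ[k] M l)
    (ψ : M i →ₗ[k] M j) : el A M S s φ * el A M S t ψ = 0 := by
  refine hom_ext fun i' m => ?_
  rw [Module.End.mul_apply]
  by_cases h' : i' = i
  · subst h'
    rw [el_of, map_smul, el_of_ne h, smul_zero]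
    rfl
  · rw [el_of_ne h', map_zero]
    rfl

theorem el_mul_e {i j : Fin r} (s : S.carrier) (φ : M i →ₗ[k] M j) :
    el A M S (s * S.e j) φ = el A M S s φ := by
  refine hom_ext fun i' m => ?_
  by_cases h : i' = i
  · subst h
    rw [el_of, el_of, ← mul_assoc, mul_smul, e_smul_of]
  · rw [el_of_ne h, el_of_ne h]

theorem el_e_mul {i j : Fin r} (s : S.carrier) (φ : M i →ₗ[k] M j) :
    el A M S (S.e i * s) φ = el A M S s φ := by
  refine hom_ext fun i' m => ?_
  by_cases h : i' = i
  · subst h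
    rw [el_of, el_of, ← mul_assoc, S.e_mul_self]
  · rw [el_of_ne h, el_of_ne h]

theorem proj_el {i j : Fin r} {s : S.carrier} (hs : s ∈ S.augIdeal) (φ : M i →ₗ[k] M j)
    (z : Free A M S) : proj A M S (el A M S s φ z) = 0 := by
  induction z using induction with
  | zero => simp
  | add y z hy hz => rw [map_add, map_add, hy, hz, add_zero]
  | of t l m =>
    rw [map_smul, proj_smul]
    by_cases h : l = i
    · subst h
      rw [el_of, proj_smul, map_mul, PointedAlg.mem_augIdeal.1 hs, mul_zero, zero_smul, smul_zero]
    · rw [el_of_ne h, map_zero, smul_zero]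

theorem map_el (f : R ⟶ S) {i j : Fin r} (s : R.carrier) (φ : M i →ₗ[k] M j) (z : Free A M R) :
    map A M f (el A M R s φ z) = el A M S (f.toAlgHom s) φ (map A M f z) := by
  induction z using induction with
  | zero => simp
  | add y z hy hz => rw [map_add, map_add, map_add, map_add, hy, hz]
  | of t l m =>
    rw [map_smul, map_smul', map_smul', map_of, map_smul]
    by_cases h : l = i
    · subst h
      rw [el_of, el_of, map_smul', map_of, map_mul, f.map_e]
    · rw [el_of_ne h, el_of_ne h, map_zero]

variable (A M) in
/-- The matrix entries of an endomorphism of `S ⊗_{k^r} ⨁ M_i`. -/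
def entry (ℓ : S.carrier →ₗ[k] k) (i j : Fin r) :
    Module.End S.carrier (Free A M S) →ₗ[k] (M i →ₗ[k] M j) where
  toFun D := coord A M ℓ j ∘ₗ D.restrictScalars k ∘ₗ of A M S i
  map_add' D D' := by ext m; simp
  map_smul' c D := by ext m; simp

theorem entry_apply (ℓ : S.carrier →ₗ[k] k) (i j : Fin r)
    (D : Module.End S.carrier (Free A M S)) (m : M i) :
    entry A M ℓ i j D m = coord A M ℓ j (D (of A M S i m)) := rfl

theorem entry_el (ℓ : S.carrier →ₗ[k] k) {i j : Fin r} (s : S.carrier) (φ : M i →ₗ[k] M j) :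
    entry A M ℓ i j (el A M S s φ) = ℓ (S.e i * s * S.e j) • φ := by
  ext m
  rw [entry_apply, el_of, coord_smul_of, LinearMap.smul_apply]

theorem entry_el_of_ne (ℓ : S.carrier →ₗ[k] k) {i j i' j' : Fin r} (h : ¬(i = i' ∧ j = j'))
    (s : S.carrier) (φ : M i →ₗ[k] M j) : entry A M ℓ i' j' (el A M S s φ) = 0 := by
  ext m
  rw [entry_apply, LinearMap.zero_apply]
  by_cases hi : i' = i
  · subst hi
    rw [el_of, coord_smul_of_ne _ fun hj => h ⟨rfl, hj⟩]
  · rw [el_of_ne hi, map_zero]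

theorem eq_of_entry [Module.Finite k S.carrier] {D D' : Module.End S.carrier (Free A M S)}
    (h : ∀ ℓ i j, entry A M ℓ i j D = entry A M ℓ i j D') : D = D' :=
  hom_ext fun i m => eq_of_coord fun ℓ j => LinearMap.congr_fun (h ℓ i j) m

/-- Expansion of the endomorphisms with values in the kernel of
`R ⊗_{k^r} ⨁ M_i → S ⊗_{k^r} ⨁ M_i`. -/
theorem exists_eq_sum_el [Module.Finite k R.carrier] [Module.Finite k S.carrier]
    (f : R ⟶ S) (hf : Function.Surjective f.toAlgHom) :
    ∃ (d : ℕ) (ρ : Fin d → R.carrier) (ℓ : Fin d → R.carrier →ₗ[k] k),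
      (∀ t, f.toAlgHom (ρ t) = 0) ∧ ∀ D : Module.End R.carrier (Free A M R),
        (∀ z, map A M f (D z) = 0) →
        D = ∑ i, ∑ j, ∑ t, el A M R (ρ t) (entry A M (ℓ t) i j D) := by
  obtain ⟨d, ρ, ℓ, hρ, h⟩ := exists_eq_sum_of_map_eq_zero (A := A) (M := M) f hf
  refine ⟨d, ρ, ℓ, hρ, fun D hD => hom_ext fun i m => ?_⟩
  have h1 : D (of A M R i m) = R.e i • D (of A M R i m) := by rw [← map_smul, e_smul_of]
  simp only [LinearMap.sum_apply]
  rw [Finset.sum_eq_single_of_mem i (Finset.mem_univ i)]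
  · simp only [el_of, mul_smul, entry_apply]
    conv_lhs => rw [h1, h _ (hD _)]
    simp only [Finset.smul_sum]
  · intro i' _ hi'
    exact Finset.sum_eq_zero fun j _ => Finset.sum_eq_zero fun t _ => el_of_ne (Ne.symm hi') _ _ _

variable (A M S) in
/-- The action of `A` on `S ⊗_{k^r} ⨁ M_i` induced by the action on `⨁ M_i`. -/
def act₀ : A →ₗ[k] Module.End S.carrier (Free A M S) :=
  ∑ i, el A M S (1 : S.carrier) ∘ₗ rightMul k A M i

theorem act₀_of (a : A) (i : Fin r) (m : M i) :
    act₀ A M S a (of A M S i m) = of A M S i (rightMul k A M i a m) := by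
  simp only [act₀, LinearMap.sum_apply, LinearMap.comp_apply]
  rw [Finset.sum_eq_single_of_mem i (Finset.mem_univ i)]
  · rw [el_of, mul_one, e_smul_of]
  · intro i' _ hi'
    rw [el_of_ne (Ne.symm hi')]

theorem act₀_mul (a b : A) : act₀ A M S (a * b) = act₀ A M S b * act₀ A M S a :=
  hom_ext fun i m => by
    rw [Module.End.mul_apply, act₀_of, act₀_of, act₀_of, rightMul_mul]
    rfl

theorem proj_act₀ (a : A) (z : Free A M S) :
    proj A M S (act₀ A M S a z) = MulOpposite.op a • proj A M S z := by
  induction z using induction with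
  | zero => simp
  | add y z hy hz => rw [map_add, map_add, map_add, smul_add, hy, hz]
  | of s i m =>
    rw [map_smul, proj_smul, proj_smul, act₀_of, proj_of, proj_of]
    ext l
    by_cases h : l = i
    · subst h
      simp [rightMul]
      rw [← smul_comm]
    · simp [h]

theorem map_act₀ (f : R ⟶ S) (a : A) (z : Free A M R) :
    map A M f (act₀ A M R a z) = act₀ A M S a (map A M f z) := by
  simp only [act₀, LinearMap.sum_apply, LinearMap.comp_apply, map_sum, map_el, map_one]

theorem el_mul_act₀ {i j : Fin r} (s : S.carrier) (φ : M i →ₗ[k] M j) (a : A) :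
    el A M S s φ * act₀ A M S a = el A M S s (φ ∘ₗ rightMul k A M i a) := by
  refine hom_ext fun i' m => ?_
  rw [Module.End.mul_apply, act₀_of]
  by_cases h : i' = i
  · subst h
    rw [el_of, el_of]
    rfl
  · rw [el_of_ne h, el_of_ne h]

theorem act₀_mul_el {i j : Fin r} (s : S.carrier) (φ : M i →ₗ[k] M j) (a : A) :
    act₀ A M S a * el A M S s φ = el A M S s (rightMul k A M j a ∘ₗ φ) := by
  refine hom_ext fun i' m => ?_
  rw [Module.End.mul_apply]
  by_cases h : i' = i
  · subst h
    rw [el_of, el_of, map_smul, act₀_of]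
    rfl
  · rw [el_of_ne h, el_of_ne h, map_zero]

/-- The differential of a cochain with values in the endomorphisms of `S ⊗_{k^r} ⨁ M_i`. -/
def diff (a b : A) : (A →ₗ[k] Module.End S.carrier (Free A M S)) →ₗ[k]
    Module.End S.carrier (Free A M S) where
  toFun δ := δ b * act₀ A M S a - δ (a * b) + act₀ A M S b * δ a
  map_add' δ δ' := by simp only [LinearMap.add_apply, add_mul, mul_add]; abel
  map_smul' c δ := by simp [smul_sub]

theorem diff_apply (a b : A) (δ : A →ₗ[k] Module.End S.carrier (Free A M S)) :
    diff a b δ = δ b * act₀ A M S a - δ (a * b) + act₀ A M S b * δ a := rfl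

theorem diff_el {i j : Fin r} (a b : A) (s : S.carrier) (φ : C1 k A M i j) :
    diff a b (el A M S s ∘ₗ φ) = el A M S s (d1 φ a b) := by
  rw [diff_apply]
  simp only [LinearMap.comp_apply]
  rw [el_mul_act₀, act₀_mul_el, ← map_sub, ← map_add]
  rfl

/-- As act₀ is itself multiplicative, the defect of act₀ + δ is its curvature: multiplicativity of a
perturbed action is the Maurer–Cartan equation. -/
theorem act₀_add_mul_iff (δ : A →ₗ[k] Module.End S.carrier (Free A M S)) (a b : A) :
    (act₀ A M S + δ) (a * b) = (act₀ A M S + δ) b * (act₀ A M S + δ) a ↔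
      diff a b δ + δ b * δ a = 0 := by
  rw [diff_apply]
  simp only [LinearMap.add_apply, add_mul, mul_add, act₀_mul]
  rw [← sub_eq_zero, ← neg_eq_zero]
  constructor <;> intro h <;> rw [← h] <;> abel

end Free

end MatrixUnits

/-! ### Actions defined by morphisms from k⟨N⟩ and from Â -/

/-- The free matrix polynomial algebra as a pointed algebra. -/
def freePt (k : Type u) [Field k] {r : ℕ} (n : Fin r → Fin r → ℕ) : PointedAlg k r where
  carrier := FreeMat k n
  incl := FreeMat.incl k n
  aug := FreeMat.aug k n
  aug_incl := FreeMat.aug_incl k n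

theorem freePt_e {k : Type u} [Field k] {r : ℕ} (n : Fin r → Fin r → ℕ) (i : Fin r) :
    (freePt k n).e i = FreeMat.e k n i := FreeMat.incl_single i

/-- The canonical morphism `k⟨N⟩ ⟶ Â(L)`. -/
def GMMP.Run.ofFreeHom {k : Type u} [Field k] {r : ℕ} {L : GMMP.{u, x} k r}
    {n : Fin r → Fin r → ℕ} {X : ∀ i j : Fin r, Fin (n i j) → L.V i j} (R : L.Run X) :
    freePt k n ⟶ R.hull where
  toAlgHom := R.ofFree
  comp_incl := rfl
  aug_comp := rfl

/-- The image of a polynomial under a morphism of pointed algebras. -/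
def ev {k : Type u} [Field k] {r : ℕ} {n : Fin r → Fin r → ℕ} {S : PointedAlg k r}
    (ψ : freePt k n ⟶ S) : FreeMat k n →ₐ[k] S.carrier := ψ.toAlgHom

section Eval

variable {k : Type u} [Field k] {r : ℕ} {n : Fin r → Fin r → ℕ} {S T : PointedAlg k r}

theorem ev_comp (ψ : freePt k n ⟶ S) (f : S ⟶ T) (t : FreeMat k n) :
    ev (CategoryTheory.CategoryStruct.comp ψ f) t = f.toAlgHom (ev ψ t) := rfl

theorem ev_e (ψ : freePt k n ⟶ S) (i : Fin r) : ev ψ (FreeMat.e k n i) = S.e i := by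
  rw [← freePt_e]
  exact ψ.map_e i

theorem aug_ev (ψ : freePt k n ⟶ S) (t : FreeMat k n) : S.aug (ev ψ t) = FreeMat.aug k n t :=
  ψ.aug_apply t

theorem ev_mem_augIdeal (ψ : freePt k n ⟶ S) {t : FreeMat k n} (ht : t ∈ FreeMat.maxIdeal k n) :
    ev ψ t ∈ S.augIdeal := by
  rw [PointedAlg.mem_augIdeal, aug_ev, FreeMat.mem_maxIdeal.1 ht]

theorem e_mul_ev (ψ : freePt k n ⟶ S) {i j : Fin r} (p : Mono n i j) :
    S.e i * ev ψ (p.val k) = ev ψ (p.val k) := by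
  rw [← ev_e ψ, ← map_mul, p.e_mul_val]

theorem ev_mul_e (ψ : freePt k n ⟶ S) {i j : Fin r} (p : Mono n i j) :
    ev ψ (p.val k) * S.e j = ev ψ (p.val k) := by
  rw [← ev_e ψ, ← map_mul, p.val_mul_e]

end Eval

namespace GMMP.Run

variable {k : Type u} [Field k] {A : Type w} [Ring A] [Algebra k A] {r : ℕ}
variable {M : Fin r → Type v} [∀ i, AddCommGroup (M i)] [∀ i, Module k (M i)]
variable [∀ i, Module Aᵐᵒᵖ (M i)] [∀ i, IsScalarTower k Aᵐᵒᵖ (M i)]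
variable {n : Fin r → Fin r → ℕ} {X : ∀ i j : Fin r, Fin (n i j) → C1 k A M i j}
variable (R : (hochschildGMMP k A M).Run X) {S T : PointedAlg k r}

/-- The cochain of a monomial. -/
def cochain {i j : Fin r} (p : Mono n i j) : C1 k A M i j := R.v p

theorem hochschild_maurerCartan (hX : ∀ i j l, d1 (X i j l) = 0) (N : ℕ) (i j : Fin r)
    (f : FreeMat k n →ₗ[k] k)
    (hf : ∀ t ∈ (hochschildGMMP k A M).relIdeal R.B R.v (N + 2), f t = 0) :
    ∑ z ∈ monos R.B (N + 2) i j, f (z.2.val k) • d1 (R.cochain z.2) +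
      ∑ z ∈ pairs R.B (N + 2) i j, f (z.2.1.val k * z.2.2.val k) •
        NCDef.cup (R.cochain z.2.1) (R.cochain z.2.2) = 0 :=
  R.maurerCartan hX N i j f hf

/-- The part of `pert` in position `(i, j)`. -/
def block (N : ℕ) (ψ : freePt k n ⟶ S) (i j : Fin r) :
    A →ₗ[k] Module.End S.carrier (Free A M S) :=
  ∑ z ∈ monos R.B N i j, Free.el A M S (ev ψ (z.2.val k)) ∘ₗ R.cochain z.2

/-- The perturbation `∑ ψ(u) v_u` of the action of `A` on `S ⊗_{k^r} ⨁ M_i`. -/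
def pert (N : ℕ) (ψ : freePt k n ⟶ S) : A →ₗ[k] Module.End S.carrier (Free A M S) :=
  ∑ i, ∑ j, R.block N ψ i j

theorem block_apply (N : ℕ) (ψ : freePt k n ⟶ S) (i j : Fin r) (a : A) :
    R.block N ψ i j a =
      ∑ z ∈ monos R.B N i j, Free.el A M S (ev ψ (z.2.val k)) (R.cochain z.2 a) := by
  simp [block]

theorem pert_apply (N : ℕ) (ψ : freePt k n ⟶ S) (a : A) :
    R.pert N ψ a = ∑ i, ∑ j, ∑ z ∈ monos R.B N i j,
      Free.el A M S (ev ψ (z.2.val k)) (R.cochain z.2 a) := by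
  simp only [pert, LinearMap.sum_apply, block_apply]

theorem ev_val_mem (ψ : freePt k n ⟶ S) {N : ℕ} {i j : Fin r} {z : Σ _ : ℕ, Mono n i j}
    (hz : z ∈ monos R.B N i j) : ev ψ (z.2.val k) ∈ S.augIdeal :=
  ev_mem_augIdeal ψ (R.val_mem_maxIdeal (mem_monos.1 hz).1.1 (mem_monos.1 hz).2)

theorem proj_pert (N : ℕ) (ψ : freePt k n ⟶ S) (a : A) (z : Free A M S) :
    Free.proj A M S (R.pert N ψ a z) = 0 := by
  rw [pert_apply]
  simp only [LinearMap.sum_apply, map_sum]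
  exact Finset.sum_eq_zero fun i _ => Finset.sum_eq_zero fun j _ => Finset.sum_eq_zero fun u hu =>
    Free.proj_el (R.ev_val_mem ψ hu) _ _

theorem map_pert (N : ℕ) (ψ : freePt k n ⟶ S) (f : S ⟶ T) (a : A) (z : Free A M S) :
    Free.map A M f (R.pert N ψ a z) =
      R.pert N (CategoryTheory.CategoryStruct.comp ψ f) a (Free.map A M f z) := by
  simp only [pert_apply, LinearMap.sum_apply, map_sum, Free.map_el, ev_comp]

theorem block_mul_block (N : ℕ) (ψ : freePt k n ⟶ S) (i s j : Fin r) (a b : A) :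
    R.block N ψ s j b * R.block N ψ i s a = ∑ z ∈ monos R.B N i s, ∑ z' ∈ monos R.B N s j,
      Free.el A M S (ev ψ (z.2.val k * z'.2.val k)) (NCDef.cup (R.cochain z.2) (R.cochain z'.2) a b) := by
  rw [block_apply, block_apply, Finset.sum_mul_sum, Finset.sum_comm]
  refine Finset.sum_congr rfl fun z _ => Finset.sum_congr rfl fun z' _ => ?_
  rw [Free.el_mul_el, ev_mul_e, map_mul (ev ψ)]
  rfl

theorem block_mul_block_of_ne (N : ℕ) (ψ : freePt k n ⟶ S) {i s s' j : Fin r} (h : s ≠ s')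
    (a b : A) : R.block N ψ s' j b * R.block N ψ i s a = 0 := by
  rw [block_apply, block_apply, Finset.sum_mul_sum]
  exact Finset.sum_eq_zero fun z _ => Finset.sum_eq_zero fun z' _ => Free.el_mul_el_of_ne h _ _ _ _

theorem pert_mul_pert (N : ℕ) (ψ : freePt k n ⟶ S) (a b : A) :
    R.pert N ψ b * R.pert N ψ a = ∑ i, ∑ j, ∑ z ∈ pairs R.B N i j,
      Free.el A M S (ev ψ (z.2.1.val k * z.2.2.val k))
        (NCDef.cup (R.cochain z.2.1) (R.cochain z.2.2) a b) := by
  have h1 : ∀ i j, ∑ z ∈ pairs R.B N i j, Free.el A M S (ev ψ (z.2.1.val k * z.2.2.val k))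
      (NCDef.cup (R.cochain z.2.1) (R.cochain z.2.2) a b) =
        ∑ s, R.block N ψ s j b * R.block N ψ i s a := by
    intro i j
    simp only [block_mul_block]
    exact sum_pairs_eq N i j fun s p q => Free.el A M S (ev ψ (p.val k * q.val k))
      (NCDef.cup (R.cochain p) (R.cochain q) a b)
  simp only [h1, pert, LinearMap.sum_apply]
  rw [Finset.sum_mul_sum, Finset.sum_comm]
  refine Finset.sum_congr rfl fun i _ => ?_
  simp only [Finset.sum_mul_sum]
  have h2 : ∀ s', ∑ j, ∑ s, R.block N ψ s' j b * R.block N ψ i s a =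
      ∑ j, R.block N ψ s' j b * R.block N ψ i s' a := fun s' => Finset.sum_congr rfl fun j _ =>
    Finset.sum_eq_single_of_mem s' (Finset.mem_univ s') fun s _ hs =>
      R.block_mul_block_of_ne N ψ hs a b
  simp only [h2]
  exact Finset.sum_comm

theorem entry_sum_el (ℓ : S.carrier →ₗ[k] k) (i j : Fin r) {ι : Fin r → Fin r → Type*}
    (s : ∀ i j, Finset (ι i j)) (c : ∀ i j, ι i j → S.carrier)
    (φ : ∀ i j, ι i j → M i →ₗ[k] M j) :
    Free.entry A M ℓ i j (∑ i', ∑ j', ∑ z ∈ s i' j', Free.el A M S (c i' j' z) (φ i' j' z)) =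
      ∑ z ∈ s i j, ℓ (S.e i * c i j z * S.e j) • φ i j z := by
  rw [map_sum, Finset.sum_eq_single_of_mem i (Finset.mem_univ i), map_sum,
    Finset.sum_eq_single_of_mem j (Finset.mem_univ j), map_sum]
  · simp only [Free.entry_el]
  · intro j' _ hj
    rw [map_sum]
    exact Finset.sum_eq_zero fun z _ => Free.entry_el_of_ne ℓ (fun h => hj h.2) _ _
  · intro i' _ hi
    rw [map_sum]
    refine Finset.sum_eq_zero fun j' _ => ?_
    rw [map_sum]
    exact Finset.sum_eq_zero fun z _ => Free.entry_el_of_ne ℓ (fun h => hi h.1) _ _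

theorem entry_diff_pert (N : ℕ) (ψ : freePt k n ⟶ S) (ℓ : S.carrier →ₗ[k] k) (i j : Fin r)
    (a b : A) : Free.entry A M ℓ i j (Free.diff a b (R.pert N ψ)) =
      ∑ z ∈ monos R.B N i j, ℓ (ev ψ (z.2.val k)) • d1 (R.cochain z.2) a b := by
  simp only [pert, block, map_sum (Free.diff a b), Free.diff_el]
  rw [entry_sum_el]
  simp only [e_mul_ev, ev_mul_e]

theorem entry_pert_mul_pert (N : ℕ) (ψ : freePt k n ⟶ S) (ℓ : S.carrier →ₗ[k] k) (i j : Fin r)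
    (a b : A) : Free.entry A M ℓ i j (R.pert N ψ b * R.pert N ψ a) =
      ∑ z ∈ pairs R.B N i j, ℓ (ev ψ (z.2.1.val k * z.2.2.val k)) •
        NCDef.cup (R.cochain z.2.1) (R.cochain z.2.2) a b := by
  rw [pert_mul_pert, entry_sum_el]
  simp only [← Mono.val_mul, e_mul_ev, ev_mul_e]

/-- The morphism `ψ` factors through `H̄_N`. -/
def Kills (N : ℕ) (ψ : freePt k n ⟶ S) : Prop :=
  ∀ t ∈ (hochschildGMMP k A M).relIdeal R.B R.v N, ev ψ t = 0

variable {R}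

theorem Kills.mono {N N' : ℕ} (h : N ≤ N') {ψ : freePt k n ⟶ S} (hψ : R.Kills N ψ) :
    R.Kills N' ψ := fun t ht => hψ t (R.relIdeal_le h ht)

theorem Kills.comp {N : ℕ} {ψ : freePt k n ⟶ S} (hψ : R.Kills N ψ) (f : S ⟶ T) :
    R.Kills N (CategoryTheory.CategoryStruct.comp ψ f) := fun t ht => by
  rw [ev_comp, hψ t ht, map_zero]

/-- The monomials of the stages beyond N lie in J_N and evaluate to 0. The truncation level is
therefore immaterial, which makes the resulting action well defined and natural. -/
theorem Kills.pert_eq {N N' : ℕ} (h : N ≤ N') {ψ : freePt k n ⟶ S} (hψ : R.Kills N ψ) :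
    R.pert N' ψ = R.pert N ψ := by
  refine LinearMap.ext fun a => ?_
  rw [pert_apply, pert_apply]
  refine Finset.sum_congr rfl fun i _ => Finset.sum_congr rfl fun j _ => ?_
  refine (Finset.sum_subset (monos_mono h i j) fun z hz hz' => ?_).symm
  have h1 := mem_monos.1 hz
  have h2 : N + 1 ≤ z.1 := by
    by_contra h3
    exact hz' (mem_monos.2 ⟨⟨h1.1.1, by omega⟩, h1.2⟩)
  obtain ⟨c, hc⟩ : ∃ c, z.1 = c + 1 := ⟨z.1 - 1, by omega⟩
  have h3 : z.2.val k ∈ (hochschildGMMP k A M).relIdeal R.B R.v N :=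
    R.relIdeal_le (by omega) (R.val_mem (hc ▸ h1.2))
  rw [hψ _ h3, map_zero, LinearMap.zero_apply]

/-- Each matrix entry is the universal Maurer–Cartan equation tested on the linear form ℓ ∘ ψ, which
vanishes on J_{N+2}. Finite dimension of S ensures that the entries detect an endomorphism. -/
theorem Kills.diff_add [Module.Finite k S.carrier] (hX : ∀ i j l, d1 (X i j l) = 0) {N : ℕ}
    {ψ : freePt k n ⟶ S} (hψ : R.Kills (N + 2) ψ) (a b : A) :
    Free.diff a b (R.pert (N + 2) ψ) + R.pert (N + 2) ψ b * R.pert (N + 2) ψ a = 0 := by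
  refine Free.eq_of_entry fun ℓ i j => ?_
  rw [map_add, entry_diff_pert, entry_pert_mul_pert, map_zero]
  have h := R.hochschild_maurerCartan hX N i j (ℓ ∘ₗ (ev ψ).toLinearMap) fun t ht => by
    rw [LinearMap.comp_apply, AlgHom.toLinearMap_apply, hψ t ht, map_zero]
  have h' := LinearMap.congr_fun (LinearMap.congr_fun h a) b
  simpa using h'

/-- The action of `A` on `S ⊗_{k^r} ⨁ M_i` defined by a morphism `H̄_N ⟶ S`. -/
def Kills.act (hX : ∀ i j l, d1 (X i j l) = 0) (hS : S.IsArt) {N : ℕ}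
    {ψ : freePt k n ⟶ S} (hψ : R.Kills N ψ) : Act A M S :=
  have hmul : ∀ a b : A, (Free.act₀ A M S + R.pert (N + 2) ψ) (a * b) =
      (Free.act₀ A M S + R.pert (N + 2) ψ) b * (Free.act₀ A M S + R.pert (N + 2) ψ) a :=
    haveI := hS.1
    fun a b => (Free.act₀_add_mul_iff _ a b).2 ((hψ.mono (Nat.le_add_right N 2)).diff_add hX a b)
  have hproj : ∀ (a : A) z, Free.proj A M S ((Free.act₀ A M S + R.pert (N + 2) ψ) a z) =
      MulOpposite.op a • Free.proj A M S z := fun a z => by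
    rw [LinearMap.add_apply, LinearMap.add_apply, map_add, proj_pert, add_zero, Free.proj_act₀]
  { toLin := Free.act₀ A M S + R.pert (N + 2) ψ
    map_one := by
      -- The cochains v_u need not vanish at 1. But the endomorphism attached to 1 is idempotent by
      -- multiplicativity and reduces to the identity, so it is bijective, and a bijective
      -- idempotent is the identity.
      have hb := Free.bijective_of_proj hS ((Free.act₀ A M S + R.pert (N + 2) ψ) 1) fun z => by
        rw [hproj, MulOpposite.op_one, one_smul]
      refine LinearMap.ext fun z => hb.1 ?_
      have h := hmul 1 1
      rw [mul_one] at h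
      exact (LinearMap.congr_fun h z).symm
    map_mul := hmul
    proj := hproj }

theorem Kills.act_toLin (hX : ∀ i j l, d1 (X i j l) = 0) (hS : S.IsArt) {N N' : ℕ} (h : N ≤ N')
    {ψ : freePt k n ⟶ S} (hψ : R.Kills N ψ) :
    (hψ.act hX hS).toLin = Free.act₀ A M S + R.pert N' ψ := by
  rw [hψ.pert_eq h, ← hψ.pert_eq (Nat.le_add_right N 2)]
  rfl

theorem Kills.act_eq (hX : ∀ i j l, d1 (X i j l) = 0) (hS : S.IsArt) {N N' : ℕ}
    {ψ : freePt k n ⟶ S} (hψ : R.Kills N ψ) (hψ' : R.Kills N' ψ) :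
    hψ.act hX hS = hψ'.act hX hS := by
  have h : (hψ.act hX hS).toLin = (hψ'.act hX hS).toLin := by
    rw [hψ.act_toLin hX hS (le_max_left N N'), hψ'.act_toLin hX hS (le_max_right N N')]
  revert h
  generalize hψ.act hX hS = ρ
  generalize hψ'.act hX hS = ρ'
  intro h
  cases ρ
  cases ρ'
  cases h
  rfl

theorem Kills.map_act (hX : ∀ i j l, d1 (X i j l) = 0) (hS : S.IsArt) (hT : T.IsArt) {N : ℕ}
    {ψ : freePt k n ⟶ S} (hψ : R.Kills N ψ) (f : S ⟶ T) (a : A) (z : Free A M S) :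
    Free.map A M f ((hψ.act hX hS).toLin a z) =
      ((hψ.comp f).act hX hT).toLin a (Free.map A M f z) := by
  rw [Kills.act_toLin hX hS le_rfl, Kills.act_toLin hX hT le_rfl, LinearMap.add_apply,
    LinearMap.add_apply, LinearMap.add_apply, LinearMap.add_apply, map_add, Free.map_act₀, map_pert]

variable (R)

theorem exists_kills (hS : S.IsArt) (b : R.hull ⟶ S) :
    ∃ N, R.Kills N (CategoryTheory.CategoryStruct.comp R.ofFreeHom b) := by
  obtain ⟨-, m, hm⟩ := hS
  exact ⟨m, fun t ht => R.hom_ofFree_eq_zero hm b (Nat.le_succ m) ht⟩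

/-- The action of `A` on `S ⊗_{k^r} ⨁ M_i` defined by a morphism `Â_M ⟶ S`. -/
def homAct (hX : ∀ i j l, d1 (X i j l) = 0) (hS : S.IsArt) (b : R.hull ⟶ S) : Act A M S :=
  (R.exists_kills hS b).choose_spec.act hX hS

theorem homAct_eq (hX : ∀ i j l, d1 (X i j l) = 0) (hS : S.IsArt) (b : R.hull ⟶ S) {N : ℕ}
    (h : R.Kills N (CategoryTheory.CategoryStruct.comp R.ofFreeHom b)) :
    R.homAct hX hS b = h.act hX hS := Kills.act_eq hX hS _ h

theorem map_homAct (hX : ∀ i j l, d1 (X i j l) = 0) (hS : S.IsArt) (hT : T.IsArt)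
    (b : R.hull ⟶ S) (f : S ⟶ T) (a : A) (z : Free A M S) :
    Free.map A M f ((R.homAct hX hS b).toLin a z) =
      (R.homAct hX hT (CategoryTheory.CategoryStruct.comp b f)).toLin a (Free.map A M f z) := by
  obtain ⟨N, hN⟩ := R.exists_kills hS b
  have hN' : R.Kills N (CategoryTheory.CategoryStruct.comp R.ofFreeHom
    (CategoryTheory.CategoryStruct.comp b f)) := hN.comp f
  rw [R.homAct_eq hX hS b hN, R.homAct_eq hX hT _ hN']
  exact hN.map_act hX hS hT f a z

end GMMP.Run

/-! ### Lifting morphisms along small extensions -/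

section Lifting

variable {k : Type u} [Field k] {r : ℕ} {n : Fin r → Fin r → ℕ} {S T : PointedAlg k r}

theorem ev_ext {ψ ψ' : freePt k n ⟶ S}
    (h : ∀ (i j : Fin r) (l : Fin (n i j)), ev ψ (FreeMat.x k n l) = ev ψ' (FreeMat.x k n l)) :
    ψ = ψ' :=
  PointedAlg.Hom.ext (FreeMat.hom_ext (fun i => (ev_e ψ i).trans (ev_e ψ' i).symm) h)

/-- Morphisms `k⟨N⟩ ⟶ S` can be prescribed on the variables. -/
theorem exists_ev_x (ξ : ∀ i j : Fin r, Fin (n i j) → S.carrier) :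
    (∀ i j l, S.e i * ξ i j l = ξ i j l) → (∀ i j l, ξ i j l * S.e j = ξ i j l) →
    (∀ i j l, ξ i j l ∈ S.augIdeal) →
    ∃ ψ : freePt k n ⟶ S, ∀ (i j : Fin r) (l : Fin (n i j)), ev ψ (FreeMat.x k n l) = ξ i j l := by
  intro hl hr hI
  let F : FreeMat k n →ₐ[k] S.carrier := FreeMat.lift S.e S.e_mul_e S.sum_e ξ hl hr
  have he : ∀ i, F (FreeMat.e k n i) = S.e i := FreeMat.lift_e _ _ _ _ _ _
  have hx : ∀ (i j : Fin r) (l : Fin (n i j)), F (FreeMat.x k n l) = ξ i j l :=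
    fun i j l => FreeMat.lift_x _ _ _ _ _ _ l
  refine ⟨⟨F, AlgHom.ext fun c => ?_, FreeMat.hom_ext (fun i => ?_) fun i j l => ?_⟩, hx⟩
  · change F (FreeMat.incl k n c) = S.incl c
    rw [FreeMat.incl_apply, map_sum]
    simp only [map_smul, he, ← S.incl_mul_e]
    rw [← Finset.mul_sum, S.sum_e, mul_one]
  · change S.aug (F (FreeMat.e k n i)) = FreeMat.aug k n (FreeMat.e k n i)
    rw [he, S.aug_e, FreeMat.aug_e]
  · change S.aug (F (FreeMat.x k n l)) = FreeMat.aug k n (FreeMat.x k n l)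
    rw [hx, FreeMat.aug_x, PointedAlg.mem_augIdeal.1 (hI i j l)]

/-- Freeness of k⟨N⟩: arbitrary preimages of the images of the variables are cut down by the
idempotents to the correct position, and they lie in I(T) because f respects the augmentations. -/
theorem exists_ev_lift (f : T ⟶ S) (hf : Function.Surjective f.toAlgHom) (ψ : freePt k n ⟶ S) :
    ∃ ψ' : freePt k n ⟶ T, CategoryTheory.CategoryStruct.comp ψ' f = ψ := by
  choose c hc using fun (i j : Fin r) (l : Fin (n i j)) => hf (ev ψ (FreeMat.x k n l))
  have hS : ∀ (i j : Fin r) (l : Fin (n i j)),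
      S.e i * ev ψ (FreeMat.x k n l) * S.e j = ev ψ (FreeMat.x k n l) := fun i j l => by
    rw [← ev_e ψ, ← ev_e ψ, ← map_mul, ← map_mul, FreeMat.e_mul_x, FreeMat.x_mul_e]
  obtain ⟨ψ', hψ'⟩ := exists_ev_x (S := T) (n := n) (fun i j l => T.e i * c i j l * T.e j)
    (fun i j l => by rw [← mul_assoc, ← mul_assoc, T.e_mul_self])
    (fun i j l => by rw [mul_assoc, T.e_mul_self])
    (fun i j l => by
      rw [PointedAlg.mem_augIdeal, ← f.aug_apply, map_mul f.toAlgHom, map_mul f.toAlgHom, f.map_e,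
        f.map_e, hc, hS, aug_ev, FreeMat.aug_x])
  refine ⟨ψ', ev_ext fun i j l => ?_⟩
  rw [ev_comp, hψ', map_mul, map_mul, f.map_e, f.map_e, hc, hS]

/-- The kernel of `f` is annihilated by the augmentation ideal. -/
def IsSmall (f : T ⟶ S) : Prop :=
  ∀ c, f.toAlgHom c = 0 → ∀ s ∈ T.augIdeal, c * s = 0 ∧ s * c = 0

theorem mem_augIdeal_of_map_eq_zero (f : T ⟶ S) {c : T.carrier} (hc : f.toAlgHom c = 0) :
    c ∈ T.augIdeal := by
  rw [PointedAlg.mem_augIdeal, ← f.aug_apply, hc, map_zero]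

theorem IsSmall.mul_eq_zero {f : T ⟶ S} (hf : IsSmall f) {s c : T.carrier} (hs : s ∈ T.augIdeal)
    (hc : f.toAlgHom c = 0) (i : Fin r) : s * T.e i * c = 0 :=
  (hf c hc _ (Ideal.mul_mem_right _ _ hs)).2

theorem IsSmall.mul_eq_zero' {f : T ⟶ S} (hf : IsSmall f) {s c : T.carrier} (hs : s ∈ T.augIdeal)
    (hc : f.toAlgHom c = 0) (i : Fin r) : c * T.e i * s = 0 := by
  rw [mul_assoc]
  exact (hf c hc _ (Ideal.mul_mem_left _ _ hs)).1

end Lifting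

/-! ### Matrix entries as Hochschild cochains and transport of actions -/

section SmallExtension

variable {k : Type u} [Field k] {A : Type w} [Ring A] [Algebra k A] {r : ℕ}
variable {M : Fin r → Type v} [∀ i, AddCommGroup (M i)] [∀ i, Module k (M i)]
variable [∀ i, Module Aᵐᵒᵖ (M i)] [∀ i, IsScalarTower k Aᵐᵒᵖ (M i)]
variable {S T : PointedAlg k r}

theorem Free.el_mul_el_eq_zero {i j j' l : Fin r} {s t : S.carrier} (h : t * S.e j * s = 0)
    (φ : M j' →ₗ[k] M l) (ψ : M i →ₗ[k] M j) : Free.el A M S s φ * Free.el A M S t ψ = 0 := by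
  by_cases hj : j = j'
  · subst hj
    rw [Free.el_mul_el, h, map_zero, LinearMap.zero_apply]
  · exact Free.el_mul_el_of_ne hj _ _ _ _

theorem Free.coord_act₀ (ℓ : S.carrier →ₗ[k] k) (j : Fin r) (a : A) (z : Free A M S) :
    Free.coord A M ℓ j (Free.act₀ A M S a z) = rightMul k A M j a (Free.coord A M ℓ j z) := by
  induction z using Free.induction with
  | zero => simp
  | add y z hy hz => rw [map_add, map_add, map_add, map_add, hy, hz]
  | of s i m =>
    rw [map_smul, Free.act₀_of]
    by_cases h : i = j
    · subst h
      rw [Free.coord_smul_of, Free.coord_smul_of, map_smul]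
    · rw [Free.coord_smul_of_ne _ h, Free.coord_smul_of_ne _ h, map_zero]

/-- Reduces cochains with values in endomorphisms of S ⊗ ⨁ M_i to Hochschild cochains with values in
Hom_k(M_i, M_j), where Ext¹ is known. -/
theorem Free.entry_diff (ℓ : S.carrier →ₗ[k] k) (i j : Fin r) (a b : A)
    (δ : A →ₗ[k] Module.End S.carrier (Free A M S)) :
    Free.entry A M ℓ i j (Free.diff a b δ) = d1 (Free.entry A M ℓ i j ∘ₗ δ) a b := by
  ext m
  rw [Free.diff_apply, map_add, map_sub]
  simp only [LinearMap.add_apply, LinearMap.sub_apply, Free.entry_apply, Module.End.mul_apply,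
    Free.act₀_of, Free.coord_act₀]
  rfl

/-- The spanning half of the basis property, lifted from cohomology classes to cochains. -/
theorem RepresentsBasis.exists_eq {n : Fin r → Fin r → ℕ}
    {X : ∀ i j : Fin r, Fin (n i j) → C1 k A M i j} (hX : RepresentsBasis k A M X) {i j : Fin r}
    (φ : C1 k A M i j) (hφ : d1 φ = 0) :
    ∃ (c : Fin (n i j) → k) (θ : C0 k M i j), φ = ∑ l, c l • X i j l + d0 θ := by
  obtain ⟨-, b, hb⟩ := hX i j
  let z : Ext1 k A M i j := ⟨(B1 k A M i j).mkQ φ, Submodule.mem_map_of_mem hφ⟩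
  have h1 := congrArg Subtype.val (b.sum_repr z)
  rw [AddSubmonoidClass.coe_finsetSum] at h1
  simp only [Submodule.coe_smul, hb] at h1
  simp only [← map_smul, ← map_sum] at h1
  have h2 : φ - ∑ l, b.repr z l • X i j l ∈ B1 k A M i j := by
    rw [← Submodule.Quotient.mk_eq_zero, ← Submodule.mkQ_apply, map_sub, h1, sub_self]
  obtain ⟨θ, hθ⟩ := h2
  exact ⟨fun l => b.repr z l, θ, by rw [hθ]; abel⟩

namespace Act

/-- The action transported by an automorphism. -/
def conj (ρ : Act A M S) (g : Free A M S ≃ₗ[S.carrier] Free A M S)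
    (hg : ∀ z, Free.proj A M S (g z) = Free.proj A M S z) : Act A M S where
  toLin :=
    { toFun := fun a => g.toLinearMap ∘ₗ ρ.toLin a ∘ₗ g.symm.toLinearMap
      map_add' := fun a b => by ext z; simp
      map_smul' := fun c a => LinearMap.ext fun z => by
        change g (ρ.toLin (c • a) (g.symm z)) = algebraMap k S.carrier c • g (ρ.toLin a (g.symm z))
        rw [← _root_.map_smul g, _root_.map_smul ρ.toLin]
        rfl }
  map_one := LinearMap.ext fun z => by
    change g (ρ.toLin 1 (g.symm z)) = z
    rw [ρ.map_one, Module.End.one_apply, g.apply_symm_apply]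
  map_mul a b := LinearMap.ext fun z => by
    change g (ρ.toLin (a * b) (g.symm z)) = g (ρ.toLin b (g.symm (g (ρ.toLin a (g.symm z)))))
    rw [ρ.map_mul, g.symm_apply_apply]
    rfl
  proj a z := by
    change Free.proj A M S (g (ρ.toLin a (g.symm z))) = _
    rw [hg, ρ.proj, ← hg, g.apply_symm_apply]

theorem conj_apply (ρ : Act A M S) (g : Free A M S ≃ₗ[S.carrier] Free A M S)
    (hg : ∀ z, Free.proj A M S (g z) = Free.proj A M S z) (a : A) (z : Free A M S) :
    (ρ.conj g hg).toLin a (g z) = g (ρ.toLin a z) := by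
  change g (ρ.toLin a (g.symm (g z))) = _
  rw [g.symm_apply_apply]

/-- If an action reduces to `σ` up to equivalence, then an equivalent action reduces to `σ`. -/
theorem exists_map_eq (hT : T.IsArt) (f : T ⟶ S) (hf : Function.Surjective f.toAlgHom)
    {ρ : Act A M T} {σ : Act A M S}
    (h : (Deformation.setoid A M S).r (Deformation.map f ρ.deformation) σ.deformation) :
    ∃ ρ' : Act A M T, (Deformation.setoid A M T).r ρ'.deformation ρ.deformation ∧
      ∀ a z, Free.map A M f (ρ'.toLin a z) = σ.toLin a (Free.map A M f z) := by
  obtain ⟨G, hsmul, hG, hproj⟩ := exists_of_map_rel f h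
  let Gₗ : Free A M T →ₗ[k] Free A M S :=
    { toFun := G
      map_add' := _root_.map_add G
      map_smul' := fun c z => by
        rw [← Free.algebraMap_smul, hsmul, AlgHom.commutes]
        rfl }
  obtain ⟨τ, hτ⟩ := (Free.mapₗ A M f).exists_rightInverse_of_surjective
    (LinearMap.range_eq_top.2 (Free.mapₗ_surjective f hf))
  have hτ' : ∀ z, Free.map A M f (τ z) = z := fun z => LinearMap.congr_fun hτ z
  -- Lift G to an endomorphism over T, using a k-linear section τ on the generators. It reduces to
  -- the identity, so it is an automorphism, and conjugating ρ by it turns equivalence over S into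
  -- equality.
  let g₀ : Free A M T →ₗ[T.carrier] Free A M T := Free.desc fun i => τ ∘ₗ Gₗ ∘ₗ Free.of A M T i
  have hg₀ : ∀ z, Free.map A M f (g₀ z) = G z := by
    intro z
    induction z using Free.induction with
    | zero => simp
    | add y z hy hz => rw [_root_.map_add, _root_.map_add, _root_.map_add, hy, hz]
    | of s i m =>
      have h1 : Free.map A M f (g₀ (Free.of A M T i m)) = G (Free.of A M T i m) := by
        have h2 : g₀ (Free.of A M T i m) = T.e i • τ (G (Free.of A M T i m)) := Free.desc_of _ i m
        rw [h2, Free.map_smul', hτ', ← hsmul, Free.e_smul_of]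
      rw [_root_.map_smul, Free.map_smul', h1, hsmul]
  have hp : ∀ z, Free.proj A M T (g₀ z) = Free.proj A M T z := fun z => by
    rw [← Free.proj_map f, hg₀, hproj]
  let g := LinearEquiv.ofBijective g₀ (Free.bijective_of_proj hT g₀ hp)
  have hp' : ∀ z, Free.proj A M T (g z) = Free.proj A M T z := hp
  refine ⟨ρ.conj g hp', (Deformation.setoid A M T).symm
    (rel_iff.2 ⟨g, fun a z => (ρ.conj_apply g hp' a z).symm, hp'⟩), fun a z => ?_⟩
  obtain ⟨z, rfl⟩ := g.surjective z
  rw [conj_apply]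
  exact (hg₀ _).trans ((hG a z).trans (congrArg (σ.toLin a) (hg₀ z).symm))

end Act

end SmallExtension

/-! ### Curvature and obstructions over a small extension -/

namespace GMMP.Run

variable {k : Type u} [Field k] {A : Type w} [Ring A] [Algebra k A] {r : ℕ}
variable {M : Fin r → Type v} [∀ i, AddCommGroup (M i)] [∀ i, Module k (M i)]
variable [∀ i, Module Aᵐᵒᵖ (M i)] [∀ i, IsScalarTower k Aᵐᵒᵖ (M i)]
variable {n : Fin r → Fin r → ℕ} {X : ∀ i j : Fin r, Fin (n i j) → C1 k A M i j}
variable (R : (hochschildGMMP k A M).Run X) {S T : PointedAlg k r}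

section Products

variable [Module.Finite k S.carrier] [Module.Finite k T.carrier] {f : T ⟶ S}

/-- D expands into matrix units with coefficients in ker f, which I(T) annihilates on both sides. -/
theorem mul_el_eq_zero (hf : Function.Surjective f.toAlgHom) (hsm : IsSmall f)
    {D : Module.End T.carrier (Free A M T)} (hD : ∀ z, Free.map A M f (D z) = 0) {i j : Fin r}
    {s : T.carrier} (hs : s ∈ T.augIdeal) (φ : M i →ₗ[k] M j) :
    D * Free.el A M T s φ = 0 ∧ Free.el A M T s φ * D = 0 := by
  obtain ⟨d, κ, ℓ, hκ, h⟩ := Free.exists_eq_sum_el (A := A) (M := M) f hf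
  rw [h D hD]
  simp only [Finset.sum_mul, Finset.mul_sum]
  constructor
  · exact Finset.sum_eq_zero fun i _ => Finset.sum_eq_zero fun j _ => Finset.sum_eq_zero fun t _ =>
      Free.el_mul_el_eq_zero (hsm.mul_eq_zero hs (hκ t) _) _ _
  · exact Finset.sum_eq_zero fun i _ => Finset.sum_eq_zero fun j _ => Finset.sum_eq_zero fun t _ =>
      Free.el_mul_el_eq_zero (hsm.mul_eq_zero' hs (hκ t) _) _ _

theorem mul_eq_zero (hf : Function.Surjective f.toAlgHom) (hsm : IsSmall f)
    {D D' : Module.End T.carrier (Free A M T)} (hD : ∀ z, Free.map A M f (D z) = 0)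
    (hD' : ∀ z, Free.map A M f (D' z) = 0) : D * D' = 0 := by
  obtain ⟨d, κ, ℓ, hκ, h⟩ := Free.exists_eq_sum_el (A := A) (M := M) f hf
  rw [h D' hD']
  simp only [Finset.mul_sum]
  exact Finset.sum_eq_zero fun i _ => Finset.sum_eq_zero fun j _ => Finset.sum_eq_zero fun t _ =>
    (mul_el_eq_zero hf hsm hD (mem_augIdeal_of_map_eq_zero f (hκ t)) _).1

theorem mul_pert_eq_zero (hf : Function.Surjective f.toAlgHom) (hsm : IsSmall f)
    {D : Module.End T.carrier (Free A M T)} (hD : ∀ z, Free.map A M f (D z) = 0) (N : ℕ)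
    (ψ : freePt k n ⟶ T) (a : A) : D * R.pert N ψ a = 0 ∧ R.pert N ψ a * D = 0 := by
  rw [pert_apply]
  simp only [Finset.sum_mul, Finset.mul_sum]
  constructor
  · exact Finset.sum_eq_zero fun i _ => Finset.sum_eq_zero fun j _ => Finset.sum_eq_zero fun u hu =>
      (mul_el_eq_zero hf hsm hD (R.ev_val_mem ψ hu) _).1
  · exact Finset.sum_eq_zero fun i _ => Finset.sum_eq_zero fun j _ => Finset.sum_eq_zero fun u hu =>
      (mul_el_eq_zero hf hsm hD (R.ev_val_mem ψ hu) _).2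

/-- The curvature of an action which agrees with `act₀ + pert` over the quotient by a small
ideal. -/
theorem diff_add_of_act (hf : Function.Surjective f.toAlgHom) (hsm : IsSmall f) (N : ℕ)
    (ψ : freePt k n ⟶ T) (ρ : Act A M T) (δ : A →ₗ[k] Module.End T.carrier (Free A M T))
    (hρ : ρ.toLin = Free.act₀ A M T + (R.pert N ψ + δ))
    (hδ : ∀ a z, Free.map A M f (δ a z) = 0) (a b : A) :
    Free.diff a b δ + (Free.diff a b (R.pert N ψ) + R.pert N ψ b * R.pert N ψ a) = 0 := by
  have h := ρ.map_mul a b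
  -- In the Maurer–Cartan equation of pert + δ every product containing δ vanishes by smallness, so
  -- δ enters only through its differential.
  rw [hρ, Free.act₀_add_mul_iff, map_add, LinearMap.add_apply, LinearMap.add_apply, add_mul,
    mul_add, mul_add, mul_eq_zero hf hsm (hδ b) (hδ a),
    (R.mul_pert_eq_zero hf hsm (hδ b) N ψ a).1, (R.mul_pert_eq_zero hf hsm (hδ a) N ψ b).2] at h
  rw [← h]
  abel

/-- The existence of an action over T forces the obstructions to vanish. The products of 𝔪 and
J_{N+1} die by smallness. For f_y, the entries of the curvature of pert are coboundaries, namely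
those of -δ, hence are annihilated by y. Since y also annihilates every d v_u, what remains says
that ℓ(ψ(f_y)) = 0 for each linear form ℓ on T. -/
theorem kills_of_act (hf : Function.Surjective f.toAlgHom) (hsm : IsSmall f) (N : ℕ)
    (ψ : freePt k n ⟶ T) (hψ : R.Kills (N + 1) (CategoryTheory.CategoryStruct.comp ψ f))
    (ρ : Act A M T) (δ : A →ₗ[k] Module.End T.carrier (Free A M T))
    (hρ : ρ.toLin = Free.act₀ A M T + (R.pert (N + 1) ψ + δ))
    (hδ : ∀ a z, Free.map A M f (δ a z) = 0) : R.Kills (N + 2) ψ := by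
  have hJ : ∀ b ∈ (hochschildGMMP k A M).relIdeal R.B R.v (N + 1),
      ∀ a ∈ FreeMat.maxIdeal k n, ev ψ (a * b) = 0 ∧ ev ψ (b * a) = 0 := by
    intro b hb a ha
    have h := hsm (ev ψ b) (hψ b hb) _ (ev_mem_augIdeal ψ ha)
    rw [map_mul (ev ψ), map_mul (ev ψ)]
    exact ⟨h.2, h.1⟩
  have hobs : ∀ (i j : Fin r) (y : C2 k A M i j →ₗ[k] k), y ∘ₗ d1 = 0 →
      ev ψ ((hochschildGMMP k A M).obstr R.B R.v (N + 1) y) = 0 := by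
    intro i j y hy
    have hy' : ∀ φ, y (d1 φ) = 0 := fun φ => LinearMap.congr_fun hy φ
    refine (Module.forall_dual_apply_eq_zero_iff k _).1 fun ℓ => ?_
    have h1 : d1 (Free.entry A M ℓ i j ∘ₗ δ) +
        (∑ z ∈ monos R.B (N + 1) i j, ℓ (ev ψ (z.2.val k)) • d1 (R.cochain z.2) +
          ∑ z ∈ pairs R.B (N + 1) i j, ℓ (ev ψ (z.2.1.val k * z.2.2.val k)) •
            NCDef.cup (R.cochain z.2.1) (R.cochain z.2.2)) = 0 := by
      refine LinearMap.ext fun a => LinearMap.ext fun b => ?_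
      have h2 := congrArg (Free.entry A M ℓ i j)
        (R.diff_add_of_act hf hsm (N + 1) ψ ρ δ hρ hδ a b)
      rw [map_add, map_add, Free.entry_diff, entry_diff_pert, entry_pert_mul_pert, map_zero] at h2
      simpa using h2
    have h3 := congrArg y h1
    simp only [map_add, map_sum, map_smul, hy', smul_zero, Finset.sum_const_zero, zero_add,
      map_zero] at h3
    have h4 : (hochschildGMMP k A M).obstr R.B R.v (N + 1) y =
      ∑ z ∈ pairs R.B (N + 1) i j, y (NCDef.cup (R.cochain z.2.1) (R.cochain z.2.2)) •
        (z.2.1.val k * z.2.2.val k) := obstr_eq (L := hochschildGMMP k A M) (N + 1) y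
    rw [h4, map_sum, map_sum, ← h3]
    refine Finset.sum_congr rfl fun z _ => ?_
    rw [map_smul, map_smul, smul_eq_mul, smul_eq_mul, mul_comm]
  have hle : (hochschildGMMP k A M).relIdeal R.B R.v (N + 2) ≤ TwoSidedIdeal.ker (ev ψ) := by
    rw [relIdeal, TwoSidedIdeal.span_le]
    rintro z (⟨a, ha, b, hb, rfl | rfl⟩ | ⟨i, j, y, hy, rfl⟩)
    · exact (TwoSidedIdeal.mem_ker _).2 (hJ b hb a ha).1
    · exact (TwoSidedIdeal.mem_ker _).2 (hJ b hb a ha).2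
    · exact (TwoSidedIdeal.mem_ker _).2 (hobs i j y hy)
  exact fun t ht => (TwoSidedIdeal.mem_ker _).1 (hle ht)

end Products

/-- Two lifts of a morphism along a small extension agree on `J_1`. -/
theorem ev_eq_of_mem {f : T ⟶ S} (hsm : IsSmall f) {ψ ψ' : freePt k n ⟶ T}
    (h : CategoryTheory.CategoryStruct.comp ψ f = CategoryTheory.CategoryStruct.comp ψ' f)
    {t : FreeMat k n} (ht : t ∈ (hochschildGMMP k A M).relIdeal R.B R.v 1) :
    ev ψ t = ev ψ' t := by
  have hK : ∀ s, f.toAlgHom (ev ψ s - ev ψ' s) = 0 := fun s => by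
    rw [map_sub, ← ev_comp, ← ev_comp, h, sub_self]
  have hl : ∀ s, ∀ a ∈ FreeMat.maxIdeal k n, ev ψ s * ev ψ a = ev ψ' s * ev ψ a := by
    intro s a ha
    rw [← sub_eq_zero, ← sub_mul]
    exact (hsm _ (hK s) _ (ev_mem_augIdeal ψ ha)).1
  have hr : ∀ s, ∀ a ∈ FreeMat.maxIdeal k n, ev ψ' a * ev ψ s = ev ψ' a * ev ψ' s := by
    intro s a ha
    rw [← sub_eq_zero, ← mul_sub]
    exact (hsm _ (hK s) _ (ev_mem_augIdeal ψ' ha)).2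
  -- The condition of lying in 𝔪 makes the locus of agreement an ideal: the two values of an
  -- arbitrary factor differ by an element of ker f, which an element of I(T) annihilates.
  let I : TwoSidedIdeal (FreeMat k n) := TwoSidedIdeal.mk'
    {t | t ∈ FreeMat.maxIdeal k n ∧ ev ψ t = ev ψ' t}
    ⟨zero_mem _, by rw [map_zero, map_zero]⟩
    (fun {a b} ha hb => ⟨add_mem ha.1 hb.1, by rw [map_add, map_add, ha.2, hb.2]⟩)
    (fun {a} ha => ⟨neg_mem ha.1, by rw [map_neg, map_neg, ha.2]⟩)
    (fun {s a} ha => ⟨TwoSidedIdeal.mul_mem_left _ _ _ ha.1, by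
      rw [map_mul (ev ψ), map_mul (ev ψ'), hl s a ha.1, ha.2]⟩)
    (fun {a s} ha => ⟨TwoSidedIdeal.mul_mem_right _ _ _ ha.1, by
      rw [map_mul (ev ψ), map_mul (ev ψ'), ha.2, hr s a ha.1]⟩)
  have hle : (hochschildGMMP k A M).relIdeal R.B R.v 1 ≤ I := by
    rw [relIdeal, TwoSidedIdeal.span_le]
    rintro _ ⟨a, ha, b, hb, rfl⟩
    refine (TwoSidedIdeal.mem_mk' _ _ _ _ _ _ _).2
      ⟨TwoSidedIdeal.mul_mem_left _ _ _ hb, ?_⟩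
    rw [map_mul (ev ψ), map_mul (ev ψ'), hl a b hb, hr b a ha]
  exact ((TwoSidedIdeal.mem_mk' _ _ _ _ _ _ _).1 (hle ht)).2

/-- Monomials of stage at least 2 lie in J_1, where the two lifts agree, so only variables
contribute. Changing a lift thus moves the action by a combination of the chosen cocycles with
coefficients in ker f. -/
theorem pert_sub_pert {f : T ⟶ S} (hsm : IsSmall f) {ψ ψ' : freePt k n ⟶ T}
    (h : CategoryTheory.CategoryStruct.comp ψ f = CategoryTheory.CategoryStruct.comp ψ' f)
    (N : ℕ) (a : A) : R.pert (N + 1) ψ a - R.pert (N + 1) ψ' a = ∑ i, ∑ j, ∑ l : Fin (n i j),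
      Free.el A M T (ev ψ (FreeMat.x k n l) - ev ψ' (FreeMat.x k n l)) (X i j l a) := by
  rw [pert_apply, pert_apply]
  simp only [← Finset.sum_sub_distrib]
  refine Finset.sum_congr rfl fun i _ => Finset.sum_congr rfl fun j _ => ?_
  rw [sum_monos (N + 1) i j fun u => Free.el A M T (ev ψ (u.val k)) (R.cochain u a) -
    Free.el A M T (ev ψ' (u.val k)) (R.cochain u a),
    Finset.sum_eq_single_of_mem 1 (Finset.mem_Icc.2 ⟨le_rfl, by omega⟩)]
  · have hv : ∀ l, R.cochain (Mono.var l) = X i j l := R.v_var i j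
    rw [(R.isStage 1).sum_B_one]
    simp only [Mono.val_var, hv, map_sub, LinearMap.sub_apply]
  · intro c hc hc1
    obtain ⟨c, rfl⟩ : ∃ e, c = e + 2 := ⟨c - 2, by rw [Finset.mem_Icc] at hc; omega⟩
    refine Finset.sum_eq_zero fun u hu => ?_
    rw [R.ev_eq_of_mem hsm h (R.relIdeal_le (by omega) (R.val_mem hu)), sub_self]

end GMMP.Run

/-! ### Smoothness along small extensions -/

section Gauge

variable {k : Type u} [Field k] {A : Type w} [Ring A] [Algebra k A] {r : ℕ}
variable {M : Fin r → Type v} [∀ i, AddCommGroup (M i)] [∀ i, Module k (M i)]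
variable [∀ i, Module Aᵐᵒᵖ (M i)] [∀ i, IsScalarTower k Aᵐᵒᵖ (M i)]
variable {S : PointedAlg k r}

/-- A coboundary becomes a commutator with act₀; this is how it is absorbed into an automorphism 1 +
ν. -/
theorem Free.el_d0 {i j : Fin r} (s : S.carrier) (θ : C0 k M i j) (a : A) :
    Free.el A M S s (d0 θ a) =
      Free.el A M S s θ * Free.act₀ A M S a - Free.act₀ A M S a * Free.el A M S s θ := by
  rw [Free.el_mul_act₀, Free.act₀_mul_el, ← map_sub]
  rfl

end Gauge

namespace GMMP.Run

variable {k : Type u} [Field k] {A : Type w} [Ring A] [Algebra k A] {r : ℕ}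
variable {M : Fin r → Type v} [∀ i, AddCommGroup (M i)] [∀ i, Module k (M i)]
variable [∀ i, Module Aᵐᵒᵖ (M i)] [∀ i, IsScalarTower k Aᵐᵒᵖ (M i)]
variable {n : Fin r → Fin r → ℕ} {X : ∀ i j : Fin r, Fin (n i j) → C1 k A M i j}
variable (R : (hochschildGMMP k A M).Run X) {S T : PointedAlg k r}

/-- Smoothness of the functor represented by `Â_M` over `Def_M` for small extensions. -/
theorem exists_lift_of_isSmall (hX : RepresentsBasis k A M X) (hX' : ∀ i j l, d1 (X i j l) = 0)
    (hT : T.IsArt) (hS : S.IsArt) (f : T ⟶ S) (hf : Function.Surjective f.toAlgHom)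
    (hsm : IsSmall f) (b : R.hull ⟶ S) (ρ : Act A M T)
    (h : (Deformation.setoid A M S).r (Deformation.map f ρ.deformation)
      (R.homAct hX' hS b).deformation) :
    ∃ a : R.hull ⟶ T, CategoryTheory.CategoryStruct.comp a f = b ∧
      (Deformation.setoid A M T).r (R.homAct hX' hT a).deformation ρ.deformation := by
  have := hS.1
  have := hT.1
  obtain ⟨ρ', hρ', hρf⟩ := Act.exists_map_eq hT f hf h
  obtain ⟨N, hN⟩ := R.exists_kills hS b
  obtain ⟨ψ, hψ⟩ := exists_ev_lift f hf (CategoryTheory.CategoryStruct.comp R.ofFreeHom b)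
  -- a lift of the morphism gives an action up to an error in the kernel
  have herr : ∀ (L : ℕ), N ≤ L → ∀ ψ' : freePt k n ⟶ T,
      CategoryTheory.CategoryStruct.comp ψ' f = CategoryTheory.CategoryStruct.comp R.ofFreeHom b →
      ∃ δ : A →ₗ[k] Module.End T.carrier (Free A M T),
        ρ'.toLin = Free.act₀ A M T + (R.pert L ψ' + δ) ∧
        ∀ a z, Free.map A M f (δ a z) = 0 := by
    intro L hL ψ' hψ'
    refine ⟨ρ'.toLin - (Free.act₀ A M T + R.pert L ψ'), by abel, fun a z => ?_⟩
    have h1 := hρf a z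
    rw [R.homAct_eq hX' hS b hN, Kills.act_toLin hX' hS hL hN] at h1
    simp only [LinearMap.sub_apply, LinearMap.add_apply, map_sub, map_add, Free.map_act₀, map_pert,
      hψ', h1, sub_self]
  -- Valid for every lift, so that it applies both to ψ and to the lift modified below.
  have hkill : ∀ ψ' : freePt k n ⟶ T,
      CategoryTheory.CategoryStruct.comp ψ' f = CategoryTheory.CategoryStruct.comp R.ofFreeHom b →
      R.Kills (N + 2) ψ' := by
    intro ψ' hψ'
    obtain ⟨δ, h1, h2⟩ := herr (N + 1) (Nat.le_succ N) ψ' hψ'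
    exact R.kills_of_act hf hsm N ψ' (by rw [hψ']; exact hN.mono (Nat.le_succ N)) ρ' δ h1 h2
  obtain ⟨δ, hδ, hδf⟩ := herr (N + 2) (Nat.le_add_right N 2) ψ hψ
  -- the error consists of cocycles
  have hdiff : ∀ a b, Free.diff a b δ = 0 := fun a b => by
    have h1 := R.diff_add_of_act hf hsm (N + 2) ψ ρ' δ hδ hδf a b
    rwa [(hkill ψ hψ).diff_add hX' a b, add_zero] at h1
  obtain ⟨d, κ, ℓ, hκ, hexp⟩ := Free.exists_eq_sum_el (A := A) (M := M) f hf
  have hcoc : ∀ (t : Fin d) (i j : Fin r), ∃ (c : Fin (n i j) → k) (θ : C0 k M i j),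
      Free.entry A M (ℓ t) i j ∘ₗ δ = ∑ l, c l • X i j l + d0 θ := fun t i j =>
    hX.exists_eq _ (LinearMap.ext fun a => LinearMap.ext fun b => by
      rw [← Free.entry_diff, hdiff, map_zero]
      rfl)
  choose c θ hcθ using hcoc
  -- modification of the lift
  obtain ⟨ψ', hψ'x⟩ := exists_ev_x (S := T) (n := n)
    (fun i j l => ev ψ (FreeMat.x k n l) + T.e i * (∑ t, c t i j l • κ t) * T.e j)
    (fun i j l => by
      rw [mul_add, ← mul_assoc, ← mul_assoc, T.e_mul_self, ← ev_e ψ, ← map_mul, FreeMat.e_mul_x])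
    (fun i j l => by
      rw [add_mul, mul_assoc _ _ (T.e j), T.e_mul_self, ← ev_e ψ j, ← map_mul, FreeMat.x_mul_e])
    (fun i j l => by
      refine add_mem (ev_mem_augIdeal ψ (FreeMat.x_mem_maxIdeal l)) (Ideal.mul_mem_right _ _
        (Ideal.mul_mem_left _ _ (sum_mem fun t _ => ?_)))
      rw [PointedAlg.mem_augIdeal, map_smul,
        PointedAlg.mem_augIdeal.1 (mem_augIdeal_of_map_eq_zero f (hκ t)), smul_zero])
  have hψ'f : CategoryTheory.CategoryStruct.comp ψ' f =
      CategoryTheory.CategoryStruct.comp ψ f := ev_ext fun i j l => by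
    rw [ev_comp, ev_comp, hψ'x, map_add, map_mul, map_mul, map_sum]
    simp [hκ]
  have hψ' := hψ'f.trans hψ
  obtain ⟨a, ha⟩ := R.exists_hom ψ'.toAlgHom ψ'.apply_incl ψ'.aug_apply (hkill ψ' hψ')
  have haψ : CategoryTheory.CategoryStruct.comp R.ofFreeHom a = ψ' :=
    PointedAlg.Hom.ext (AlgHom.ext ha)
  refine ⟨a, R.hom_ext hS fun t => ?_, (Deformation.setoid A M T).trans ?_ hρ'⟩
  · have h1 : ev (CategoryTheory.CategoryStruct.comp ψ' f) t =
        ev (CategoryTheory.CategoryStruct.comp R.ofFreeHom b) t := by rw [hψ']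
    rw [ev_comp] at h1
    refine Eq.trans ?_ h1
    exact congrArg f.toAlgHom (ha t)
  · have hka : R.Kills (N + 2) (CategoryTheory.CategoryStruct.comp R.ofFreeHom a) := by
      rw [haψ]
      exact hkill ψ' hψ'
    rw [R.homAct_eq hX' hT a hka]
    -- Collects the cochains θ whose coboundaries occur in the error; 1 + ν is the required
    -- equivalence.
    let ν : Module.End T.carrier (Free A M T) := ∑ i, ∑ j, ∑ t, Free.el A M T (κ t) (θ t i j)
    have hνf : ∀ z, Free.map A M f (ν z) = 0 := fun z => by
      simp only [ν, LinearMap.sum_apply, map_sum, Free.map_el, hκ]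
      simp
    have hνp : ∀ z, Free.proj A M T (ν z) = 0 := fun z => by
      rw [← Free.proj_map f, hνf, map_zero]
    have hgp : ∀ z, Free.proj A M T ((1 + ν) z) = Free.proj A M T z := fun z => by
      rw [LinearMap.add_apply, map_add, hνp, add_zero]
      rfl
    have hσ : (hka.act hX' hT).toLin = Free.act₀ A M T + R.pert (N + 2) ψ' := by
      rw [Kills.act_toLin hX' hT le_rfl hka, haψ]
    -- The Ext¹ part of the error is the effect of changing ψ to ψ', and the coboundary part is the
    -- commutator of ν with act₀.
    have hdec : ∀ a, δ a = R.pert (N + 2) ψ' a - R.pert (N + 2) ψ a +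
        (ν * Free.act₀ A M T a - Free.act₀ A M T a * ν) := by
      intro a
      have h0 : ∀ (i j : Fin r) (l : Fin (n i j)),
          Free.el A M T (ev ψ' (FreeMat.x k n l) - ev ψ (FreeMat.x k n l)) (X i j l a) =
            Free.el A M T (∑ t, c t i j l • κ t) (X i j l a) := fun i j l => by
        rw [hψ'x, add_sub_cancel_left, Free.el_mul_e, Free.el_e_mul]
      rw [R.pert_sub_pert hsm hψ'f, hexp (δ a) (hδf a)]
      have h1 : ∀ t i j, Free.entry A M (ℓ t) i j (δ a) = ∑ l, c t i j l • X i j l a +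
          d0 (θ t i j) a := fun t i j => by
        have h2 := LinearMap.congr_fun (hcθ t i j) a
        simpa using h2
      simp only [ν, Finset.sum_mul, Finset.mul_sum, ← Finset.sum_sub_distrib,
        ← Finset.sum_add_distrib, ← Free.el_d0, h0, h1, map_add]
      refine Finset.sum_congr rfl fun i _ => Finset.sum_congr rfl fun j _ => ?_
      rw [Finset.sum_add_distrib]
      congr 1
      simp only [map_sum, map_smul, LinearMap.sum_apply, LinearMap.smul_apply]
      exact Finset.sum_comm
    have hνν : ∀ a, ν * Free.act₀ A M T a * ν = 0 := fun a => by
      refine mul_eq_zero hf hsm (D := ν * Free.act₀ A M T a) (fun z => ?_) hνf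
      rw [Module.End.mul_apply, hνf]
    -- The products of ν with itself and with the perturbations vanish by smallness, so conjugation
    -- by 1 + ν has only its first-order effect.
    have hcomm : ∀ a, (1 + ν) * (hka.act hX' hT).toLin a = ρ'.toLin a * (1 + ν) := by
      intro a
      have h1 := (R.mul_pert_eq_zero hf hsm hνf (N + 2) ψ' a)
      have h2 := (R.mul_pert_eq_zero hf hsm hνf (N + 2) ψ a)
      have h3 : ν * ν = 0 := mul_eq_zero hf hsm hνf hνf
      have h4 : ρ'.toLin a = Free.act₀ A M T a + R.pert (N + 2) ψ' a +
          (ν * Free.act₀ A M T a - Free.act₀ A M T a * ν) := by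
        rw [hδ, LinearMap.add_apply, LinearMap.add_apply, hdec]
        abel
      rw [h4, hσ, LinearMap.add_apply, add_mul, mul_add, mul_add, h1.1, mul_add _ (1 : Module.End _ _),
        add_mul _ _ ν, add_mul _ _ ν, h1.2, sub_mul, hνν, mul_assoc _ ν ν, h3]
      simp only [one_mul, mul_one, mul_zero, add_zero, sub_zero]
      abel
    let g := LinearEquiv.ofBijective (1 + ν) (Free.bijective_of_proj hT _ hgp)
    exact Act.rel_iff.2 ⟨g, fun a z => LinearMap.congr_fun (hcomm a) z, hgp⟩

end GMMP.Run

/-! ### The point k^r and quotients of pointed algebras -/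

namespace PointedAlg

variable {k : Type u} [Field k] {r : ℕ}

/-- The final object `k^r`. -/
def point (k : Type u) [Field k] (r : ℕ) : PointedAlg k r where
  carrier := Fin r → k
  incl := AlgHom.id k _
  aug := AlgHom.id k _
  aug_incl _ := rfl

theorem augIdeal_point : (point k r).augIdeal = ⊥ := by
  rw [eq_bot_iff]
  exact fun a ha => ha

theorem isArt_point : (point k r).IsArt :=
  ⟨inferInstanceAs (Module.Finite k (Fin r → k)), 1, by rw [Submodule.pow_one, augIdeal_point]⟩

/-- The augmentation as a morphism to `k^r`. -/
def toPoint (S : PointedAlg k r) : S ⟶ point k r where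
  toAlgHom := S.aug
  comp_incl := AlgHom.ext S.aug_incl
  aug_comp := rfl

theorem toPoint_surjective (S : PointedAlg k r) : Function.Surjective S.toPoint.toAlgHom :=
  fun c => ⟨S.incl c, S.aug_incl c⟩

theorem eq_toPoint {S : PointedAlg k r} (f : S ⟶ point k r) : f = S.toPoint :=
  Hom.ext (AlgHom.ext fun s => f.aug_apply s)

theorem isSmall_toPoint {S : PointedAlg k r} (h : S.augIdeal ^ 2 = ⊥) : IsSmall S.toPoint := by
  have h0 : ∀ a ∈ S.augIdeal, ∀ b ∈ S.augIdeal, a * b = 0 := by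
    intro a ha b hb
    have h1 := Ideal.mul_mem_mul ha hb
    rw [← Submodule.pow_one S.augIdeal, ← Ideal.IsTwoSided.pow_add, h] at h1
    exact h1
  exact fun c hc s hs => ⟨h0 c hc s hs, h0 s hs c hc⟩

/-- The quotient of a pointed algebra by an ideal. -/
def quot (T : PointedAlg k r) (J : Ideal T.carrier) [J.IsTwoSided] (hJ : J ≤ T.augIdeal) :
    PointedAlg k r where
  carrier := T.carrier ⧸ J
  incl := (Ideal.Quotient.mkₐ k J).comp T.incl
  aug := Ideal.Quotient.liftₐ J T.aug fun _ ha => hJ ha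
  aug_incl := T.aug_incl

def toQuot (T : PointedAlg k r) (J : Ideal T.carrier) [J.IsTwoSided] (hJ : J ≤ T.augIdeal) :
    T ⟶ T.quot J hJ where
  toAlgHom := Ideal.Quotient.mkₐ k J
  comp_incl := rfl
  aug_comp := rfl

def ofQuot {T S : PointedAlg k r} (f : T ⟶ S) (J : Ideal T.carrier) [J.IsTwoSided]
    (hJ : J ≤ T.augIdeal) (hf : ∀ a ∈ J, f.toAlgHom a = 0) : T.quot J hJ ⟶ S where
  toAlgHom := Ideal.Quotient.liftₐ J f.toAlgHom hf
  comp_incl := f.comp_incl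
  aug_comp := AlgHom.ext fun a => by
    obtain ⟨a, rfl⟩ := Ideal.Quotient.mkₐ_surjective k J a
    exact f.aug_apply a

theorem exists_mem_pow {T S : PointedAlg k r} (f : T ⟶ S) (hf : Function.Surjective f.toAlgHom)
    (m : ℕ) {s : S.carrier} (hs : s ∈ S.augIdeal ^ m) : ∃ t ∈ T.augIdeal ^ m, f.toAlgHom t = s := by
  have hf' : Function.Surjective f.toAlgHom.toRingHom := hf
  suffices h : S.augIdeal ^ m ≤ (T.augIdeal ^ m).map f.toAlgHom.toRingHom from
    (Ideal.mem_map_iff_of_surjective _ hf').1 (h hs)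
  clear hs
  induction m with
  | zero =>
    rw [Submodule.pow_zero, Submodule.pow_zero, Ideal.one_eq_top, Ideal.one_eq_top, Ideal.map_top]
  | succ m ih =>
    rw [Ideal.IsTwoSided.pow_succ, Ideal.mul_le]
    intro a ha b hb
    obtain ⟨b, hb', rfl⟩ := (Ideal.mem_map_iff_of_surjective _ hf').1 (ih hb)
    obtain ⟨a, rfl⟩ := hf' a
    rw [← map_mul]
    refine Ideal.mem_map_of_mem _ ?_
    rw [Ideal.IsTwoSided.pow_succ]
    refine Ideal.mul_mem_mul (mem_augIdeal.2 ?_) hb'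
    rw [← f.aug_apply]
    exact ha

theorem IsArt.of_surjective {T S : PointedAlg k r} (hT : T.IsArt) (f : T ⟶ S)
    (hf : Function.Surjective f.toAlgHom) : S.IsArt := by
  obtain ⟨h, m, hm⟩ := hT
  refine ⟨Module.Finite.of_surjective f.toAlgHom.toLinearMap hf, m, eq_bot_iff.2 fun s hs => ?_⟩
  obtain ⟨t, ht, rfl⟩ := exists_mem_pow f hf m hs
  rw [hm] at ht
  rw [Ideal.mem_bot.1 ht, map_zero]
  exact zero_mem _

end PointedAlg

/-! ### Smoothness in general and bijectivity for square-zero augmentation ideals -/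

section Smooth

variable {k : Type u} [Field k] {A : Type w} [Ring A] [Algebra k A] {r : ℕ}
variable {M : Fin r → Type v} [∀ i, AddCommGroup (M i)] [∀ i, Module k (M i)]
variable [∀ i, Module Aᵐᵒᵖ (M i)] [∀ i, IsScalarTower k Aᵐᵒᵖ (M i)]

/-- The equivalence class of the deformation given by an action. -/
def Act.toDef {S : PointedAlg k r} (ρ : Act A M S) : (Def (k := k) A M).obj S :=
  Quotient.mk (Deformation.setoid A M S) ρ.deformation

theorem Act.exists_toDef {S : PointedAlg k r} (ξ : (Def (k := k) A M).obj S) :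
    ∃ ρ : Act A M S, ρ.toDef = ξ := by
  obtain ⟨X, rfl⟩ := Quotient.exists_rep ξ
  obtain ⟨ρ, hρ⟩ := Act.exists_rel X
  exact ⟨ρ, Quotient.sound ((Deformation.setoid A M S).symm hρ)⟩

theorem Act.toDef_eq_iff {S : PointedAlg k r} {ρ σ : Act A M S} :
    ρ.toDef = σ.toDef ↔ (Deformation.setoid A M S).r ρ.deformation σ.deformation :=
  Quotient.eq

theorem Free.proj_point_injective : Function.Injective (Free.proj A M (PointedAlg.point k r)) := by
  intro y z h
  have h0 : ∀ z : Free A M (PointedAlg.point k r), Free.unit A M _ (Free.proj A M _ z) = z := by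
    intro z
    have h1 := Free.sub_unit_mem z
    rw [PointedAlg.augIdeal_point, Submodule.bot_smul, Submodule.mem_bot, sub_eq_zero] at h1
    exact h1.symm
  rw [← h0 y, ← h0 z, h]

/-- Over k^r the reduction is injective on S ⊗ ⨁ M_i, and every action is prescribed after
reduction. -/
theorem Act.subsingleton_point (ξ ξ' : (Def (k := k) A M).obj (PointedAlg.point k r)) :
    ξ = ξ' := by
  obtain ⟨ρ, rfl⟩ := Act.exists_toDef ξ
  obtain ⟨σ, rfl⟩ := Act.exists_toDef ξ'
  refine Act.toDef_eq_iff.2 (Act.rel_iff.2 ⟨LinearEquiv.refl _ _, fun a z => ?_, fun _ => rfl⟩)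
  exact Free.proj_point_injective ((ρ.proj a z).trans (σ.proj a z).symm)

theorem Free.entry_commutator {S : PointedAlg k r} (ℓ : S.carrier →ₗ[k] k) (i j : Fin r)
    (D : Module.End S.carrier (Free A M S)) (a : A) :
    Free.entry A M ℓ i j (D * Free.act₀ A M S a - Free.act₀ A M S a * D) =
      d0 (Free.entry A M ℓ i j D) a := by
  ext m
  rw [map_sub]
  simp only [LinearMap.sub_apply, Free.entry_apply, Module.End.mul_apply,
    Free.act₀_of, Free.coord_act₀]
  rfl

/-- The independence half of the basis property: no nontrivial combination of the x_ij(l) is a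
coboundary. -/
theorem RepresentsBasis.eq_zero {n : Fin r → Fin r → ℕ}
    {X : ∀ i j : Fin r, Fin (n i j) → C1 k A M i j} (hX : RepresentsBasis k A M X) {i j : Fin r}
    (c : Fin (n i j) → k) (θ : C0 k M i j) (h : ∑ l, c l • X i j l + d0 θ = 0) (l : Fin (n i j)) :
    c l = 0 := by
  obtain ⟨-, b, hb⟩ := hX i j
  refine Fintype.linearIndependent_iff.1 b.linearIndependent c ?_ l
  apply Subtype.ext
  rw [AddSubmonoidClass.coe_finsetSum]
  simp only [Submodule.coe_smul, hb]
  simp only [← map_smul, ← map_sum]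
  rw [eq_neg_of_add_eq_zero_left h, map_neg, Submodule.mkQ_apply,
    (Submodule.Quotient.mk_eq_zero _).2 (LinearMap.mem_range_self d0 θ), neg_zero]
  rfl

end Smooth

namespace GMMP.Run

variable {k : Type u} [Field k] {A : Type w} [Ring A] [Algebra k A] {r : ℕ}
variable {M : Fin r → Type v} [∀ i, AddCommGroup (M i)] [∀ i, Module k (M i)]
variable [∀ i, Module Aᵐᵒᵖ (M i)] [∀ i, IsScalarTower k Aᵐᵒᵖ (M i)]
variable {n : Fin r → Fin r → ℕ} {X : ∀ i j : Fin r, Fin (n i j) → C1 k A M i j}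
variable (R : (hochschildGMMP k A M).Run X) {S T : PointedAlg k r}

theorem map_toDef_homAct (hX : ∀ i j l, d1 (X i j l) = 0) (hT : T.IsArt) (hS : S.IsArt)
    (f : T ⟶ S) (a : R.hull ⟶ T) :
    (R.homAct hX hS (CategoryTheory.CategoryStruct.comp a f)).toDef =
      (Def (k := k) A M).map f (R.homAct hX hT a).toDef :=
  Eq.symm (Quotient.sound (Act.map_rel f (R.map_homAct hX hT hS a f)))

/-- Smoothness of the functor represented by `Â_M` over `Def_M`. -/
theorem exists_lift (hX : RepresentsBasis k A M X) (hX' : ∀ i j l, d1 (X i j l) = 0) (m : ℕ)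
    (hT : T.IsArt) (hS : S.IsArt) (f : T ⟶ S) (hf : Function.Surjective f.toAlgHom)
    (hm : ∀ c ∈ T.augIdeal ^ m, f.toAlgHom c = 0 → c = 0) (b : R.hull ⟶ S)
    (ξ : (Def (k := k) A M).obj T)
    (hξ : (Def (k := k) A M).map f ξ = (R.homAct hX' hS b).toDef) :
    ∃ a : R.hull ⟶ T, CategoryTheory.CategoryStruct.comp a f = b ∧
      (R.homAct hX' hT a).toDef = ξ := by
  have small : ∀ (T S : PointedAlg k r) (hT : T.IsArt) (hS : S.IsArt) (f : T ⟶ S),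
      Function.Surjective f.toAlgHom → IsSmall f → ∀ (b : R.hull ⟶ S)
      (ξ : (Def (k := k) A M).obj T),
      (Def (k := k) A M).map f ξ = (R.homAct hX' hS b).toDef →
      ∃ a : R.hull ⟶ T, CategoryTheory.CategoryStruct.comp a f = b ∧
        (R.homAct hX' hT a).toDef = ξ := by
    intro T S hT hS f hf hsm b ξ hξ
    obtain ⟨ρ, rfl⟩ := Act.exists_toDef ξ
    obtain ⟨a, ha, h⟩ := R.exists_lift_of_isSmall hX hX' hT hS f hf hsm b ρ (Quotient.exact hξ)
    exact ⟨a, ha, Quotient.sound h⟩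
  -- Induction on m, where `hm` says that ker f meets I(T)^m trivially; for m = 0 the map f is
  -- injective. Otherwise put J = ker f ∩ I(T)^m. The map T → T / J is small, since I(T) J and J
  -- I(T) lie in ker f ∩ I(T)^{m+1} = 0, and T / J → S satisfies the hypothesis for m.
  induction m generalizing T with
  | zero =>
    refine small T S hT hS f hf (fun c hc s _ => ?_) b ξ hξ
    rw [hm c (by rw [Submodule.pow_zero, Ideal.one_eq_top]; trivial) hc, zero_mul, mul_zero]
    exact ⟨rfl, rfl⟩
  | succ m ih =>
    let J : Ideal T.carrier := RingHom.ker f.toAlgHom ⊓ T.augIdeal ^ m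
    have hJ2 : J.IsTwoSided := ⟨fun {a} c ha =>
      ⟨Ideal.mul_mem_right c (RingHom.ker f.toAlgHom) ha.1,
        Ideal.mul_mem_right c (T.augIdeal ^ m) ha.2⟩⟩
    have hJ : J ≤ T.augIdeal := fun c hc => mem_augIdeal_of_map_eq_zero f hc.1
    let p := T.toQuot J hJ
    let q := PointedAlg.ofQuot f J hJ fun c hc => hc.1
    have hp : Function.Surjective p.toAlgHom := Ideal.Quotient.mkₐ_surjective k J
    have hp0 : ∀ c, p.toAlgHom c = 0 ↔ c ∈ J := fun c => Ideal.Quotient.eq_zero_iff_mem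
    have hqp : ∀ c, q.toAlgHom (p.toAlgHom c) = f.toAlgHom c := fun c => rfl
    have hq : Function.Surjective q.toAlgHom := fun s => by
      obtain ⟨t, rfl⟩ := hf s
      exact ⟨p.toAlgHom t, hqp t⟩
    have hpq : CategoryTheory.CategoryStruct.comp p q = f :=
      PointedAlg.Hom.ext (AlgHom.ext hqp)
    have hQ : (T.quot J hJ).IsArt := hT.of_surjective p hp
    have hsm : IsSmall p := by
      intro c hc s hs
      have hc' := (hp0 c).1 hc
      constructor
      · refine hm _ ?_ (Ideal.mul_mem_right s (RingHom.ker f.toAlgHom) hc'.1)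
        rw [Ideal.IsTwoSided.pow_add, Submodule.pow_one]
        exact Ideal.mul_mem_mul hc'.2 hs
      · refine hm _ ?_ (Ideal.mul_mem_left (RingHom.ker f.toAlgHom) s hc'.1)
        rw [Ideal.IsTwoSided.pow_succ]
        exact Ideal.mul_mem_mul hs hc'.2
    obtain ⟨a', ha', hξ'⟩ := ih hQ q hq (fun c hc hqc => by
        obtain ⟨t, ht, rfl⟩ := PointedAlg.exists_mem_pow p hp m hc
        exact (hp0 t).2 ⟨hqc, ht⟩)
      ((Def (k := k) A M).map p ξ) (by
        rw [← hξ, ← hpq]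
        exact ((Def (k := k) A M).map_comp_apply p q ξ).symm)
    obtain ⟨a, ha, hξa⟩ := small T _ hT hQ p hp hsm a' ξ hξ'.symm
    exact ⟨a, by rw [← hpq, ← CategoryTheory.Category.assoc, ha, ha'], hξa⟩

/-- Smoothness along S → k^r, over which all deformations are equivalent. -/
theorem toDef_homAct_surjective (hX : RepresentsBasis k A M X)
    (hX' : ∀ i j l, d1 (X i j l) = 0) (hS : S.IsArt) :
    Function.Surjective fun a : R.hull ⟶ S => (R.homAct hX' hS a).toDef := by
  intro ξ
  have ⟨m, hm⟩ := hS.2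
  obtain ⟨a, -, h⟩ := R.exists_lift hX hX' m hS PointedAlg.isArt_point S.toPoint
    S.toPoint_surjective (fun c hc _ => by rwa [hm] at hc) R.hull.toPoint ξ
    (Act.subsingleton_point _ _)
  exact ⟨a, h⟩

/-- As I(S)² = 0, the map S → k^r is small. An equivalence 1 + ν between the two actions therefore
exhibits ∑ (ψ(x) - ψ'(x)) X as a commutator of act₀ with ν. Entrywise this is a coboundary, so
independence in Ext¹ forces ψ and ψ' to agree on the variables. -/
theorem toDef_homAct_injective (hX : RepresentsBasis k A M X)
    (hX' : ∀ i j l, d1 (X i j l) = 0) (hS : S.IsArt) (h2 : S.augIdeal ^ 2 = ⊥) :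
    Function.Injective fun a : R.hull ⟶ S => (R.homAct hX' hS a).toDef := by
  intro a a' h
  have := hS.1
  have : Module.Finite k (PointedAlg.point k r).carrier := PointedAlg.isArt_point.1
  have hf := S.toPoint_surjective
  have hsm := PointedAlg.isSmall_toPoint h2
  obtain ⟨g, hg, hgp⟩ := Act.rel_iff.1 (Act.toDef_eq_iff.1 h)
  obtain ⟨N, hN⟩ := R.exists_kills hS a
  obtain ⟨N', hN'⟩ := R.exists_kills hS a'
  have hL : N ≤ N + N' + 1 := by omega
  have hL' : N' ≤ N + N' + 1 := by omega
  set ψ := CategoryTheory.CategoryStruct.comp R.ofFreeHom a with hψ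
  set ψ' := CategoryTheory.CategoryStruct.comp R.ofFreeHom a' with hψ'
  have hψψ' : CategoryTheory.CategoryStruct.comp ψ S.toPoint =
      CategoryTheory.CategoryStruct.comp ψ' S.toPoint :=
    (PointedAlg.eq_toPoint _).trans (PointedAlg.eq_toPoint _).symm
  let ν : Module.End S.carrier (Free A M S) := g.toLinearMap - 1
  have hνf : ∀ z, Free.map A M S.toPoint (ν z) = 0 := fun z => by
    apply Free.proj_point_injective
    rw [Free.proj_map, map_zero]
    change Free.proj A M S (g z - z) = 0
    rw [map_sub, hgp, sub_self]
  have hcomm : ∀ c, (1 + ν) * (Free.act₀ A M S c + R.pert (N + N' + 1) ψ c) =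
      (Free.act₀ A M S c + R.pert (N + N' + 1) ψ' c) * (1 + ν) := by
    intro c
    rw [R.homAct_eq hX' hS a hN, Kills.act_toLin hX' hS hL hN, R.homAct_eq hX' hS a' hN',
      Kills.act_toLin hX' hS hL' hN'] at hg
    rw [add_sub_cancel]
    exact LinearMap.ext (hg c)
  have hzero : ∀ c, R.pert (N + N' + 1) ψ c - R.pert (N + N' + 1) ψ' c +
      (ν * Free.act₀ A M S c - Free.act₀ A M S c * ν) = 0 := by
    intro c
    have h1 := hcomm c
    rw [add_mul, mul_add ν, (R.mul_pert_eq_zero hf hsm hνf _ ψ c).1, mul_add _ _ ν, add_mul _ _ ν,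
      (R.mul_pert_eq_zero hf hsm hνf _ ψ' c).2, one_mul, mul_one, add_zero, add_zero] at h1
    rw [← sub_eq_zero] at h1
    rw [← h1]
    abel
  have hx : ∀ (i j : Fin r) (l : Fin (n i j)),
      ev ψ (FreeMat.x k n l) = ev ψ' (FreeMat.x k n l) := by
    intro i j l
    rw [← sub_eq_zero]
    refine (Module.forall_dual_apply_eq_zero_iff k _).1 fun ℓ => ?_
    refine hX.eq_zero (fun l => ℓ (ev ψ (FreeMat.x k n l) - ev ψ' (FreeMat.x k n l)))
      (Free.entry A M ℓ i j ν) (LinearMap.ext fun c => ?_) l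
    have h1 := congrArg (Free.entry A M ℓ i j) (hzero c)
    rw [map_add, Free.entry_commutator, R.pert_sub_pert hsm hψψ',
      entry_sum_el ℓ i j (fun i j => (Finset.univ : Finset (Fin (n i j))))
        (fun i j l => ev ψ (FreeMat.x k n l) - ev ψ' (FreeMat.x k n l))
        (fun i j l => X i j l c), map_zero] at h1
    have h3 : ∀ l : Fin (n i j), S.e i * (ev ψ (FreeMat.x k n l) - ev ψ' (FreeMat.x k n l)) *
        S.e j = ev ψ (FreeMat.x k n l) - ev ψ' (FreeMat.x k n l) := fun l => by
      rw [mul_sub, sub_mul]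
      congr 1
      · rw [← ev_e ψ, ← ev_e ψ, ← map_mul, ← map_mul, FreeMat.e_mul_x, FreeMat.x_mul_e]
      · rw [← ev_e ψ', ← ev_e ψ', ← map_mul, ← map_mul, FreeMat.e_mul_x, FreeMat.x_mul_e]
    simp only [h3] at h1
    simpa using h1
  have hψeq : ψ = ψ' := ev_ext hx
  exact R.hom_ext hS fun t => congrArg (fun ψ => ev ψ t) hψeq

end GMMP.Run

end NCDef

theorem mainTheorem1 {k : Type u} [Field k] {A : Type w} [Ring A] [Algebra k A] {r : ℕ}
    (M : Fin r → Type v) [∀ i, AddCommGroup (M i)] [∀ i, Module k (M i)]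
    [∀ i, Module Aᵐᵒᵖ (M i)] [∀ i, IsScalarTower k Aᵐᵒᵖ (M i)]
    (n : Fin r → Fin r → ℕ) (X : ∀ i j : Fin r, Fin (n i j) → NCDef.C1 k A M i j)
    (hX : NCDef.RepresentsBasis k A M X) :
    Nonempty ((NCDef.hochschildGMMP k A M).Run X) ∧
      ∀ R : (NCDef.hochschildGMMP k A M).Run X,
        NCDef.IsProrepHull (NCDef.Def (k := k) A M) R.hull := by
  have hX' : ∀ i j l, NCDef.d1 (X i j l) = 0 := fun i j l => (hX i j).1 l
  refine ⟨NCDef.GMMP.nonempty_run (L := NCDef.hochschildGMMP k A M) X, fun R => ⟨R.isFormal_hull,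
    fun S hS a => (R.homAct hX' hS a).toDef, fun T S hT hS f a => R.map_toDef_homAct hX' hT hS f a,
    fun T S hT hS f hf b ξ hξ => ?_, fun S hS h2 =>
      ⟨R.toDef_homAct_injective hX hX' hS h2, R.toDef_homAct_surjective hX hX' hS⟩⟩⟩
  obtain ⟨m, hm⟩ := hT.2
  -- The intersection of ker f with I(T)^m is trivial because I(T)^m itself is 0.
  exact R.exists_lift hX hX' m hT hS f hf (fun c hc _ => by rwa [hm] at hc) b ξ hξ

end
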